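/- Let $N>2$ be an integer, $1<p<N$ and $R>0$. Let $f:\mathbb R\setminus\{0\}\to\mathbb R$ be odd and locally Lipschitz, and assume: (H1) there are $l>p-1$ and a locally Lipschitz $g_1:\mathbb R\to\mathbb R$ with $f(u)=|u|^{l-1}u+g_1(u)$ for all sufficiently large $|u|$ and $\lim_{u\to\infty}|g_1(u)|/|u|^{l}=0$; (H2) there are $0<m<1$ and a locally Lipschitz $g_2:\mathbb R\to\mathbb R$ with $g_2(0)=0$ and $f(u)=-\frac{1}{|u|^{m-1}u}+g_2(u)$ for all sufficiently small $|u|>0$; (H3) there is $\beta>0$ with $f(\beta)=0$, $f<0$ on $(0,\beta)$ and $f>0$ on $(\beta,\infty)$; (H4) $K:[R,\infty)\to(0,\infty)$ is $C^1$ and there are constants $K_0,K_1>0$ and $\alpha_1\le\alpha$ with $N+\frac{m(N-p)}{p-1}<\alpha_1\le\alpha<2(N-1)$ such that $\frac{rK'(r)}{K(r)}>-\frac{(N-1)p}{p-1}$ and $\frac{K_0}{r^{\alpha}}\le K(r)\le\frac{K_1}{r^{\alpha_1}}$ for all $r\ge R$. Then there is an integer $n_0\ge 0$ such that for every integer $n\ge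 n_0$ the problem $\Delta_p u+K(|x|)f(u)=0$ on $\mathbb R^N\setminus B_R$, $u=0$ on $\partial B_R$, $u\to0$ as $|x|\to\infty$ (where $\Delta_p u=\nabla\cdot(|\nabla u|^{p-2}\nabla u)$ and $B_R$ is the ball of radius $R$ centred at the origin) has a radial solution $u=u(r)$, $r=|x|$, with exactly $n$ zeros on $(R,\infty)$. Here a radial solution is a function $u\in C^1[R,\infty)$ such that $|u|^{-m}\in L^1_{loc}[R,\infty)$ (in particular $u\neq0$ almost everywhere), $u(R)=0$, $\lim_{r\to\infty}u(r)=0$, and $$r^{N-1}|u'(r)|^{p-2}u'(r)=R^{N-1}|u'(R)|^{p-2}u'(R)-\int_R^r t^{N-1}K(t)f(u(t))\,dt\qquad\text{for all } r\ge R,$$ where $|s|^{p-2}s$ is read as $0$ at $s=0$, and the integral converges absolutely. -/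

import Mathlib

open Set Filter Topology MeasureTheory

/-- `f` is odd and locally Lipschitz on `ℝ \ {0}`. The value `f 0` is irrelevant. -/
def OddLocLipschitz (f : ℝ → ℝ) : Prop :=
  (∀ u : ℝ, u ≠ 0 → f (-u) = -f u) ∧ LocallyLipschitzOn ({0}ᶜ : Set ℝ) f

/-- `f u = |u|^(l-1) u + g u` for large `|u|`, with `g` locally Lipschitz on `ℝ`
and `|g u| / |u|^l → 0` as `u → ∞`. -/
def PowerAtInfinity (f : ℝ → ℝ) (l : ℝ) : Prop :=
  ∃ g : ℝ → ℝ, LocallyLipschitz g ∧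
    (∃ M : ℝ, ∀ u : ℝ, M < |u| → f u = |u| ^ (l - 1) * u + g u) ∧
    Tendsto (fun u : ℝ => |g u| / |u| ^ l) atTop (𝓝 0)

/-- `f u = -1 / (|u|^(m-1) u) + g u` for small `u ≠ 0`, with `g` locally Lipschitz on `ℝ`
and `g 0 = 0`. -/
def SingularAtZero (f : ℝ → ℝ) (m : ℝ) : Prop :=
  ∃ g : ℝ → ℝ, LocallyLipschitz g ∧ g 0 = 0 ∧
    ∃ δ : ℝ, 0 < δ ∧
      ∀ u : ℝ, u ≠ 0 → |u| < δ → f u = -(1 / (|u| ^ (m - 1) * u)) + g u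

/-- `f` has a unique positive zero `β`, with `f < 0` on `(0, β)` and `f > 0` on `(β, ∞)`. -/
def UniquePositiveZero (f : ℝ → ℝ) : Prop :=
  ∃ β : ℝ, 0 < β ∧ f β = 0 ∧ (∀ u ∈ Ioo 0 β, f u < 0) ∧ (∀ u ∈ Ioi β, 0 < f u)

/-- `K` is positive and `C¹` on `[R, ∞)`, satisfies `r K' / K > -(N-1) p / (p-1)` there, and
`K₀ r^(-α) ≤ K ≤ K₁ r^(-α₁)` for some positive constants `K₀, K₁`. -/
def WeightCondition (N : ℕ) (p R α α₁ : ℝ) (K : ℝ → ℝ) : Prop :=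
  ContDiffOn ℝ 1 K (Ici R) ∧ (∀ r ∈ Ici R, 0 < K r) ∧
    (∀ r ∈ Ici R, -(((N : ℝ) - 1) * p / (p - 1)) < r * derivWithin K (Ici R) r / K r) ∧
    ∃ K₀ K₁ : ℝ, 0 < K₀ ∧ 0 < K₁ ∧
      ∀ r ∈ Ici R, K₀ / r ^ α ≤ K r ∧ K r ≤ K₁ / r ^ α₁

/-- `Φ_p(x) = |x|^(p-2) x`. -/
noncomputable def pPhi (p x : ℝ) : ℝ := |x| ^ (p - 2) * x

/-- `u ∈ C¹[R, ∞)` is a radial solution, in the integrated sense, of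
`Δ_p u + K(|x|) f(u) = 0` outside the ball of radius `R` in `ℝ^N`, `u = 0` on its boundary and
`u → 0` at infinity. Since `1 / |u|^m` is to be read as `∞` where `u = 0`, its local
integrability includes that `u ≠ 0` almost everywhere. -/
structure IsRadialSolution (N : ℕ) (p R m : ℝ) (f K u : ℝ → ℝ) : Prop where
  contDiffOn : ContDiffOn ℝ 1 u (Ici R)
  ae_ne_zero : ∀ᵐ r ∂(volume.restrict (Ici R)), u r ≠ 0
  locallyIntegrableOn : LocallyIntegrableOn (fun r => 1 / |u r| ^ m) (Ici R)
  intervalIntegrable : ∀ r ∈ Ici R,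
    IntervalIntegrable (fun t => t ^ ((N : ℝ) - 1) * K t * f (u t)) volume R r
  integral_eq : ∀ r ∈ Ici R,
    r ^ ((N : ℝ) - 1) * pPhi p (derivWithin u (Ici R) r) =
      R ^ ((N : ℝ) - 1) * pPhi p (derivWithin u (Ici R) R) -
        ∫ t in R..r, t ^ ((N : ℝ) - 1) * K t * f (u t)
  boundary : u R = 0
  tendsto_zero : Tendsto u atTop (𝓝 0)

/-! With c = (N-p)/(p-1), put t = r^(-c), v(t) = u(r), κ = 1/(p-1) and let w be a multiple of the
flux. The equation becomes v' = |w|^(κ-1) w, w' = -h(t) f(v) on (0, T], T = R^(-c), with infinity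
moved to t = 0 (`exists_shootingData`). The lower bound on rK'/K makes h nonincreasing, and the
upper bound on K gives h ≤ A t^(-q) with q + m < 1. One shoots from t = 0 with v(0) = 0, w(0) = a,
and looks for v(T) = 0 with n zeros in (0, T).

The field is singular where v = 0, so f, the power and h are first truncated at a parameter M. Let Ψ
and F be the primitives of the truncated power and of the truncated f. The energy Ψ(w)/h + F(v) is
nondecreasing for t ≥ 1/M, and positive from a small time on. Since F ≤ 0 for |v| ≤ β, this keeps
|w| above some w₀ > 0 there. Hence zeros of v are simple, and they are a fixed distance apart,
because v must leave [-β, β] between two of them. All constants are uniform in M (`uniform_bounds`,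
`Bounds.gap`).

For the slope a = 1 the spacing bounds the number of zeros. For large a the superlinearity of f
forces a zero in every short interval away from t = 0 (`exists_forall_exists_zero`). The Prüfer
angle of (v, w) at T depends continuously on a, so it takes the value (n+1)π for every n ≥ n₀, which
means v(T) = 0 and exactly n interior zeros (`exists_regularized`).

Finally M → ∞ along an ultrafilter. Away from zeros of the limit the force converges locally
uniformly; near a zero the energy controls w even though the force does not stay bounded. Spacing
and simplicity of zeros prevent them from merging, disappearing or being created
(`exists_singularSol`). Undoing the substitution gives the radial solution; the singular term is
integrable because zeros are simple and m < 1. -/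

/-! ### Truncated nonlinearities. -/

/-- Odd regularization of `g`: equal to `g` on `[M⁻¹, M]`, linear near `0`, constant near `∞`. -/
noncomputable def reg (g : ℝ → ℝ) (M x : ℝ) : ℝ :=
  max (-M) (min M x) * (g (max M⁻¹ (min M |x|)) / max M⁻¹ (min M |x|))

section Reg

variable {g : ℝ → ℝ} {M x y : ℝ}

theorem inv_le_self_of_one_le (hM : 1 ≤ M) : M⁻¹ ≤ M :=
  (inv_le_one_of_one_le₀ hM).trans hM

theorem reg_neg (hM : 1 ≤ M) (x : ℝ) : reg g M (-x) = -reg g M x := by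
  unfold reg
  rw [abs_neg, ← neg_mul]
  congr 1
  grind

theorem reg_zero (hM : 1 ≤ M) : reg g M 0 = 0 := by
  have h := reg_neg (g := g) hM 0
  rw [neg_zero] at h
  linarith

theorem reg_of_mem (hM : 1 ≤ M) (h1 : M⁻¹ ≤ x) (h2 : x ≤ M) : reg g M x = g x := by
  have h0 : 0 < x := (inv_pos.2 (by linarith)).trans_le h1
  have : max (-M) (min M x) = x := by grind
  have h' : max M⁻¹ (min M |x|) = x := by rw [abs_of_pos h0]; grind
  rw [reg, this, h', mul_div_cancel₀ _ h0.ne']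

theorem reg_of_le_inv (hM : 1 ≤ M) (h0 : 0 ≤ x) (h1 : x ≤ M⁻¹) :
    reg g M x = x * (g M⁻¹ * M) := by
  have hi := inv_le_self_of_one_le hM
  have : max (-M) (min M x) = x := by grind
  have h' : max M⁻¹ (min M |x|) = M⁻¹ := by rw [abs_of_nonneg h0]; grind
  rw [reg, this, h', div_inv_eq_mul]

theorem reg_of_ge (hM : 1 ≤ M) (h : M ≤ x) : reg g M x = g M := by
  have hi := inv_le_self_of_one_le hM
  have : max (-M) (min M x) = M := by grind
  have h' : max M⁻¹ (min M |x|) = M := by rw [abs_of_nonneg (by linarith)]; grind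
  rw [reg, this, h', mul_div_cancel₀ _ (by linarith)]

/-- Both factors of `reg`, the clamped variable and the quotient g(y)/y at a clamped point, are
bounded and Lipschitz. These global bounds allow the truncated system to be solved on all of [0, T]
at once. -/
theorem exists_lipschitz_bound_reg (hg : LocallyLipschitzOn (Ioi 0) g) (hM : 1 ≤ M) :
    ∃ L B : ℝ, 0 ≤ L ∧ 0 ≤ B ∧ (∀ x y, |reg g M x - reg g M y| ≤ L * |x - y|) ∧
      ∀ x, |reg g M x| ≤ B := by
  have hM0 : 0 < M := by linarith
  have hi : 0 < M⁻¹ := inv_pos.2 hM0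
  have hii := inv_le_self_of_one_le hM
  have hsub : Icc M⁻¹ M ⊆ Ioi 0 := fun x hx => hi.trans_le hx.1
  obtain ⟨L, hL⟩ := (hg.mono hsub).exists_lipschitzOnWith_of_compact isCompact_Icc
  obtain ⟨B, hB⟩ := isCompact_Icc.exists_bound_of_continuousOn ((hg.mono hsub).continuousOn)
  have hB0 : 0 ≤ B := (norm_nonneg _).trans (hB M ⟨hii, le_rfl⟩)
  have hL' : ∀ x ∈ Icc M⁻¹ M, ∀ y ∈ Icc M⁻¹ M, |g x - g y| ≤ L * |x - y| := by
    intro x hx y hy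
    simpa [Real.dist_eq] using hL.dist_le_mul x hx y hy
  have hcl : ∀ x, max M⁻¹ (min M |x|) ∈ Icc M⁻¹ M := fun x => 
    ⟨le_max_left _ _, max_le hii (min_le_left _ _)⟩
  have hinv : ∀ x ∈ Icc M⁻¹ M, x⁻¹ ≤ M := fun x hx => by
    rw [inv_le_comm₀ (hi.trans_le hx.1) hM0]; exact hx.1
  have hq : ∀ x ∈ Icc M⁻¹ M, |g x / x| ≤ B * M := by
    intro x hx
    have hx0 := hi.trans_le hx.1
    rw [abs_div, abs_of_pos hx0, div_eq_mul_inv]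
    exact mul_le_mul (hB x hx) (hinv x hx) (inv_nonneg.2 hx0.le) hB0
  have hqL : ∀ x ∈ Icc M⁻¹ M, ∀ y ∈ Icc M⁻¹ M,
      |g x / x - g y / y| ≤ (L * M + B * M * M) * |x - y| := by
    intro x hx y hy
    have hx0 := hi.trans_le hx.1
    have hy0 := hi.trans_le hy.1
    have e : g x / x - g y / y = (g x - g y) * x⁻¹ - g y / y * (x - y) * x⁻¹ := by
      field_simp
      ring
    rw [e]
    have h1 : |(g x - g y) * x⁻¹| ≤ L * |x - y| * M := by
      rw [abs_mul, abs_of_pos (inv_pos.2 hx0)]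
      exact mul_le_mul (hL' x hx y hy) (hinv x hx) (inv_nonneg.2 hx0.le) (by positivity)
    have h2 : |g y / y * (x - y) * x⁻¹| ≤ B * M * |x - y| * M := by
      rw [abs_mul, abs_of_pos (inv_pos.2 hx0), abs_mul]
      exact mul_le_mul (mul_le_mul_of_nonneg_right (hq y hy) (abs_nonneg _)) (hinv x hx)
        (inv_nonneg.2 hx0.le) (by positivity)
    calc _ ≤ _ := abs_sub _ _
      _ ≤ L * |x - y| * M + B * M * |x - y| * M := add_le_add h1 h2
      _ = _ := by ring
  have hc1 : ∀ x y : ℝ, |max M⁻¹ (min M |x|) - max M⁻¹ (min M |y|)| ≤ |x - y| := by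
    intro x y
    refine (abs_max_sub_max_le_max _ _ _ _).trans ?_
    rw [sub_self, abs_zero]
    refine max_le (abs_nonneg _) ((abs_min_sub_min_le_max _ _ _ _).trans ?_)
    rw [sub_self, abs_zero]
    exact max_le (abs_nonneg _) (abs_abs_sub_abs_le _ _)
  have hc2 : ∀ x y : ℝ, |max (-M) (min M x) - max (-M) (min M y)| ≤ |x - y| := by
    intro x y
    refine (abs_max_sub_max_le_max _ _ _ _).trans ?_
    rw [sub_self, abs_zero]
    refine max_le (abs_nonneg _) ((abs_min_sub_min_le_max _ _ _ _).trans ?_)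
    rw [sub_self, abs_zero]
    exact max_le (abs_nonneg _) le_rfl
  have hb : ∀ x : ℝ, |max (-M) (min M x)| ≤ M := fun x =>
    abs_le.2 ⟨le_max_left _ _, max_le (by linarith) (min_le_left _ _)⟩
  refine ⟨B * M + M * (L * M + B * M * M), M * (B * M), by positivity, by positivity, ?_, ?_⟩
  · intro x y
    unfold reg
    set cx := max (-M) (min M x)
    set cy := max (-M) (min M y)
    set qx := g (max M⁻¹ (min M |x|)) / max M⁻¹ (min M |x|)
    set qy := g (max M⁻¹ (min M |y|)) / max M⁻¹ (min M |y|)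
    have e : cx * qx - cy * qy = (cx - cy) * qx + cy * (qx - qy) := by ring
    rw [e]
    have h1 : |(cx - cy) * qx| ≤ |x - y| * (B * M) := by
      rw [abs_mul]
      exact mul_le_mul (hc2 x y) (hq _ (hcl x)) (abs_nonneg _) (abs_nonneg _)
    have h2 : |cy * (qx - qy)| ≤ M * ((L * M + B * M * M) * |x - y|) := by
      rw [abs_mul]
      refine mul_le_mul (hb y) ((hqL _ (hcl x) _ (hcl y)).trans ?_) (abs_nonneg _) hM0.le
      exact mul_le_mul_of_nonneg_left (hc1 x y) (by positivity)
    calc _ ≤ _ := abs_add_le _ _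
      _ ≤ |x - y| * (B * M) + M * ((L * M + B * M * M) * |x - y|) := add_le_add h1 h2
      _ = _ := by ring
  · intro x
    rw [reg, abs_mul]
    exact mul_le_mul (hb x) (hq _ (hcl x)) (abs_nonneg _) hM0.le

theorem continuous_reg (hg : LocallyLipschitzOn (Ioi 0) g) (hM : 1 ≤ M) :
    Continuous (reg g M) := by
  obtain ⟨L, B, hL, hB, h1, h2⟩ := exists_lipschitz_bound_reg hg hM
  refine (LipschitzWith.of_dist_le_mul (K := L.toNNReal) fun x y => ?_).continuous
  rw [Real.dist_eq, Real.dist_eq, Real.coe_toNNReal _ hL]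
  exact h1 x y

end Reg

section RegPow

variable {κ M x y : ℝ}

theorem locallyLipschitzOn_rpow (κ : ℝ) :
    LocallyLipschitzOn (Ioi 0) (fun x : ℝ => x ^ κ) := by
  intro x hx
  have : ContDiffAt ℝ 1 (fun x : ℝ => x ^ κ) x := Real.contDiffAt_rpow_const_of_ne (ne_of_gt hx)
  obtain ⟨K, t, ht, h⟩ := this.exists_lipschitzOnWith
  exact ⟨K, t, mem_nhdsWithin_of_mem_nhds ht, h⟩

theorem reg_rpow_le_reg_rpow (hκ : 0 < κ) (hM : 1 ≤ M) (hx : 0 ≤ x) (hxy : x ≤ y) :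
    reg (fun x => x ^ κ) M x ≤ reg (fun x => x ^ κ) M y := by
  have hM0 : 0 < M := by linarith
  have hi : 0 < M⁻¹ := inv_pos.2 hM0
  have hii := inv_le_self_of_one_le hM
  have A : ∀ x y, 0 ≤ x → x ≤ y → y ≤ M⁻¹ →
      reg (fun x => x ^ κ) M x ≤ reg (fun x => x ^ κ) M y := by
    intro x y h1 h2 h3
    rw [reg_of_le_inv hM h1 (h2.trans h3), reg_of_le_inv hM (h1.trans h2) h3]
    exact mul_le_mul_of_nonneg_right h2 (by positivity)
  have B : ∀ x y, M⁻¹ ≤ x → x ≤ y → y ≤ M →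
      reg (fun x => x ^ κ) M x ≤ reg (fun x => x ^ κ) M y := by
    intro x y h1 h2 h3
    rw [reg_of_mem hM h1 (h2.trans h3), reg_of_mem hM (h1.trans h2) h3]
    exact Real.rpow_le_rpow (hi.le.trans h1) h2 hκ.le
  have C : ∀ x y, M ≤ x → x ≤ y →
      reg (fun x => x ^ κ) M x ≤ reg (fun x => x ^ κ) M y := by
    intro x y h1 h2
    rw [reg_of_ge hM h1, reg_of_ge hM (h1.trans h2)]
  have D : ∀ x y, M⁻¹ ≤ x → x ≤ y →
      reg (fun x => x ^ κ) M x ≤ reg (fun x => x ^ κ) M y := by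
    intro x y h1 h2
    rcases le_total y M with h | h
    · exact B x y h1 h2 h
    rcases le_total x M with h' | h'
    · exact (B x M h1 h' le_rfl).trans (C M y le_rfl h)
    · exact C x y h' h2
  rcases le_total y M⁻¹ with h | h
  · exact A x y hx hxy h
  rcases le_total x M⁻¹ with h' | h'
  · exact (A x _ hx h' le_rfl).trans (D _ y le_rfl h)
  · exact D x y h' hxy

theorem reg_rpow_nonneg (hκ : 0 < κ) (hM : 1 ≤ M) (hx : 0 ≤ x) :
    0 ≤ reg (fun x => x ^ κ) M x := by
  simpa [reg_zero hM] using reg_rpow_le_reg_rpow hκ hM le_rfl hx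

theorem reg_rpow_pos (hκ : 0 < κ) (hM : 1 ≤ M) (hx : 0 < x) :
    0 < reg (fun x => x ^ κ) M x := by
  have hM0 : 0 < M := by linarith
  have hi : 0 < M⁻¹ := inv_pos.2 hM0
  have h1 : 0 < min x M⁻¹ := lt_min hx hi
  refine lt_of_lt_of_le ?_ (reg_rpow_le_reg_rpow hκ hM h1.le (min_le_left _ _))
  rw [reg_of_le_inv hM h1.le (min_le_right _ _)]
  positivity

/-- The restriction 1 ≤ x matters: for κ > 1 the linear piece near 0 lies above x^κ. -/
theorem reg_rpow_le (hκ : 0 < κ) (hM : 1 ≤ M) (hx : 1 ≤ x) :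
    reg (fun x => x ^ κ) M x ≤ x ^ κ := by
  have hi : M⁻¹ ≤ 1 := inv_le_one_of_one_le₀ hM
  rcases le_total x M with h | h
  · rw [reg_of_mem hM (hi.trans hx) h]
  · rw [reg_of_ge hM h]
    exact Real.rpow_le_rpow (by linarith) h hκ.le

theorem reg_rpow_one (hM : 1 ≤ M) : reg (fun x => x ^ κ) M 1 = 1 := by
  rw [reg_of_mem hM (inv_le_one_of_one_le₀ hM) hM, Real.one_rpow]

theorem abs_reg_rpow (hκ : 0 < κ) (hM : 1 ≤ M) (x : ℝ) :
    |reg (fun x => x ^ κ) M x| = reg (fun x => x ^ κ) M |x| := by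
  rcases le_total 0 x with h | h
  · rw [abs_of_nonneg h, abs_of_nonneg (reg_rpow_nonneg hκ hM h)]
  · rw [abs_of_nonpos h, reg_neg hM, abs_of_nonpos]
    have := reg_rpow_nonneg hκ hM (neg_nonneg.2 h)
    rw [reg_neg hM] at this
    linarith

end RegPow

/-! ### Comparison lemmas from the sign or size of a derivative. -/

theorem le_of_hasDerivAt_nonneg {g g' : ℝ → ℝ} {a b : ℝ} (hab : a ≤ b)
    (hc : ContinuousOn g (Icc a b)) (hd : ∀ t ∈ Ioo a b, HasDerivAt g (g' t) t)
    (h : ∀ t ∈ Ioo a b, 0 ≤ g' t) : g a ≤ g b := by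
  refine monotoneOn_of_deriv_nonneg (convex_Icc a b) hc ?_ ?_ (left_mem_Icc.2 hab)
    (right_mem_Icc.2 hab) hab
  · rw [interior_Icc]
    exact fun t ht => (hd t ht).differentiableAt.differentiableWithinAt
  · rw [interior_Icc]
    intro t ht
    rw [(hd t ht).deriv]
    exact h t ht

theorem sub_le_of_hasDerivAt_le {g g' : ℝ → ℝ} {a b B : ℝ} (hab : a ≤ b)
    (hc : ContinuousOn g (Icc a b)) (hd : ∀ t ∈ Ioo a b, HasDerivAt g (g' t) t)
    (h : ∀ t ∈ Ioo a b, g' t ≤ B) : g b - g a ≤ B * (b - a) := by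
  have e : ∀ t, HasDerivAt (fun t => B * t) B t := fun t => by
    simpa using (hasDerivAt_id t).const_mul B
  have : B * a - g a ≤ B * b - g b :=
    le_of_hasDerivAt_nonneg (g := fun t => B * t - g t) (g' := fun t => B - g' t) hab
      ((continuousOn_const.mul continuousOn_id).sub hc) (fun t ht => (e t).sub (hd t ht))
      (fun t ht => sub_nonneg.2 (h t ht))
  linarith

theorem le_sub_of_le_hasDerivAt {g g' : ℝ → ℝ} {a b B : ℝ} (hab : a ≤ b)
    (hc : ContinuousOn g (Icc a b)) (hd : ∀ t ∈ Ioo a b, HasDerivAt g (g' t) t)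
    (h : ∀ t ∈ Ioo a b, B ≤ g' t) : B * (b - a) ≤ g b - g a := by
  have := sub_le_of_hasDerivAt_le (g := fun t => - g t) (g' := fun t => - g' t) (B := -B) hab
    hc.neg (fun t ht => (hd t ht).neg) (fun t ht => neg_le_neg (h t ht))
  linarith

theorem abs_sub_le_of_abs_hasDerivAt_le {g g' : ℝ → ℝ} {a b B : ℝ} (hab : a ≤ b)
    (hc : ContinuousOn g (Icc a b)) (hd : ∀ t ∈ Ioo a b, HasDerivAt g (g' t) t)
    (h : ∀ t ∈ Ioo a b, |g' t| ≤ B) : |g b - g a| ≤ B * (b - a) := by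
  have h1 := sub_le_of_hasDerivAt_le hab hc hd fun t ht => (abs_le.1 (h t ht)).2
  have h2 := le_sub_of_le_hasDerivAt hab hc hd fun t ht => (abs_le.1 (h t ht)).1
  rw [abs_le]
  constructor <;> linarith

/-- Continuous induction: a strict lower bound that reproduces itself persists. -/
theorem lt_of_forall_lt_imp_lt {g : ℝ → ℝ} {a b c : ℝ} (hc : ContinuousOn g (Icc a b))
    (hstep : ∀ τ ∈ Icc a b, (∀ s ∈ Ico a τ, c < g s) → c < g τ) :
    ∀ t ∈ Icc a b, c < g t := by
  by_contra! hcon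
  obtain ⟨t, ht, hgt⟩ := hcon
  have hcl : IsCompact (Icc a b ∩ g ⁻¹' Iic c) := by
    have := hc.preimage_isClosed_of_isClosed isClosed_Icc (isClosed_Iic (a := c))
    exact isCompact_Icc.of_isClosed_subset this inter_subset_left
  obtain ⟨τ, hτ, hmin⟩ := hcl.exists_isLeast ⟨t, ht, hgt⟩
  have := hstep τ hτ.1 fun s hs => by
    by_contra! h
    exact absurd (hmin ⟨⟨hs.1, hs.2.le.trans hτ.1.2⟩, h⟩) (not_le.2 hs.2)
  exact absurd hτ.2 (not_le.2 this)

theorem integral_zero_neg_of_odd {φ : ℝ → ℝ} (h : ∀ x, φ (-x) = -φ x) (x : ℝ) :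
    ∫ s in (0 : ℝ)..(-x), φ s = ∫ s in (0 : ℝ)..x, φ s := by
  have h1 := intervalIntegral.integral_comp_neg (a := 0) (b := x) φ
  simp only [h, intervalIntegral.integral_neg, neg_zero] at h1
  rw [intervalIntegral.integral_symm, ← h1, neg_neg]

theorem integral_zero_abs_of_odd {φ : ℝ → ℝ} (h : ∀ x, φ (-x) = -φ x) (x : ℝ) :
    ∫ s in (0 : ℝ)..|x|, φ s = ∫ s in (0 : ℝ)..x, φ s := by
  rcases abs_cases x with ⟨h1, -⟩ | ⟨h1, -⟩
  · rw [h1]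
  · rw [h1, integral_zero_neg_of_odd h]

/-! ### The singular initial value problem, its regularization and its energy. -/

/-- Data of the singular initial value problem `v' = |w|^(κ-1) w`, `w' = -h(t) f(v)`,
`v(0) = 0` on `(0, T]`. -/
structure ShootingData where
  (κ m q T β A C : ℝ)
  (f h h' : ℝ → ℝ)
  κ_pos : 0 < κ
  m_pos : 0 < m
  q_nonneg : 0 ≤ q
  mq : q + m < 1
  T_pos : 0 < T
  β_pos : 0 < β
  A_pos : 0 < A
  C_pos : 0 < C
  f_odd : ∀ x, x ≠ 0 → f (-x) = -f x
  f_lip : LocallyLipschitzOn (Ioi 0) f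
  f_nonpos : ∀ x, 0 < x → x ≤ β → f x ≤ 0
  f_nonneg : ∀ x, β ≤ x → 0 ≤ f x
  f_bound : ∀ x, 0 < x → x ≤ β → |f x| ≤ C * x ^ (-m)
  f_super : Tendsto (fun x => f x / x ^ (1 / κ)) atTop atTop
  h_pos : ∀ t ∈ Ioc 0 T, 0 < h t
  h_cont : ContinuousOn h (Ioc 0 T)
  h_deriv : ∀ t ∈ Ioo 0 T, HasDerivAt h (h' t) t
  h'_nonpos : ∀ t ∈ Ioo 0 T, h' t ≤ 0
  h_bound : ∀ t ∈ Ioc 0 T, h t ≤ A * t ^ (-q)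

namespace ShootingData

variable (D : ShootingData)

noncomputable def psi (M : ℝ) : ℝ → ℝ := reg (fun x => x ^ D.κ) M
noncomputable def frc (M : ℝ) : ℝ → ℝ := reg D.f M
noncomputable def wt (M t : ℝ) : ℝ := D.h (max t M⁻¹)
noncomputable def Psi (M x : ℝ) : ℝ := ∫ s in (0 : ℝ)..x, D.psi M s
noncomputable def Frc (M x : ℝ) : ℝ := ∫ s in (0 : ℝ)..x, D.frc M s

/-- The regularization parameter is large enough. -/
structure Adm (M : ℝ) : Prop where
  two_le : 2 ≤ M
  β_le : D.β ≤ M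
  inv_le_β : M⁻¹ ≤ D.β
  inv_le_T : M⁻¹ ≤ D.T

theorem m_lt_one : D.m < 1 := by linarith [D.mq, D.q_nonneg]

theorem eventually_adm : ∀ᶠ M in atTop, D.Adm M := by
  have h := tendsto_inv_atTop_zero (𝕜 := ℝ)
  filter_upwards [eventually_ge_atTop 2, eventually_ge_atTop D.β,
    h.eventually_le_const D.β_pos, h.eventually_le_const D.T_pos] with M h1 h2 h3 h4
  exact ⟨h1, h2, h3, h4⟩

/-- Solutions of the regularized initial value problem. -/
structure Sol (M a : ℝ) (v w : ℝ → ℝ) : Prop where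
  v_zero : v 0 = 0
  w_zero : w 0 = a
  dv : ∀ t ∈ Icc 0 D.T, HasDerivWithinAt v (D.psi M (w t)) (Icc 0 D.T) t
  dw : ∀ t ∈ Icc 0 D.T, HasDerivWithinAt w (-(D.wt M t * D.frc M (v t))) (Icc 0 D.T) t

variable {D} {M x y : ℝ}

namespace Adm

variable (hM : D.Adm M)
include hM

theorem one_le : 1 ≤ M := by linarith [hM.two_le]
theorem pos : 0 < M := by linarith [hM.two_le]
theorem inv_pos : 0 < M⁻¹ := _root_.inv_pos.2 hM.pos
theorem inv_le_half : M⁻¹ ≤ 1 / 2 := by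
  rw [one_div]; exact inv_anti₀ (by norm_num) hM.two_le

theorem continuous_psi : Continuous (D.psi M) :=
  continuous_reg (locallyLipschitzOn_rpow _) hM.one_le

theorem continuous_frc : Continuous (D.frc M) := continuous_reg D.f_lip hM.one_le

theorem psi_neg (x : ℝ) : D.psi M (-x) = -D.psi M x := reg_neg hM.one_le x
theorem frc_neg (x : ℝ) : D.frc M (-x) = -D.frc M x := reg_neg hM.one_le x
theorem psi_zero : D.psi M 0 = 0 := reg_zero hM.one_le
theorem psi_one : D.psi M 1 = 1 := reg_rpow_one hM.one_le
theorem psi_mono (h0 : 0 ≤ x) (h : x ≤ y) : D.psi M x ≤ D.psi M y :=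
  reg_rpow_le_reg_rpow D.κ_pos hM.one_le h0 h
theorem psi_nonneg (h : 0 ≤ x) : 0 ≤ D.psi M x := reg_rpow_nonneg D.κ_pos hM.one_le h
theorem psi_pos (h : 0 < x) : 0 < D.psi M x := reg_rpow_pos D.κ_pos hM.one_le h
theorem psi_le (h : 1 ≤ x) : D.psi M x ≤ x ^ D.κ := reg_rpow_le D.κ_pos hM.one_le h
theorem abs_psi (x : ℝ) : |D.psi M x| = D.psi M |x| := abs_reg_rpow D.κ_pos hM.one_le x
theorem psi_of_mem (h1 : M⁻¹ ≤ x) (h2 : x ≤ M) : D.psi M x = x ^ D.κ :=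
  reg_of_mem hM.one_le h1 h2
theorem frc_of_mem (h1 : M⁻¹ ≤ x) (h2 : x ≤ M) : D.frc M x = D.f x :=
  reg_of_mem hM.one_le h1 h2

theorem psi_eq_zero_iff : D.psi M x = 0 ↔ x = 0 := by
  refine ⟨fun h => ?_, fun h => by rw [h, hM.psi_zero]⟩
  by_contra hx
  have := hM.psi_pos (abs_pos.2 hx)
  rw [← hM.abs_psi, h, abs_zero] at this
  exact lt_irrefl _ this

theorem abs_psi_le {W : ℝ} (hW : 1 ≤ W) (h : |x| ≤ W) : |D.psi M x| ≤ W ^ D.κ := by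
  rw [hM.abs_psi]
  exact (hM.psi_mono (abs_nonneg _) h).trans (hM.psi_le hW)

theorem frc_nonpos (h0 : 0 ≤ x) (h : x ≤ D.β) : D.frc M x ≤ 0 := by
  rcases le_total x M⁻¹ with h' | h'
  · rw [frc, reg_of_le_inv hM.one_le h0 h']
    have := D.f_nonpos _ hM.inv_pos hM.inv_le_β
    exact mul_nonpos_of_nonneg_of_nonpos h0 (mul_nonpos_of_nonpos_of_nonneg this hM.pos.le)
  · rw [hM.frc_of_mem h' (h.trans hM.β_le)]
    exact D.f_nonpos _ (hM.inv_pos.trans_le h') h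

theorem frc_nonneg (h : D.β ≤ x) : 0 ≤ D.frc M x := by
  rcases le_total x M with h' | h'
  · rw [hM.frc_of_mem (hM.inv_le_β.trans h) h']
    exact D.f_nonneg _ h
  · rw [frc, reg_of_ge hM.one_le h']
    exact D.f_nonneg _ hM.β_le

/-- Truncation does not worsen the singular bound: on (0, 1/M] the linear piece is at most C M^m
(xM), where xM ≤ 1 and M^m ≤ x^(-m). -/
theorem abs_frc_le (h0 : 0 < x) (h : x ≤ D.β) : |D.frc M x| ≤ D.C * x ^ (-D.m) := by
  rcases le_total x M⁻¹ with h' | h'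
  · rw [frc, reg_of_le_inv hM.one_le h0.le h']
    have h1 := D.f_bound _ hM.inv_pos hM.inv_le_β
    have h2 : x * M ≤ 1 := by
      have := mul_le_mul_of_nonneg_right h' hM.pos.le
      rwa [inv_mul_cancel₀ hM.pos.ne'] at this
    have h3 : M⁻¹ ^ (-D.m) ≤ x ^ (-D.m) :=
      Real.rpow_le_rpow_of_nonpos h0 h' (by linarith [D.m_pos])
    have h4 : 0 ≤ M⁻¹ ^ (-D.m) := Real.rpow_nonneg hM.inv_pos.le _
    have h5 := D.C_pos
    calc |x * (D.f M⁻¹ * M)| = |D.f M⁻¹| * (x * M) := by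
          rw [abs_mul, abs_mul, abs_of_pos h0, abs_of_pos hM.pos]; ring
      _ ≤ D.C * M⁻¹ ^ (-D.m) * 1 := by
          have := mul_nonneg h0.le hM.pos.le
          gcongr
      _ ≤ D.C * x ^ (-D.m) := by rw [mul_one]; gcongr
  · rw [hM.frc_of_mem h' (h.trans hM.β_le)]
    exact D.f_bound _ h0 h

theorem hasDerivAt_Psi (x : ℝ) : HasDerivAt (D.Psi M) (D.psi M x) x :=
  intervalIntegral.integral_hasDerivAt_right (hM.continuous_psi.intervalIntegrable _ _)
    (hM.continuous_psi.stronglyMeasurableAtFilter _ _) hM.continuous_psi.continuousAt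

theorem hasDerivAt_Frc (x : ℝ) : HasDerivAt (D.Frc M) (D.frc M x) x :=
  intervalIntegral.integral_hasDerivAt_right (hM.continuous_frc.intervalIntegrable _ _)
    (hM.continuous_frc.stronglyMeasurableAtFilter _ _) hM.continuous_frc.continuousAt

theorem continuous_Psi : Continuous (D.Psi M) :=
  continuous_iff_continuousAt.2 fun x => (hM.hasDerivAt_Psi x).continuousAt

theorem continuous_Frc : Continuous (D.Frc M) :=
  continuous_iff_continuousAt.2 fun x => (hM.hasDerivAt_Frc x).continuousAt

theorem Psi_abs (x : ℝ) : D.Psi M |x| = D.Psi M x := integral_zero_abs_of_odd hM.psi_neg x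
theorem Frc_abs (x : ℝ) : D.Frc M |x| = D.Frc M x := integral_zero_abs_of_odd hM.frc_neg x

omit hM in
theorem Psi_zero : D.Psi M 0 = 0 := by simp [Psi]
omit hM in
theorem Frc_zero : D.Frc M 0 = 0 := by simp [Frc]

theorem Psi_sub_ge (h0 : 0 ≤ x) (h : x ≤ y) :
    D.psi M x * (y - x) ≤ D.Psi M y - D.Psi M x :=
  le_sub_of_le_hasDerivAt h hM.continuous_Psi.continuousOn (fun t _ => hM.hasDerivAt_Psi t)
    fun _ ht => hM.psi_mono h0 ht.1.le

theorem Psi_sub_le (h0 : 0 ≤ x) (h : x ≤ y) :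
    D.Psi M y - D.Psi M x ≤ D.psi M y * (y - x) :=
  sub_le_of_hasDerivAt_le h hM.continuous_Psi.continuousOn (fun t _ => hM.hasDerivAt_Psi t)
    fun _ ht => hM.psi_mono (h0.trans ht.1.le) ht.2.le

theorem Psi_mono (h0 : 0 ≤ x) (h : x ≤ y) : D.Psi M x ≤ D.Psi M y := by
  have := hM.Psi_sub_ge h0 h
  have := mul_nonneg (hM.psi_nonneg h0) (sub_nonneg.2 h)
  linarith

theorem Psi_nonneg (x : ℝ) : 0 ≤ D.Psi M x := by
  rw [← hM.Psi_abs, ← Psi_zero (D := D) (M := M)]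
  exact hM.Psi_mono le_rfl (abs_nonneg x)

/-- Ψ has slope at least ψ(1) = 1 beyond 1. This turns bounds on Ψ(w) into bounds on w that do not
involve M. -/
theorem abs_le_Psi_add_one (x : ℝ) : |x| ≤ D.Psi M x + 1 := by
  rcases le_total |x| 1 with h | h
  · linarith [hM.Psi_nonneg x]
  · have h1 := hM.Psi_sub_ge zero_le_one h
    rw [hM.psi_one, hM.Psi_abs] at h1
    linarith [hM.Psi_nonneg 1]

theorem Psi_le_mul (h : 1 ≤ x) : D.Psi M x ≤ x * x ^ D.κ := by
  have h1 := hM.Psi_sub_le le_rfl (zero_le_one.trans h)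
  rw [Psi_zero, sub_zero, sub_zero] at h1
  have := mul_le_mul_of_nonneg_right (hM.psi_le h) (zero_le_one.trans h)
  linarith

theorem Psi_le_self (h0 : 0 ≤ x) (h : x ≤ 1) : D.Psi M x ≤ x := by
  have h1 := hM.Psi_sub_le le_rfl h0
  rw [Psi_zero, sub_zero, sub_zero] at h1
  have h2 := mul_le_mul_of_nonneg_right (hM.psi_mono h0 h) h0
  rw [hM.psi_one] at h2
  linarith

/-- The lower bound must not depend on M: since M ≥ 2, the point 1/2 lies where ψ is the true power,
and ψ ≥ (1/2)^κ on [1/2, 1]. -/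
theorem Psi_one_ge : (1 / 2) ^ D.κ * (1 / 2) ≤ D.Psi M 1 := by
  have h1 := hM.Psi_sub_ge (x := 1 / 2) (y := 1) (by norm_num) (by norm_num)
  rw [hM.psi_of_mem hM.inv_le_half (by linarith [hM.two_le])] at h1
  have := hM.Psi_nonneg (1 / 2)
  norm_num at h1 this ⊢
  linarith

theorem Frc_nonpos (h : |x| ≤ D.β) : D.Frc M x ≤ 0 := by
  have := sub_le_of_hasDerivAt_le (abs_nonneg x) hM.continuous_Frc.continuousOn
    (fun t _ => hM.hasDerivAt_Frc t) (fun t ht => hM.frc_nonpos ht.1.le (ht.2.le.trans h))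
  rw [Frc_zero, hM.Frc_abs] at this
  linarith

theorem neg_le_Frc (h : |x| ≤ D.β) :
    -(D.C / (1 - D.m) * |x| ^ (1 - D.m)) ≤ D.Frc M x := by
  have hm := D.m_lt_one
  have := le_of_hasDerivAt_nonneg (g := fun t => D.Frc M t + D.C / (1 - D.m) * t ^ (1 - D.m))
    (g' := fun t => D.frc M t + D.C * t ^ (-D.m)) (abs_nonneg x)
    (hM.continuous_Frc.add (continuous_const.mul
      (Real.continuous_rpow_const (by linarith)))).continuousOn
    (fun t ht => by
      refine (hM.hasDerivAt_Frc t).add ?_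
      have := (Real.hasDerivAt_rpow_const (x := t) (p := 1 - D.m) (Or.inl ht.1.ne')).const_mul
        (D.C / (1 - D.m))
      refine this.congr_deriv ?_
      have h1 : 1 - D.m ≠ 0 := by linarith
      rw [← mul_assoc, div_mul_cancel₀ _ h1, sub_sub_cancel_left])
    (fun t ht => by
      have := (abs_le.1 (hM.abs_frc_le ht.1 (ht.2.le.trans h))).1
      linarith)
  simp only [Frc_zero, hM.Frc_abs] at this
  rw [Real.zero_rpow (by linarith)] at this
  linarith

theorem abs_Frc_le (h : |x| ≤ D.β) : |D.Frc M x| ≤ D.C / (1 - D.m) * |x| ^ (1 - D.m) := by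
  rw [abs_of_nonpos (hM.Frc_nonpos h)]
  linarith [hM.neg_le_Frc h]

/-- F decreases on [0, β] and increases afterwards, so its infimum is F(β), which is finite
uniformly in M because m < 1. -/
theorem neg_le_Frc_all (x : ℝ) : -(D.C / (1 - D.m) * D.β ^ (1 - D.m)) ≤ D.Frc M x := by
  have hm := D.m_lt_one
  have hC := D.C_pos
  rcases le_total |x| D.β with h | h
  · refine le_trans ?_ (hM.neg_le_Frc h)
    have : |x| ^ (1 - D.m) ≤ D.β ^ (1 - D.m) :=
      Real.rpow_le_rpow (abs_nonneg _) h (by linarith)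
    have h2 : 0 ≤ D.C / (1 - D.m) := div_nonneg hC.le (by linarith)
    exact neg_le_neg (mul_le_mul_of_nonneg_left this h2)
  · have h1 := hM.neg_le_Frc (x := D.β) (by rw [abs_of_pos D.β_pos])
    rw [abs_of_pos D.β_pos] at h1
    have := le_of_hasDerivAt_nonneg h hM.continuous_Frc.continuousOn
      (fun t _ => hM.hasDerivAt_Frc t) (fun t ht => hM.frc_nonneg ht.1.le)
    rw [hM.Frc_abs] at this
    linarith

end Adm

theorem h_antitone {s t : ℝ} (hs : 0 < s) (hst : s ≤ t) (ht : t ≤ D.T) : D.h t ≤ D.h s := by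
  have := sub_le_of_hasDerivAt_le hst
    (D.h_cont.mono fun x hx => ⟨hs.trans_le hx.1, hx.2.trans ht⟩)
    (fun x hx => D.h_deriv x ⟨hs.trans hx.1, hx.2.trans_le ht⟩)
    (fun x hx => D.h'_nonpos x ⟨hs.trans hx.1, hx.2.trans_le ht⟩)
  linarith

theorem Adm.wt_pos (hM : D.Adm M) {t : ℝ} (ht : t ≤ D.T) : 0 < D.wt M t :=
  D.h_pos _ ⟨lt_max_of_lt_right hM.inv_pos, max_le ht hM.inv_le_T⟩

theorem Adm.wt_le (hM : D.Adm M) {t : ℝ} (h0 : 0 < t) (ht : t ≤ D.T) :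
    D.wt M t ≤ D.A * t ^ (-D.q) := by
  refine (D.h_bound _ ⟨lt_max_of_lt_left h0, max_le ht hM.inv_le_T⟩).trans ?_
  exact mul_le_mul_of_nonneg_left (Real.rpow_le_rpow_of_nonpos h0 (le_max_left _ _)
    (neg_nonpos.2 D.q_nonneg)) D.A_pos.le

theorem Adm.continuousOn_wt (hM : D.Adm M) : ContinuousOn (D.wt M) (Icc 0 D.T) := by
  refine D.h_cont.comp (by fun_prop) fun t ht => ?_
  exact ⟨lt_max_of_lt_right hM.inv_pos, max_le ht.2 hM.inv_le_T⟩

theorem wt_of_ge {t : ℝ} (h : M⁻¹ ≤ t) : D.wt M t = D.h t := by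
  rw [wt, max_eq_left h]

namespace Sol

variable {a : ℝ} {v w : ℝ → ℝ} (S : D.Sol M a v w)
include S

theorem continuousOn_v : ContinuousOn v (Icc 0 D.T) := fun t ht => (S.dv t ht).continuousWithinAt
theorem continuousOn_w : ContinuousOn w (Icc 0 D.T) := fun t ht => (S.dw t ht).continuousWithinAt
theorem hasDerivAt_v {t : ℝ} (h0 : 0 < t) (h : t < D.T) : HasDerivAt v (D.psi M (w t)) t :=
  (S.dv t ⟨h0.le, h.le⟩).hasDerivAt (Icc_mem_nhds h0 h)
theorem hasDerivAt_w {t : ℝ} (h0 : 0 < t) (h : t < D.T) :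
    HasDerivAt w (-(D.wt M t * D.frc M (v t))) t :=
  (S.dw t ⟨h0.le, h.le⟩).hasDerivAt (Icc_mem_nhds h0 h)

theorem neg (hM : D.Adm M) : D.Sol M (-a) (fun t => -v t) (fun t => -w t) where
  v_zero := by simp [S.v_zero]
  w_zero := by simp [S.w_zero]
  dv t ht := by rw [hM.psi_neg]; exact (S.dv t ht).neg
  dw t ht := by
    rw [hM.frc_neg, mul_neg]
    exact (S.dw t ht).neg

theorem abs_v_sub_le (hM : D.Adm M) {W s t : ℝ} (hW1 : 1 ≤ W)
    (hW : ∀ t ∈ Icc 0 D.T, |w t| ≤ W) (h0 : 0 ≤ s) (hst : s ≤ t) (ht : t ≤ D.T) :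
    |v t - v s| ≤ W ^ D.κ * (t - s) :=
  abs_sub_le_of_abs_hasDerivAt_le hst
    (S.continuousOn_v.mono (Icc_subset_Icc h0 ht))
    (fun _ hx => S.hasDerivAt_v (h0.trans_lt hx.1) (hx.2.trans_le ht))
    (fun x hx => hM.abs_psi_le hW1 (hW x ⟨h0.trans hx.1.le, hx.2.le.trans ht⟩))

end Sol

/-- `h` times the energy of a solution. -/
noncomputable def en (D : ShootingData) (M : ℝ) (v w : ℝ → ℝ) (t : ℝ) : ℝ :=
  D.Psi M (w t) + D.h t * D.Frc M (v t)

namespace Sol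

variable {a : ℝ} {v w : ℝ → ℝ} (S : D.Sol M a v w) (hM : D.Adm M) {s t B : ℝ}
include S hM

theorem continuousOn_en (h0 : 0 < s) : ContinuousOn (D.en M v w) (Icc s D.T) := by
  have h1 : Icc s D.T ⊆ Icc 0 D.T := Icc_subset_Icc h0.le le_rfl
  exact (hM.continuous_Psi.comp_continuousOn (S.continuousOn_w.mono h1)).add
    ((D.h_cont.mono fun x hx => ⟨h0.trans_le hx.1, hx.2⟩).mul
      (hM.continuous_Frc.comp_continuousOn (S.continuousOn_v.mono h1)))

theorem hasDerivAt_en (h0 : M⁻¹ ≤ t) (h : t < D.T) :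
    HasDerivAt (D.en M v w) (D.h' t * D.Frc M (v t)) t := by
  have ht := hM.inv_pos.trans_le h0
  have h1 := (hM.hasDerivAt_Psi (w t)).comp t (S.hasDerivAt_w ht h)
  have h2 := (D.h_deriv t ⟨ht, h⟩).mul
    ((hM.hasDerivAt_Frc (v t)).comp t (S.hasDerivAt_v ht h))
  have h3 := h1.add h2
  rw [wt_of_ge h0] at h3
  refine h3.congr_deriv ?_
  simp only [Function.comp_apply]
  ring

/-- The derivative of `en` is h' F(v), because the terms in ψ(w) f(v) cancel. Subtracting B h leaves
h' (F(v) - B), whose sign is known since h' ≤ 0. -/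
theorem en_sub_mono (h0 : M⁻¹ ≤ s) (hst : s ≤ t) (ht : t ≤ D.T)
    (hB : ∀ x ∈ Icc s t, D.Frc M (v x) ≤ B) :
    D.en M v w s - B * D.h s ≤ D.en M v w t - B * D.h t := by
  have hs := hM.inv_pos.trans_le h0
  refine le_of_hasDerivAt_nonneg (g := fun x => D.en M v w x - B * D.h x)
    (g' := fun x => D.h' x * D.Frc M (v x) - B * D.h' x) hst ?_ ?_ ?_
  · exact ((S.continuousOn_en hM hs).mono (Icc_subset_Icc le_rfl ht)).sub
      (continuousOn_const.mul (D.h_cont.mono fun x hx => ⟨hs.trans_le hx.1, hx.2.trans ht⟩))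
  · intro x hx
    exact (S.hasDerivAt_en hM (h0.trans hx.1.le) (hx.2.trans_le ht)).sub
      ((D.h_deriv x ⟨hs.trans hx.1, hx.2.trans_le ht⟩).const_mul B)
  · intro x hx
    have h1 := D.h'_nonpos x ⟨hs.trans hx.1, hx.2.trans_le ht⟩
    nlinarith [hB x (Ioo_subset_Icc_self hx)]

theorem en_sub_anti (h0 : M⁻¹ ≤ s) (hst : s ≤ t) (ht : t ≤ D.T)
    (hB : ∀ x ∈ Icc s t, B ≤ D.Frc M (v x)) :
    D.en M v w t - B * D.h t ≤ D.en M v w s - B * D.h s := by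
  have hs := hM.inv_pos.trans_le h0
  have := sub_le_of_hasDerivAt_le (g := fun x => D.en M v w x - B * D.h x)
    (g' := fun x => D.h' x * D.Frc M (v x) - B * D.h' x) (B := 0) hst ?_ ?_ ?_
  · linarith
  · exact ((S.continuousOn_en hM hs).mono (Icc_subset_Icc le_rfl ht)).sub
      (continuousOn_const.mul (D.h_cont.mono fun x hx => ⟨hs.trans_le hx.1, hx.2.trans ht⟩))
  · intro x hx
    exact (S.hasDerivAt_en hM (h0.trans hx.1.le) (hx.2.trans_le ht)).sub
      ((D.h_deriv x ⟨hs.trans hx.1, hx.2.trans_le ht⟩).const_mul B)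
  · intro x hx
    have h1 := D.h'_nonpos x ⟨hs.trans hx.1, hx.2.trans_le ht⟩
    nlinarith [hB x (Ioo_subset_Icc_self hx)]

/-- The energy is nondecreasing. -/
theorem energy_mono (h0 : M⁻¹ ≤ s) (hst : s ≤ t) (ht : t ≤ D.T) :
    D.en M v w s / D.h s ≤ D.en M v w t / D.h t := by
  have hs := hM.inv_pos.trans_le h0
  have hp : ∀ x ∈ Icc s t, 0 < D.h x := fun x hx =>
    D.h_pos x ⟨hs.trans_le hx.1, hx.2.trans ht⟩
  refine le_of_hasDerivAt_nonneg (g := fun x => D.en M v w x / D.h x)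
    (g' := fun x => (D.h' x * D.Frc M (v x) * D.h x - D.en M v w x * D.h' x) / D.h x ^ 2)
    hst ?_ ?_ ?_
  · exact ((S.continuousOn_en hM hs).mono (Icc_subset_Icc le_rfl ht)).div
      (D.h_cont.mono fun x hx => ⟨hs.trans_le hx.1, hx.2.trans ht⟩) fun x hx => (hp x hx).ne'
  · intro x hx
    exact (S.hasDerivAt_en hM (h0.trans hx.1.le) (hx.2.trans_le ht)).div
      (D.h_deriv x ⟨hs.trans hx.1, hx.2.trans_le ht⟩) (hp x (Ioo_subset_Icc_self hx)).ne'
  · intro x hx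
    have h1 := D.h'_nonpos x ⟨hs.trans hx.1, hx.2.trans_le ht⟩
    have h2 := hM.Psi_nonneg (w x)
    -- The terms in F cancel and the numerator is -h' Ψ(w).
    refine div_nonneg ?_ (sq_nonneg _)
    unfold en
    nlinarith

end Sol

end ShootingData

/-! ### A priori bounds uniform in the truncation. -/

namespace ShootingData

variable {D : ShootingData} {M a : ℝ} {v w : ℝ → ℝ}

/-- Bound for `w` as long as `0 ≤ v ≤ β`. -/
noncomputable def topSlope (D : ShootingData) (a : ℝ) : ℝ :=
  a + D.C * D.A / (1 - D.q - D.m) * D.T ^ (1 - D.q - D.m)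

theorem le_topSlope (D : ShootingData) (a : ℝ) : a ≤ D.topSlope a := by
  have := D.mq
  have h1 := D.C_pos
  have h2 := D.A_pos
  have h3 : 0 < D.T ^ (1 - D.q - D.m) := Real.rpow_pos_of_pos D.T_pos _
  have h4 : 0 < 1 - D.q - D.m := by linarith
  unfold topSlope
  have : 0 < D.C * D.A / (1 - D.q - D.m) * D.T ^ (1 - D.q - D.m) := by positivity
  linarith

theorem topSlope_mono (D : ShootingData) {a b : ℝ} (h : a ≤ b) : D.topSlope a ≤ D.topSlope b := by
  unfold topSlope; linarith

namespace Sol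

/-- While 0 ≤ v ≤ β the force pushes w upwards, so w ≥ a ≥ 1 and v grows at least like t. This
growth tames the singularity: |f(v)| ≤ C t^(-m). -/
theorem bounds_of_lt_β (S : D.Sol M a v w) (hM : D.Adm M) (ha : 1 ≤ a) {τ : ℝ} (hτ : τ ≤ D.T)
    (hv : ∀ s ∈ Ico 0 τ, v s < D.β) :
    ∀ s ∈ Icc 0 τ, a ≤ w s ∧ s ≤ v s ∧ w s ≤ D.topSlope a ∧
      v s ≤ D.topSlope a ^ D.κ * s := by
  have hcv : ∀ {s}, s ≤ τ → ContinuousOn v (Icc 0 s) := fun h =>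
    S.continuousOn_v.mono (Icc_subset_Icc le_rfl (h.trans hτ))
  have hcw : ∀ {s}, s ≤ τ → ContinuousOn w (Icc 0 s) := fun h =>
    S.continuousOn_w.mono (Icc_subset_Icc le_rfl (h.trans hτ))
  have hdv : ∀ {s}, s ≤ τ → ∀ t ∈ Ioo 0 s, HasDerivAt v (D.psi M (w t)) t := fun h t ht =>
    S.hasDerivAt_v ht.1 (ht.2.trans_le (h.trans hτ))
  have hdw : ∀ {s}, s ≤ τ → ∀ t ∈ Ioo 0 s, HasDerivAt w (-(D.wt M t * D.frc M (v t))) t :=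
    fun h t ht => S.hasDerivAt_w ht.1 (ht.2.trans_le (h.trans hτ))
  have vpos : ∀ σ ≤ τ, (∀ s ∈ Ioo 0 σ, 0 ≤ w s) → ∀ s ∈ Icc 0 σ, 0 ≤ v s := by
    intro σ hσ hw s hs
    have := le_of_hasDerivAt_nonneg hs.1 (hcv (hs.2.trans hσ)) (hdv (hs.2.trans hσ))
      fun t ht => hM.psi_nonneg (hw t ⟨ht.1, ht.2.trans_le hs.2⟩)
    rwa [S.v_zero] at this
  have wmono : ∀ σ ≤ τ, (∀ s ∈ Icc 0 σ, 0 ≤ v s) → ∀ s ∈ Icc 0 σ, a ≤ w s := by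
    intro σ hσ hv0 s hs
    have := le_of_hasDerivAt_nonneg hs.1 (hcw (hs.2.trans hσ)) (hdw (hs.2.trans hσ))
      fun t ht => by
        have ht' : t < τ := ht.2.trans_le (hs.2.trans hσ)
        have h1 := hM.frc_nonpos (hv0 t ⟨ht.1.le, ht.2.le.trans hs.2⟩) (hv t ⟨ht.1.le, ht'⟩).le
        have h2 := hM.wt_pos (ht'.le.trans hτ)
        nlinarith
    rwa [S.w_zero] at this
  -- Bootstrap: w > 1/2 before σ gives v ≥ 0, hence w nondecreasing up to σ, hence w(σ) ≥ a ≥ 1 >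
  -- 1/2.
  have hw : ∀ s ∈ Icc 0 τ, 1 / 2 < w s := by
    refine lt_of_forall_lt_imp_lt (hcw le_rfl) fun σ hσ h => ?_
    have h1 := wmono σ hσ.2 (vpos σ hσ.2 fun s hs => by linarith [h s ⟨hs.1.le, hs.2⟩]) σ
      ⟨hσ.1, le_rfl⟩
    linarith
  have hv0 := vpos τ le_rfl fun s hs => by linarith [hw s ⟨hs.1.le, hs.2.le⟩]
  have hwa := wmono τ le_rfl hv0
  have hvs : ∀ s ∈ Icc 0 τ, s ≤ v s := by
    intro s hs
    have := le_sub_of_le_hasDerivAt (B := 1) hs.1 (hcv hs.2) (hdv hs.2) fun t ht => by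
      have := hM.psi_mono zero_le_one (ha.trans (hwa t ⟨ht.1.le, ht.2.le.trans hs.2⟩))
      rwa [hM.psi_one] at this
    rw [S.v_zero] at this
    linarith
  have hσ : 0 < 1 - D.q - D.m := by linarith [D.mq]
  -- The derivative of w is at most C A t^(-q-m), integrable at 0 because q + m < 1; `topSlope a` is
  -- a plus its integral over [0, T].
  have hwW : ∀ s ∈ Icc 0 τ, w s ≤ D.topSlope a := by
    intro s hs
    have := sub_le_of_hasDerivAt_le (B := 0)
      (g := fun t => w t - D.C * D.A / (1 - D.q - D.m) * t ^ (1 - D.q - D.m))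
      (g' := fun t => -(D.wt M t * D.frc M (v t)) - D.C * D.A * t ^ (-D.q - D.m)) hs.1
      ((hcw hs.2).sub (continuous_const.mul
        (Real.continuous_rpow_const hσ.le)).continuousOn)
      (fun t ht => by
        refine (hdw hs.2 t ht).sub ?_
        refine ((Real.hasDerivAt_rpow_const (x := t) (p := 1 - D.q - D.m)
          (Or.inl ht.1.ne')).const_mul (D.C * D.A / (1 - D.q - D.m))).congr_deriv ?_
        rw [← mul_assoc, div_mul_cancel₀ _ hσ.ne']
        congr 2
        ring)
      (fun t ht => by
        have htτ : t < τ := ht.2.trans_le hs.2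
        have h1 := hM.wt_pos (htτ.le.trans hτ)
        have h2 := hM.wt_le ht.1 (htτ.le.trans hτ)
        have h3 := hvs t ⟨ht.1.le, htτ.le⟩
        have h4 := hM.abs_frc_le (ht.1.trans_le h3) (hv t ⟨ht.1.le, htτ⟩).le
        have h5 : v t ^ (-D.m) ≤ t ^ (-D.m) :=
          Real.rpow_le_rpow_of_nonpos ht.1 h3 (by linarith [D.m_pos])
        have h6 := mul_le_mul_of_nonneg_left h5 D.C_pos.le
        have h7 : D.wt M t * |D.frc M (v t)| ≤ D.A * t ^ (-D.q) * (D.C * t ^ (-D.m)) :=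
          mul_le_mul h2 (h4.trans h6) (abs_nonneg _) (h1.le.trans h2)
        have h8 : t ^ (-D.q - D.m) = t ^ (-D.q) * t ^ (-D.m) := by
          rw [← Real.rpow_add ht.1]; congr 1
        have h9 := neg_abs_le (D.frc M (v t))
        rw [h8]
        nlinarith)
    rw [S.w_zero, Real.zero_rpow hσ.ne'] at this
    have h1 : s ^ (1 - D.q - D.m) ≤ D.T ^ (1 - D.q - D.m) :=
      Real.rpow_le_rpow hs.1 (hs.2.trans hτ) hσ.le
    have h2 : 0 ≤ D.C * D.A / (1 - D.q - D.m) :=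
      div_nonneg (mul_nonneg D.C_pos.le D.A_pos.le) hσ.le
    have h3 := mul_le_mul_of_nonneg_left h1 h2
    unfold topSlope
    linarith
  intro s hs
  refine ⟨hwa s hs, hvs s hs, hwW s hs, ?_⟩
  have := sub_le_of_hasDerivAt_le (B := D.topSlope a ^ D.κ) hs.1 (hcv hs.2) (hdv hs.2)
    fun t ht => by
      have h1 := hwW t ⟨ht.1.le, ht.2.le.trans hs.2⟩
      have h2 := hwa t ⟨ht.1.le, ht.2.le.trans hs.2⟩
      exact (hM.psi_mono (by linarith) h1).trans (hM.psi_le (by linarith))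
  rw [S.v_zero] at this
  linarith

/-- Removes the assumption v < β of `bounds_of_lt_β` by continuous induction: up to t₀ the resulting
bound on v keeps v below β. The time t₀ serves all slopes a ≤ a₁ and all M. -/
theorem initial_bounds (S : D.Sol M a v w) (hM : D.Adm M) {a₁ : ℝ} (ha : 1 ≤ a) (ha₁ : a ≤ a₁)
    {t₀ : ℝ} (h0T : t₀ ≤ D.T) (ht₀ : D.topSlope a₁ ^ D.κ * t₀ < D.β) :
    ∀ s ∈ Icc 0 t₀, a ≤ w s ∧ s ≤ v s ∧ w s ≤ D.topSlope a₁ ∧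
      v s ≤ D.topSlope a₁ ^ D.κ * s := by
  have h1 : 1 ≤ D.topSlope a := ha.trans (D.le_topSlope a)
  have h2 := D.topSlope_mono ha₁
  have h3 : D.topSlope a ^ D.κ ≤ D.topSlope a₁ ^ D.κ :=
    Real.rpow_le_rpow (by linarith) h2 D.κ_pos.le
  have h4 : 0 ≤ D.topSlope a₁ ^ D.κ := Real.rpow_nonneg (by linarith) _
  have key : ∀ s ∈ Icc 0 t₀, -D.β < -v s := by
    refine lt_of_forall_lt_imp_lt (S.continuousOn_v.neg.mono (Icc_subset_Icc le_rfl h0T)) ?_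
    intro τ hτ h
    have := (S.bounds_of_lt_β hM ha (hτ.2.trans h0T) (fun s hs => neg_lt_neg_iff.1 (h s hs)) τ
      ⟨hτ.1, le_rfl⟩).2.2.2
    have h5 := mul_le_mul_of_nonneg_right h3 hτ.1
    have h6 := mul_le_mul_of_nonneg_left hτ.2 h4
    linarith
  intro s hs
  obtain ⟨e1, e2, e3, e4⟩ := S.bounds_of_lt_β hM ha h0T
    (fun s hs => neg_lt_neg_iff.1 (key s ⟨hs.1, hs.2.le⟩)) s hs
  exact ⟨e1, e2, e3.trans h2, e4.trans (mul_le_mul_of_nonneg_right h3 hs.1)⟩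

end Sol

/-- A priori bounds for solutions, uniform in the regularization parameter. -/
structure Bounds (D : ShootingData) (W w₀ t₂ : ℝ) (M : ℝ) (v w : ℝ → ℝ) : Prop where
  le_v : ∀ t ∈ Icc 0 t₂, t ≤ v t
  abs_w_le : ∀ t ∈ Icc 0 D.T, |w t| ≤ W
  le_abs_w : ∀ t ∈ Icc 0 D.T, |v t| ≤ D.β → w₀ ≤ |w t|

theorem exists_small_time (D : ShootingData) {P c₂ e : ℝ} (he : 0 < e) :
    ∃ t, 0 < t ∧ t ≤ D.T ∧ P * t < D.β ∧ c₂ * t ^ (1 - D.m - D.q) ≤ e := by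
  have hσ : 0 < 1 - D.m - D.q := by linarith [D.mq]
  have h1 : Tendsto (fun t : ℝ => P * t) (𝓝 0) (𝓝 0) := by
    have : Continuous fun t : ℝ => P * t := by fun_prop
    simpa using this.tendsto 0
  have h2 : Tendsto (fun t : ℝ => c₂ * t ^ (1 - D.m - D.q)) (𝓝 0) (𝓝 0) := by
    have : Continuous fun t : ℝ => c₂ * t ^ (1 - D.m - D.q) :=
      continuous_const.mul (Real.continuous_rpow_const hσ.le)
    simpa [Real.zero_rpow hσ.ne'] using this.tendsto 0
  have h3 : ∀ᶠ t in 𝓝[>] (0 : ℝ), t ≤ D.T ∧ P * t < D.β ∧ c₂ * t ^ (1 - D.m - D.q) ≤ e :=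
    nhdsWithin_le_nhds ((eventually_le_nhds D.T_pos).and
      ((h1.eventually_lt_const D.β_pos).and (h2.eventually_le_const he)))
  obtain ⟨t, ht, ht0⟩ := (h3.and self_mem_nhdsWithin).exists
  exact ⟨t, ht0, ht⟩

/-- At a small time t₂ the kinetic part Ψ(w)/h is at least of order t₂^q, while |F(v)| is at most of
order t₂^(1-m), which is smaller because q + m < 1. So the energy is positive at t₂ and stays so;
this bounds |w| below where |v| ≤ β. The upper bound comes from the monotonicity of `en` plus a
multiple of h. -/
theorem uniform_bounds (D : ShootingData) {a₁ : ℝ} (h1 : 1 ≤ a₁) :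
    ∃ W w₀ t₂, 1 ≤ W ∧ 0 < w₀ ∧ 0 < t₂ ∧ t₂ ≤ D.T ∧ ∀ M, D.Adm M → M⁻¹ ≤ t₂ →
      ∀ a ∈ Icc 1 a₁, ∀ v w, D.Sol M a v w → D.Bounds W w₀ t₂ M v w := by
  have hm := D.m_lt_one
  set W0 := D.topSlope a₁ with hW0def
  have hW0 : 1 ≤ W0 := h1.trans (D.le_topSlope a₁)
  set c₁ : ℝ := (1 / 2) ^ D.κ * (1 / 2) with hc₁
  have hc₁p : 0 < c₁ := by positivity
  set c₂ : ℝ := D.C / (1 - D.m) * (W0 ^ D.κ) ^ (1 - D.m)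
  have hA := D.A_pos
  obtain ⟨t₂, ht0, htT, htβ, hte⟩ := D.exists_small_time (P := W0 ^ D.κ) (c₂ := c₂)
    (e := c₁ / (2 * D.A)) (by positivity)
  set F₁ := D.C / (1 - D.m) * D.β ^ (1 - D.m)
  have hF₁ : 0 ≤ F₁ := mul_nonneg (div_nonneg D.C_pos.le (by linarith))
    (Real.rpow_nonneg D.β_pos.le _)
  set H₀ := t₂ ^ D.q * (c₁ / (2 * D.A))
  have hH₀ : 0 < H₀ := by positivity
  have hht₂ := D.h_pos t₂ ⟨ht0, htT⟩
  have hhT := D.h_pos D.T ⟨D.T_pos, le_rfl⟩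
  have hWW : 0 ≤ W0 * W0 ^ D.κ := by positivity
  have hFh : 0 ≤ F₁ * D.h t₂ := mul_nonneg hF₁ hht₂.le
  -- W covers w ≤ W0 before t₂ and Ψ(w) + 1 afterwards, since Ψ(w) ≤ W0^(1+κ) + F₁ h(t₂) there. For
  -- w₀: Ψ(w) ≥ h(T) H₀ where |v| ≤ β, and Ψ(w) ≤ |w| when |w| ≤ 1.
  refine ⟨W0 + W0 * W0 ^ D.κ + F₁ * D.h t₂ + 1, min 1 (D.h D.T * H₀), t₂, by linarith,
    lt_min one_pos (by positivity), ht0, htT, ?_⟩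
  intro M hM hMt a ha v w S
  have init := S.initial_bounds hM ha.1 ha.2 htT htβ
  obtain ⟨i1, i2, i3, i4⟩ := init t₂ ⟨ht0.le, le_rfl⟩
  have hvt : |v t₂| ≤ W0 ^ D.κ * t₂ := by rwa [abs_of_nonneg (ht0.le.trans i2)]
  have hFt0 : D.Frc M (v t₂) ≤ 0 := hM.Frc_nonpos (hvt.trans htβ.le)
  -- The kinetic part is at least 2 H₀, and t₂ was chosen so that |F(v)| takes away at most H₀.
  have hen0 : H₀ ≤ D.en M v w t₂ / D.h t₂ := by
    have e1 : c₁ ≤ D.Psi M (w t₂) := hM.Psi_one_ge.trans (hM.Psi_mono zero_le_one (ha.1.trans i1))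
    have e2 : -(c₂ * t₂ ^ (1 - D.m)) ≤ D.Frc M (v t₂) := by
      refine le_trans ?_ (hM.neg_le_Frc (hvt.trans htβ.le))
      have : |v t₂| ^ (1 - D.m) ≤ (W0 ^ D.κ) ^ (1 - D.m) * t₂ ^ (1 - D.m) := by
        rw [← Real.mul_rpow (by positivity) ht0.le]
        exact Real.rpow_le_rpow (abs_nonneg _) hvt (by linarith)
      have h2 : 0 ≤ D.C / (1 - D.m) := div_nonneg D.C_pos.le (by linarith)
      have := mul_le_mul_of_nonneg_left this h2
      simp only [c₂]
      linarith
    have e3 : D.en M v w t₂ / D.h t₂ = D.Psi M (w t₂) / D.h t₂ + D.Frc M (v t₂) := by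
      rw [en]; field_simp
    have e4 : c₁ / D.A * t₂ ^ D.q ≤ D.Psi M (w t₂) / D.h t₂ := by
      have hb := D.h_bound t₂ ⟨ht0, htT⟩
      rw [le_div_iff₀ hht₂]
      calc c₁ / D.A * t₂ ^ D.q * D.h t₂ ≤ c₁ / D.A * t₂ ^ D.q * (D.A * t₂ ^ (-D.q)) := by gcongr
        _ = c₁ * (t₂ ^ D.q * t₂ ^ (-D.q)) := by field_simp
        _ = c₁ := by rw [← Real.rpow_add ht0, add_neg_cancel, Real.rpow_zero, mul_one]
        _ ≤ _ := e1
    have e5 : c₂ * t₂ ^ (1 - D.m) = t₂ ^ D.q * (c₂ * t₂ ^ (1 - D.m - D.q)) := by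
      have : t₂ ^ (1 - D.m) = t₂ ^ D.q * t₂ ^ (1 - D.m - D.q) := by
        rw [← Real.rpow_add ht0]; congr 1; ring
      rw [this]; ring
    have e6 := mul_le_mul_of_nonneg_left hte (Real.rpow_nonneg ht0.le D.q)
    have e7 : c₁ / D.A * t₂ ^ D.q = H₀ + H₀ := by simp only [H₀]; field_simp; ring
    have e8 : t₂ ^ D.q * (c₁ / (2 * D.A)) = H₀ := rfl
    rw [e3]
    linarith
  refine ⟨fun t ht => (init t ht).2.1, fun t ht => ?_, fun t ht hvβ => ?_⟩
  · rcases le_total t t₂ with h | h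
    · obtain ⟨j1, j2, j3, j4⟩ := init t ⟨ht.1, h⟩
      rw [abs_of_nonneg (by linarith [ha.1])]
      linarith
    · have e1 := S.en_sub_anti hM hMt h ht.2 (B := -F₁) fun x _ => hM.neg_le_Frc_all _
      have e2 : D.en M v w t₂ ≤ W0 * W0 ^ D.κ := by
        have := hM.Psi_mono (by linarith [ha.1]) i3
        have := hM.Psi_le_mul hW0
        have := mul_nonpos_of_nonneg_of_nonpos hht₂.le hFt0
        unfold en; linarith
      have e3 : -F₁ * D.h t ≤ D.h t * D.Frc M (v t) := by
        have := mul_le_mul_of_nonneg_left (hM.neg_le_Frc_all (v t))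
          (D.h_pos t ⟨ht0.trans_le h, ht.2⟩).le
        linarith
      have e4 := hM.abs_le_Psi_add_one (w t)
      have e5 : D.en M v w t = D.Psi M (w t) + D.h t * D.Frc M (v t) := rfl
      linarith
  · rcases le_total t t₂ with h | h
    · obtain ⟨j1, j2, j3, j4⟩ := init t ⟨ht.1, h⟩
      exact (min_le_left _ _).trans (by rw [abs_of_nonneg] <;> linarith [ha.1])
    · have hht := D.h_pos t ⟨ht0.trans_le h, ht.2⟩
      have e1 := hen0.trans (S.energy_mono hM hMt h ht.2)
      rw [le_div_iff₀ hht] at e1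
      have e2 := mul_nonpos_of_nonneg_of_nonpos hht.le (hM.Frc_nonpos hvβ)
      have e3 : D.en M v w t = D.Psi M (w t) + D.h t * D.Frc M (v t) := rfl
      have e4 := mul_le_mul_of_nonneg_left (h_antitone (ht0.trans_le h) ht.2 le_rfl) hH₀.le
      rcases le_total |w t| 1 with h' | h'
      · have := hM.Psi_le_self (abs_nonneg _) h'
        rw [hM.Psi_abs] at this
        exact (min_le_right _ _).trans (by linarith)
      · exact (min_le_left _ _).trans h'

end ShootingData

/-! ### Spacing of zeros, and oscillation for large initial slopes. -/

theorem forall_lt_or_forall_lt_neg {g : ℝ → ℝ} {a b c : ℝ} (hc : 0 ≤ c)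
    (hg : ContinuousOn g (Icc a b)) (h : ∀ t ∈ Icc a b, c < |g t|) :
    (∀ t ∈ Icc a b, c < g t) ∨ ∀ t ∈ Icc a b, g t < -c := by
  by_contra! hcon
  obtain ⟨⟨s, hs, hgs⟩, t, ht, hgt⟩ := hcon
  have h1 : g s < 0 := by
    have := h s hs
    rcases abs_cases (g s) with ⟨e, -⟩ | ⟨e, e'⟩ <;> linarith
  have h2 : 0 < g t := by
    have := h t ht
    rcases abs_cases (g t) with ⟨e, e'⟩ | ⟨e, e'⟩ <;> [skip; linarith]
    linarith
  obtain ⟨x, hx, hx0⟩ := isPreconnected_Icc.intermediate_value hs ht hg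
    (show (0 : ℝ) ∈ Icc (g s) (g t) from ⟨h1.le, h2.le⟩)
  have := h x hx
  rw [hx0, abs_zero] at this
  linarith

namespace ShootingData

variable {D : ShootingData} {M a : ℝ} {v w : ℝ → ℝ}

/-- By Rolle, w vanishes somewhere between two zeros of v. The lower bound on |w| forces |v| > β at
that point, and v moves with speed at most W^κ. -/
theorem Bounds.gap {W w₀ t₂ : ℝ} (B : D.Bounds W w₀ t₂ M v w) (S : D.Sol M a v w)
    (hM : D.Adm M) (hW : 1 ≤ W) (hw₀ : 0 < w₀) {s t : ℝ} (hs : 0 ≤ s) (hst : s < t)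
    (ht : t ≤ D.T) (hvs : v s = 0) (hvt : v t = 0) : D.β / W ^ D.κ ≤ t - s := by
  obtain ⟨ξ, hξ, h0⟩ := exists_hasDerivAt_eq_zero hst
    (S.continuousOn_v.mono (Icc_subset_Icc hs ht)) (hvs.trans hvt.symm)
    (fun x hx => S.hasDerivAt_v (hs.trans_lt hx.1) (hx.2.trans_le ht))
  rw [hM.psi_eq_zero_iff] at h0
  have hξT : ξ ∈ Icc 0 D.T := ⟨hs.trans hξ.1.le, hξ.2.le.trans ht⟩
  have h1 : D.β < |v ξ| := by
    by_contra! h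
    have := B.le_abs_w ξ hξT h
    rw [h0, abs_zero] at this
    linarith
  have h2 := S.abs_v_sub_le hM hW B.abs_w_le hs hξ.1.le hξT.2
  rw [hvs, sub_zero] at h2
  have hWp : 0 < W ^ D.κ := Real.rpow_pos_of_pos (by linarith) _
  rw [div_le_iff₀ hWp]
  have := mul_le_mul_of_nonneg_left (sub_le_sub_right hξ.2.le s) hWp.le
  linarith

/-- As long as v < P, the force costs w at most the integral of B A t^(-q), less than a/2. Hence w >
a/2, and v climbs at rate at least (a/2)^κ, enough to reach P within time ℓ. -/
theorem Sol.exists_le_v (S : D.Sol M a v w) (hM : D.Adm M) (ha : 2 ≤ a) (haM : a ≤ M)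
    {ℓ P B : ℝ} (hℓ : 0 < ℓ) (hℓT : ℓ ≤ D.T) (hB : 0 ≤ B)
    (hf : ∀ x, 0 ≤ x → x ≤ P → D.frc M x ≤ B)
    (h1 : B * D.A / (1 - D.q) * ℓ ^ (1 - D.q) < a / 2) (h2 : P ≤ (a / 2) ^ D.κ * ℓ) :
    ∃ t ∈ Icc 0 ℓ, P ≤ v t := by
  by_contra! hcon
  have hq : 0 < 1 - D.q := by linarith [D.mq, D.m_pos]
  have hcv : ∀ {s}, s ≤ ℓ → ContinuousOn v (Icc 0 s) := fun h =>
    S.continuousOn_v.mono (Icc_subset_Icc le_rfl (h.trans hℓT))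
  have hcw : ∀ {s}, s ≤ ℓ → ContinuousOn w (Icc 0 s) := fun h =>
    S.continuousOn_w.mono (Icc_subset_Icc le_rfl (h.trans hℓT))
  have hdv : ∀ {s}, s ≤ ℓ → ∀ t ∈ Ioo 0 s, HasDerivAt v (D.psi M (w t)) t := fun h t ht =>
    S.hasDerivAt_v ht.1 (ht.2.trans_le (h.trans hℓT))
  have hdw : ∀ {s}, s ≤ ℓ → ∀ t ∈ Ioo 0 s, HasDerivAt w (-(D.wt M t * D.frc M (v t))) t :=
    fun h t ht => S.hasDerivAt_w ht.1 (ht.2.trans_le (h.trans hℓT))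
  have hw : ∀ s ∈ Icc 0 ℓ, a / 2 < w s := by
    refine lt_of_forall_lt_imp_lt (hcw le_rfl) fun τ hτ h => ?_
    have hv0 : ∀ s ∈ Icc 0 τ, 0 ≤ v s := by
      intro s hs
      have := le_of_hasDerivAt_nonneg hs.1 (hcv (hs.2.trans hτ.2)) (hdv (hs.2.trans hτ.2))
        fun t ht => hM.psi_nonneg (by linarith [h t ⟨ht.1.le, ht.2.trans_le hs.2⟩])
      rwa [S.v_zero] at this
    have := le_of_hasDerivAt_nonneg
      (g := fun t => w t + B * D.A / (1 - D.q) * t ^ (1 - D.q))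
      (g' := fun t => -(D.wt M t * D.frc M (v t)) + B * D.A * t ^ (-D.q)) hτ.1
      ((hcw hτ.2).add (continuous_const.mul (Real.continuous_rpow_const hq.le)).continuousOn)
      (fun t ht => by
        refine (hdw hτ.2 t ht).add ?_
        refine ((Real.hasDerivAt_rpow_const (x := t) (p := 1 - D.q)
          (Or.inl ht.1.ne')).const_mul (B * D.A / (1 - D.q))).congr_deriv ?_
        rw [← mul_assoc, div_mul_cancel₀ _ hq.ne', sub_sub_cancel_left])
      (fun t ht => by
        have htT : t ≤ D.T := ht.2.le.trans (hτ.2.trans hℓT)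
        have e1 := hf _ (hv0 t (Ioo_subset_Icc_self ht))
          (hcon t ⟨ht.1.le, ht.2.le.trans hτ.2⟩).le
        have e2 := mul_le_mul_of_nonneg_left e1 (hM.wt_pos htT).le
        have e3 := mul_le_mul_of_nonneg_right (hM.wt_le ht.1 htT) hB
        linarith)
    simp only [S.w_zero, Real.zero_rpow hq.ne'] at this
    have e1 : τ ^ (1 - D.q) ≤ ℓ ^ (1 - D.q) := Real.rpow_le_rpow hτ.1 hτ.2 hq.le
    have e2 : 0 ≤ B * D.A / (1 - D.q) := div_nonneg (mul_nonneg hB D.A_pos.le) hq.le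
    have e3 := mul_le_mul_of_nonneg_left e1 e2
    linarith
  have := le_sub_of_le_hasDerivAt (B := (a / 2) ^ D.κ) hℓ.le (hcv le_rfl) (hdv le_rfl)
    fun t ht => by
      have := hM.psi_mono (x := a / 2) (by linarith) (hw t (Ioo_subset_Icc_self ht)).le
      rwa [hM.psi_of_mem (by linarith [hM.inv_le_half]) (by linarith)] at this
  rw [S.v_zero] at this
  linarith [hcon ℓ ⟨hℓ.le, le_rfl⟩]

/-- In a time `4λ`, a solution cannot stay above a level where `f` is large compared with
`x ^ (1 / κ)`. -/
theorem false_of_superlinear (hM : D.Adm M) {lam b V w₁ : ℝ} (hlam : 0 < lam) (hV : 1 ≤ V)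
    (hw₁M : w₁ ≤ M) (hMl : M⁻¹ ≤ lam⁻¹ ^ (1 / D.κ))
    (hb : lam⁻¹ ^ (1 / D.κ) < b) (h1 : lam * D.psi M w₁ ≤ V) (h2 : b * V ^ (1 / D.κ) ≤ w₁) :
    False := by
  have hκ := D.κ_pos
  have hV1 : 1 ≤ V ^ (1 / D.κ) := Real.one_le_rpow hV (by positivity)
  -- The second bound makes w₁ exceed (V/λ)^(1/κ), so λ ψ(w₁) > V, against the first bound.
  have h3 : lam⁻¹ ^ (1 / D.κ) * V ^ (1 / D.κ) < w₁ := by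
    have := mul_lt_mul_of_pos_right hb (by linarith : 0 < V ^ (1 / D.κ))
    linarith
  have h4 : M⁻¹ ≤ w₁ := by
    have : 0 ≤ lam⁻¹ ^ (1 / D.κ) := Real.rpow_nonneg (by positivity) _
    nlinarith
  rw [hM.psi_of_mem h4 hw₁M] at h1
  rw [← Real.mul_rpow (by positivity) (by linarith)] at h3
  have h5 : lam⁻¹ * V < w₁ ^ D.κ := by
    have h6 : 0 ≤ lam⁻¹ * V := by positivity
    have := Real.rpow_lt_rpow (Real.rpow_nonneg h6 _) h3 hκ
    rwa [← Real.rpow_mul h6, one_div_mul_cancel hκ.ne', Real.rpow_one] at this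
  have := mul_lt_mul_of_pos_left h5 hlam
  rw [← mul_assoc, mul_inv_cancel₀ hlam.ne', one_mul] at this
  linarith

/-- Below the level P the curve moves too fast to remain in (0, P) for long, and above P
superlinearity bends it too strongly. So v cannot stay positive for a time ℓ. -/
theorem Sol.not_forall_pos (S : D.Sol M a v w) (hM : D.Adm M) {ℓ s P ω Λ : ℝ} (hℓ : 0 < ℓ)
    (hMs : M⁻¹ ≤ s) (hsT : s + ℓ ≤ D.T) (hP1 : 1 ≤ P) (hω1 : 1 ≤ ω)
    (hωM : ω ≤ M) (hω : P < ω ^ D.κ * (ℓ / 4))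
    (hwω : ∀ t ∈ Icc s (s + ℓ), |v t| ≤ P → ω < |w t|)
    (hwM : ∀ t ∈ Icc s (s + ℓ), |w t| ≤ M) (hvM : ∀ t ∈ Icc s (s + ℓ), v t ≤ M)
    (hΛ0 : 0 ≤ Λ) (hfΛ : ∀ x, P ≤ x → x ≤ M → Λ * x ^ (1 / D.κ) ≤ D.frc M x)
    (hMl : M⁻¹ ≤ (ℓ / 8)⁻¹ ^ (1 / D.κ))
    (hΛ : (ℓ / 8)⁻¹ ^ (1 / D.κ) < ℓ / 8 * D.h D.T * Λ) :
    ¬ ∀ t ∈ Icc s (s + ℓ), 0 < v t := by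
  intro hpos
  have hs0 : 0 < s := hM.inv_pos.trans_le hMs
  have hcv : ∀ {x y}, s ≤ x → y ≤ s + ℓ → ContinuousOn v (Icc x y) := fun h h' =>
    S.continuousOn_v.mono (Icc_subset_Icc (hs0.le.trans h) (h'.trans hsT))
  have hcw : ∀ {x y}, s ≤ x → y ≤ s + ℓ → ContinuousOn w (Icc x y) := fun h h' =>
    S.continuousOn_w.mono (Icc_subset_Icc (hs0.le.trans h) (h'.trans hsT))
  have hdv : ∀ {x y}, s ≤ x → y ≤ s + ℓ → ∀ t ∈ Ioo x y, HasDerivAt v (D.psi M (w t)) t :=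
    fun h h' t ht => S.hasDerivAt_v (hs0.trans_le (h.trans ht.1.le)) (ht.2.trans_le (h'.trans hsT))
  have hdw : ∀ {x y}, s ≤ x → y ≤ s + ℓ → ∀ t ∈ Ioo x y,
      HasDerivAt w (-(D.wt M t * D.frc M (v t))) t :=
    fun h h' t ht => S.hasDerivAt_w (hs0.trans_le (h.trans ht.1.le)) (ht.2.trans_le (h'.trans hsT))
  -- Where 0 < v < P one has |v'| ≥ ω^κ with a fixed sign, and crossing (0, P) takes less than ℓ/4.
  -- This is applied to the first and last quarters.
  have step1 : ∀ x, s ≤ x → x + ℓ / 4 ≤ s + ℓ → ∃ t ∈ Icc x (x + ℓ / 4), P ≤ v t := by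
    intro x hx hx'
    by_contra! hcon
    have hsub : ∀ {t}, t ∈ Icc x (x + ℓ / 4) → t ∈ Icc s (s + ℓ) :=
      fun h => ⟨hx.trans h.1, h.2.trans hx'⟩
    have hxx : x ≤ x + ℓ / 4 := by linarith
    have hψ : D.psi M ω = ω ^ D.κ := hM.psi_of_mem (by linarith [hM.inv_le_half]) hωM
    rcases forall_lt_or_forall_lt_neg (by linarith) (hcw hx hx') (fun t ht => hwω t (hsub ht)
        (by rw [abs_of_pos (hpos t (hsub ht))]; exact (hcon t ht).le)) with h | h
    · have := le_sub_of_le_hasDerivAt (B := ω ^ D.κ) hxx (hcv hx hx') (hdv hx hx')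
        fun t ht => by
          rw [← hψ]; exact hM.psi_mono (by linarith) (h t (Ioo_subset_Icc_self ht)).le
      rw [add_sub_cancel_left] at this
      linarith [hcon _ (right_mem_Icc.2 hxx), hpos _ (hsub (left_mem_Icc.2 hxx))]
    · have := sub_le_of_hasDerivAt_le (B := -ω ^ D.κ) hxx (hcv hx hx') (hdv hx hx')
        fun t ht => by
          have e1 := hM.psi_mono (x := ω) (y := -w t) (by linarith)
            (by linarith [h t (Ioo_subset_Icc_self ht)])
          rw [hψ, hM.psi_neg] at e1
          linarith
      rw [add_sub_cancel_left] at this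
      linarith [hcon _ (left_mem_Icc.2 hxx), hpos _ (hsub (right_mem_Icc.2 hxx))]
  obtain ⟨τ₁, hτ₁, hv₁⟩ := step1 s le_rfl (by linarith)
  obtain ⟨τ₂, hτ₂, hv₂⟩ := step1 (s + 3 * ℓ / 4) (by linarith) (by linarith)
  have h12 : τ₁ + ℓ / 2 ≤ τ₂ := by linarith [hτ₁.2, hτ₂.1]
  have hτ₂' : τ₂ ≤ s + ℓ := by linarith [hτ₂.2]
  -- An interior minimum below P would have w = 0, excluded by |w| > ω.
  have step2 : ∀ t ∈ Icc τ₁ τ₂, P ≤ v t := by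
    obtain ⟨ξ, hξ, hmin⟩ := isCompact_Icc.exists_isMinOn (nonempty_Icc.2 (by linarith))
      (hcv hτ₁.1 hτ₂')
    suffices P ≤ v ξ from fun t ht => this.trans (hmin ht)
    by_contra! hlt
    have h1 : τ₁ < ξ := lt_of_le_of_ne hξ.1 (by rintro rfl; linarith)
    have h2 : ξ < τ₂ := lt_of_le_of_ne hξ.2 (by rintro rfl; linarith)
    have hξs : ξ ∈ Icc s (s + ℓ) := ⟨hτ₁.1.trans hξ.1, hξ.2.trans hτ₂'⟩
    have h0 := (hmin.isLocalMin (Icc_mem_nhds h1 h2)).hasDerivAt_eq_zero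
      (hdv hτ₁.1 hτ₂' ξ ⟨h1, h2⟩)
    rw [hM.psi_eq_zero_iff] at h0
    have := hwω ξ hξs (by rw [abs_of_pos (hpos ξ hξs)]; exact hlt.le)
    rw [h0, abs_zero] at this
    linarith
  -- The points τ₁ and τ₂ are at least ℓ/2 = 4λ apart, so there are four consecutive steps of length
  -- λ with v ≥ P, on which w decreases.
  set lam := ℓ / 8 with hlam
  have hl0 : 0 < lam := by positivity
  have hmem : ∀ {t}, t ∈ Icc τ₁ (τ₁ + 4 * lam) → t ∈ Icc s (s + ℓ) :=
    fun h => ⟨hτ₁.1.trans h.1, by linarith [h.2]⟩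
  have hPv : ∀ {t}, t ∈ Icc τ₁ (τ₁ + 4 * lam) → P ≤ v t :=
    fun h => step2 _ ⟨h.1, by linarith [h.2]⟩
  have hhT := D.h_pos D.T ⟨D.T_pos, le_rfl⟩
  -- decay rate of `w` where `v ≥ V`
  have hrate : ∀ V, 0 ≤ V → ∀ t ∈ Icc τ₁ (τ₁ + 4 * lam), V ≤ v t →
      -(D.wt M t * D.frc M (v t)) ≤ -(D.h D.T * Λ * V ^ (1 / D.κ)) := by
    intro V hV t ht hVt
    have hts := hmem ht
    have e1 := hfΛ _ (hPv ht) (hvM t hts)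
    have e2 : V ^ (1 / D.κ) ≤ v t ^ (1 / D.κ) :=
      Real.rpow_le_rpow hV hVt (one_div_pos.2 D.κ_pos).le
    have e3 := (mul_le_mul_of_nonneg_left e2 hΛ0).trans e1
    have e4 : D.h D.T ≤ D.wt M t := by
      rw [wt_of_ge (hMs.trans hts.1)]
      exact h_antitone (hs0.trans_le hts.1) (hts.2.trans hsT) le_rfl
    have e5 : 0 ≤ Λ * V ^ (1 / D.κ) := mul_nonneg hΛ0 (Real.rpow_nonneg hV _)
    have := mul_le_mul e4 e3 e5 (hhT.le.trans e4)
    linarith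
  have hwanti : ∀ x y, τ₁ ≤ x → x ≤ y → y ≤ τ₁ + 4 * lam → w y ≤ w x := by
    intro x y h1 h2 h3
    have := sub_le_of_hasDerivAt_le (B := 0) h2
      (hcw (hτ₁.1.trans h1) (by linarith)) (hdw (hτ₁.1.trans h1) (by linarith)) fun t ht => by
        have := hrate 0 le_rfl t ⟨h1.trans ht.1.le, ht.2.le.trans h3⟩
          (by linarith [hPv (t := t) ⟨h1.trans ht.1.le, ht.2.le.trans h3⟩])
        rwa [Real.zero_rpow (one_div_pos.2 D.κ_pos).ne', mul_zero, neg_zero] at this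
    linarith
  -- If w ≥ 0 at the midpoint, v increases on the first two steps: the first gives v(τ₁+λ) ≥ λ
  -- ψ(w(τ₁+λ)), the second costs w at least λ h(T) Λ v(τ₁+λ)^(1/κ). Otherwise v decreases on the
  -- last two steps and the argument is mirrored.
  rcases le_total 0 (w (τ₁ + 2 * lam)) with h | h
  · have hx : τ₁ + lam ∈ Icc τ₁ (τ₁ + 4 * lam) := ⟨by linarith, by linarith⟩
    have hw1 : 0 ≤ w (τ₁ + lam) := h.trans (hwanti _ _ (by linarith) (by linarith) (by linarith))
    refine false_of_superlinear hM (b := lam * D.h D.T * Λ) hl0 (hP1.trans (hPv hx))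
      ((le_abs_self _).trans (hwM _ (hmem hx))) hMl hΛ ?_ ?_
    · have := le_sub_of_le_hasDerivAt (B := D.psi M (w (τ₁ + lam)))
        (a := τ₁) (b := τ₁ + lam) (by linarith) (hcv hτ₁.1 (by linarith))
        (hdv hτ₁.1 (by linarith)) fun t ht => hM.psi_mono hw1
          (hwanti _ _ ht.1.le ht.2.le (by linarith))
      rw [add_sub_cancel_left] at this
      linarith [hPv (t := τ₁) ⟨le_rfl, by linarith⟩]
    · have hV : ∀ t ∈ Icc (τ₁ + lam) (τ₁ + 2 * lam), v (τ₁ + lam) ≤ v t := by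
        intro t ht
        refine le_of_hasDerivAt_nonneg ht.1 (hcv (by linarith [hτ₁.1]) (by linarith [ht.2]))
          (hdv (by linarith [hτ₁.1]) (by linarith [ht.2])) fun y hy => hM.psi_nonneg ?_
        exact h.trans (hwanti _ _ (by linarith [hy.1]) (by linarith [hy.2, ht.2]) (by linarith))
      have := sub_le_of_hasDerivAt_le (a := τ₁ + lam) (b := τ₁ + 2 * lam) (by linarith)
        (hcw (by linarith [hτ₁.1]) (by linarith)) (hdw (by linarith [hτ₁.1]) (by linarith))
        fun t ht => hrate (v (τ₁ + lam)) (by linarith [hPv hx]) t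
          ⟨by linarith [ht.1], by linarith [ht.2]⟩ (hV t (Ioo_subset_Icc_self ht))
      have e : τ₁ + 2 * lam - (τ₁ + lam) = lam := by ring
      rw [e] at this
      linarith
  · have hx : τ₁ + 3 * lam ∈ Icc τ₁ (τ₁ + 4 * lam) := ⟨by linarith, by linarith⟩
    have hw1 : w (τ₁ + 3 * lam) ≤ 0 :=
      (hwanti _ _ (by linarith) (by linarith) (by linarith)).trans h
    refine false_of_superlinear hM (b := lam * D.h D.T * Λ) (w₁ := -w (τ₁ + 3 * lam)) hl0
      (hP1.trans (hPv hx))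
      ((neg_le_abs _).trans (hwM _ (hmem hx))) hMl hΛ ?_ ?_
    · have := sub_le_of_hasDerivAt_le (B := -D.psi M (-w (τ₁ + 3 * lam)))
        (a := τ₁ + 3 * lam) (b := τ₁ + 4 * lam) (by linarith)
        (hcv (by linarith [hτ₁.1]) (by linarith)) (hdv (by linarith [hτ₁.1]) (by linarith))
        fun t ht => by
          have := hM.psi_mono (x := -w (τ₁ + 3 * lam)) (y := -w t) (by linarith)
            (neg_le_neg (hwanti _ _ (by linarith) ht.1.le ht.2.le))
          rw [hM.psi_neg (w t)] at this
          linarith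
      have e : τ₁ + 4 * lam - (τ₁ + 3 * lam) = lam := by ring
      rw [e] at this
      linarith [hPv (t := τ₁ + 4 * lam) ⟨by linarith, by linarith⟩]
    · have hV : ∀ t ∈ Icc (τ₁ + 2 * lam) (τ₁ + 3 * lam), v (τ₁ + 3 * lam) ≤ v t := by
        intro t ht
        have := sub_le_of_hasDerivAt_le (B := 0) ht.2
          (hcv (by linarith [hτ₁.1, ht.1]) (by linarith))
          (hdv (by linarith [hτ₁.1, ht.1]) (by linarith)) fun y hy => by
            have := hM.psi_nonneg (x := -w y) (by
              have := hwanti (τ₁ + 2 * lam) y (by linarith) (by linarith [hy.1, ht.1])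
                (by linarith [hy.2])
              linarith)
            rw [hM.psi_neg] at this
            linarith
        linarith
      have := sub_le_of_hasDerivAt_le (a := τ₁ + 2 * lam) (b := τ₁ + 3 * lam) (by linarith)
        (hcw (by linarith [hτ₁.1]) (by linarith)) (hdw (by linarith [hτ₁.1]) (by linarith))
        fun t ht => hrate (v (τ₁ + 3 * lam)) (by linarith [hPv hx]) t
          ⟨by linarith [ht.1], by linarith [ht.2]⟩ (hV t (Ioo_subset_Icc_self ht))
      have e : τ₁ + 3 * lam - (τ₁ + 2 * lam) = lam := by ring
      rw [e] at this
      linarith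

end ShootingData

namespace ShootingData

variable {D : ShootingData} {M a : ℝ} {v w : ℝ → ℝ}

theorem f_continuousOn (D : ShootingData) : ContinuousOn D.f (Ioi 0) := D.f_lip.continuousOn

/-- For a large initial slope, every interval of length `ℓ` in `[ℓ, T]` contains a zero. -/
theorem exists_forall_exists_zero (D : ShootingData) {ℓ : ℝ} (hℓ : 0 < ℓ) (hℓT : ℓ ≤ D.T) :
    ∃ a₁, 1 ≤ a₁ ∧ ∀ᶠ M in atTop, ∀ v w, D.Sol M a₁ v w →
      ∀ s, ℓ ≤ s → s + ℓ ≤ D.T → ∃ t ∈ Icc s (s + ℓ), v t = 0 := by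
  have hκ := D.κ_pos
  have hm := D.m_lt_one
  have hhT := D.h_pos D.T ⟨D.T_pos, le_rfl⟩
  have hq : 0 < 1 - D.q := by linarith [D.mq, D.m_pos]
  set c := (ℓ / 8)⁻¹ ^ (1 / D.κ) with hc
  have hc0 : 0 < c := by positivity
  obtain ⟨Λ, hΛ⟩ : ∃ Λ, 1 ≤ Λ ∧ c < ℓ / 8 * D.h D.T * Λ := by
    refine ⟨c / (ℓ / 8 * D.h D.T) + 1, ?_, ?_⟩
    · have : 0 < c / (ℓ / 8 * D.h D.T) := by positivity
      linarith
    · have h1 : 0 < ℓ / 8 * D.h D.T := by positivity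
      rw [mul_add, mul_div_cancel₀ _ h1.ne']
      linarith
  obtain ⟨P, hPβ, hP1, hPf⟩ : ∃ P, D.β ≤ P ∧ 1 ≤ P ∧
      ∀ x, P ≤ x → Λ * x ^ (1 / D.κ) ≤ D.f x := by
    obtain ⟨P, hP⟩ := eventually_atTop.1 (D.f_super.eventually_ge_atTop Λ)
    refine ⟨max (max P D.β) 1, (le_max_right _ _).trans (le_max_left _ _), le_max_right _ _,
      fun x hx => ?_⟩
    have hx1 : 1 ≤ x := (le_max_right _ _).trans hx
    have := hP x (((le_max_left _ _).trans (le_max_left _ _)).trans hx)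
    rwa [le_div_iff₀ (by positivity)] at this
  obtain ⟨ω, hω1, hω⟩ : ∃ ω, 1 ≤ ω ∧ P < ω ^ D.κ * (ℓ / 4) :=
    ((eventually_ge_atTop 1).and (((tendsto_rpow_atTop hκ).atTop_mul_const
      (by positivity : 0 < ℓ / 4)).eventually_gt_atTop P)).exists
  set F₁ := D.C / (1 - D.m) * D.β ^ (1 - D.m) with hF₁
  have hF₁0 : 0 ≤ F₁ := mul_nonneg (div_nonneg D.C_pos.le (by linarith))
    (Real.rpow_nonneg D.β_pos.le _)
  set E := ω * ω ^ D.κ with hE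
  have hE0 : 0 < E := by positivity
  -- Since f ≥ 1 beyond P, F(P₂) exceeds F(P) by E/h(T) + F₁ + 1. Once v has reached P₂, the energy
  -- suffices to keep Ψ(w) > E ≥ Ψ(ω) wherever |v| ≤ P.
  set P₂ := P + F₁ + E / D.h D.T + 1 with hP₂
  have hPP : P ≤ P₂ := by
    have : 0 < E / D.h D.T := by positivity
    linarith
  obtain ⟨B, hB⟩ := isCompact_Icc.exists_bound_of_continuousOn
    (D.f_continuousOn.mono fun x (hx : x ∈ Icc D.β P₂) => D.β_pos.trans_le hx.1)
  have hB0 : 0 ≤ B := (norm_nonneg _).trans (hB D.β ⟨le_rfl, hPβ.trans hPP⟩)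
  obtain ⟨a₁, ha₁2, ha₁B, ha₁P⟩ : ∃ a₁, 2 ≤ a₁ ∧
      B * D.A / (1 - D.q) * ℓ ^ (1 - D.q) < a₁ / 2 ∧ P₂ ≤ (a₁ / 2) ^ D.κ * ℓ := by
    have h1 : Tendsto (fun x : ℝ => x / 2) atTop atTop := tendsto_id.atTop_div_const two_pos
    exact ((eventually_ge_atTop 2).and ((h1.eventually_gt_atTop _).and
      ((((tendsto_rpow_atTop hκ).comp h1).atTop_mul_const hℓ).eventually_ge_atTop P₂))).exists
  obtain ⟨W, w₀, t₂, hW1, hw₀, ht₂, ht₂T, hbd⟩ := D.uniform_bounds (a₁ := a₁) (by linarith)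
  have hWκ : 1 ≤ W ^ D.κ := Real.one_le_rpow hW1 hκ.le
  refine ⟨a₁, by linarith, ?_⟩
  have hinv := tendsto_inv_atTop_zero (𝕜 := ℝ)
  filter_upwards [D.eventually_adm, hinv.eventually_le_const ht₂, hinv.eventually_le_const hℓ,
    hinv.eventually_le_const hc0, eventually_ge_atTop a₁, eventually_ge_atTop W,
    eventually_ge_atTop (W ^ D.κ * D.T), eventually_ge_atTop P₂, eventually_ge_atTop (W ^ D.κ),
    eventually_ge_atTop ω] with M hM hMt hMℓ hMc hMa hMW hMT hMP hMκ hMω v w S s hs hsT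
  have bd := hbd M hM hMt a₁ ⟨by linarith, le_rfl⟩ v w S
  have hfrc : ∀ x, 0 ≤ x → x ≤ P₂ → D.frc M x ≤ B := by
    intro x h0 h
    rcases le_total x D.β with h' | h'
    · exact (hM.frc_nonpos h0 h').trans hB0
    · rw [hM.frc_of_mem (hM.inv_le_β.trans h') (h.trans hMP)]
      exact (le_abs_self _).trans (hB x ⟨h', h⟩)
  have hFmono : ∀ x y, D.β ≤ x → x ≤ y → D.Frc M x ≤ D.Frc M y := fun x y h1 h2 =>
    le_of_hasDerivAt_nonneg h2 hM.continuous_Frc.continuousOn (fun t _ => hM.hasDerivAt_Frc t)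
      fun t ht => hM.frc_nonneg (h1.trans ht.1.le)
  have hvT : ∀ t ∈ Icc 0 D.T, |v t| ≤ W ^ D.κ * t := by
    intro t ht
    have := S.abs_v_sub_le hM hW1 bd.abs_w_le le_rfl ht.1 ht.2
    rwa [S.v_zero, sub_zero, sub_zero] at this
  obtain ⟨t₁, ht₁, hPv⟩ := S.exists_le_v hM ha₁2 hMa hℓ hℓT hB0 hfrc ha₁B ha₁P
  have ht₁T : t₁ ≤ D.T := ht₁.2.trans hℓT
  -- The energy is monotone only from 1/M on. Reaching P₂ ≥ 1 at speed at most W^κ ≤ M takes at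
  -- least time 1/M.
  have hMt₁ : M⁻¹ ≤ t₁ := by
    have h1 := (le_abs_self _).trans (hvT t₁ ⟨ht₁.1, ht₁T⟩)
    have h2 := mul_le_mul_of_nonneg_right hMκ ht₁.1
    rw [inv_le_iff_one_le_mul₀' hM.pos]
    linarith
  have ht₁0 : 0 < t₁ := hM.inv_pos.trans_le hMt₁
  have hFP : E / D.h D.T + F₁ + 1 ≤ D.Frc M P₂ - D.Frc M P := by
    have := le_sub_of_le_hasDerivAt (B := 1) hPP hM.continuous_Frc.continuousOn
      (fun t _ => hM.hasDerivAt_Frc t) fun t ht => by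
        rw [hM.frc_of_mem (hM.inv_le_β.trans (hPβ.trans ht.1.le)) (ht.2.le.trans hMP)]
        have h1 : 1 ≤ t ^ (1 / D.κ) := Real.one_le_rpow (hP1.trans ht.1.le) (by positivity)
        have := hPf t ht.1.le
        nlinarith [hΛ.1]
    linarith
  have hlow : ∀ t ∈ Icc ℓ D.T, |v t| ≤ P → ω < |w t| := by
    intro t ht hvP
    have htt : t₁ ≤ t := ht₁.2.trans ht.1
    have hht := D.h_pos t ⟨ht₁0.trans_le htt, ht.2⟩
    have hht₁ := D.h_pos t₁ ⟨ht₁0, ht₁T⟩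
    have e1 : D.Frc M P₂ ≤ D.en M v w t / D.h t := by
      refine le_trans ?_ (S.energy_mono hM hMt₁ htt ht.2)
      rw [le_div_iff₀ hht₁, en]
      have h1 := hM.Psi_nonneg (w t₁)
      have h2 := mul_le_mul_of_nonneg_left (hFmono _ _ (hPβ.trans hPP) hPv) hht₁.le
      linarith
    have e2 : D.Frc M (v t) ≤ D.Frc M P + F₁ := by
      rcases le_total |v t| D.β with h | h
      · linarith [hM.Frc_nonpos h, hM.neg_le_Frc_all P]
      · rw [← hM.Frc_abs]
        linarith [hFmono _ _ h hvP]
    rw [le_div_iff₀ hht, en] at e1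
    have e3 : E < D.Psi M (w t) := by
      have h1 : E / D.h D.T + 1 ≤ D.Frc M P₂ - D.Frc M (v t) := by linarith
      have h2 := mul_le_mul_of_nonneg_left h1 hht.le
      have h3 := mul_le_mul_of_nonneg_right
        (h_antitone (ht₁0.trans_le htt) ht.2 le_rfl) (by positivity : 0 ≤ E / D.h D.T)
      rw [mul_div_cancel₀ _ hhT.ne'] at h3
      linarith
    by_contra! h
    have h1 := hM.Psi_mono (abs_nonneg _) h
    rw [hM.Psi_abs] at h1
    linarith [hM.Psi_le_mul hω1]
  have hsub : ∀ {t}, t ∈ Icc s (s + ℓ) → t ∈ Icc 0 D.T := fun h =>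
    ⟨(hℓ.le.trans hs).trans h.1, h.2.trans hsT⟩
  have hvM : ∀ t ∈ Icc s (s + ℓ), |v t| ≤ M := fun t ht =>
    (hvT t (hsub ht)).trans ((mul_le_mul_of_nonneg_left (hsub ht).2 (by linarith)).trans hMT)
  have hwM : ∀ t ∈ Icc s (s + ℓ), |w t| ≤ M := fun t ht => (bd.abs_w_le t (hsub ht)).trans hMW
  have hfΛ : ∀ x, P ≤ x → x ≤ M → Λ * x ^ (1 / D.κ) ≤ D.frc M x := fun x h1 h2 => by
    rw [hM.frc_of_mem (hM.inv_le_β.trans (hPβ.trans h1)) h2]; exact hPf x h1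
  have hwl : ∀ t ∈ Icc s (s + ℓ), |v t| ≤ P → ω < |w t| := fun t ht =>
    hlow t ⟨hs.trans ht.1, ht.2.trans hsT⟩
  by_contra! hne
  rcases forall_lt_or_forall_lt_neg le_rfl
      (S.continuousOn_v.mono fun t ht => hsub ht) (fun t ht => abs_pos.2 (hne t ht)) with h | h
  · exact S.not_forall_pos hM hℓ (hMℓ.trans hs) hsT hP1 hω1 hMω hω hwl hwM
      (fun t ht => (le_abs_self _).trans (hvM t ht)) (by linarith [hΛ.1]) hfΛ hMc hΛ.2 h
  · exact (S.neg hM).not_forall_pos hM hℓ (hMℓ.trans hs) hsT hP1 hω1 hMω hω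
      (by simpa using hwl) (by simpa using hwM)
      (fun t ht => (neg_le_abs _).trans (hvM t ht)) (by linarith [hΛ.1]) hfΛ hMc hΛ.2
      (fun t ht => by linarith [h t ht])

end ShootingData

/-! ### The Prüfer angle and counting zeros. -/

theorem HasDerivAt.nonpos_of_forall_le {g : ℝ → ℝ} {g' s τ : ℝ} (hg : HasDerivAt g g' τ)
    (hs : s < τ) (h : ∀ x ∈ Ioo s τ, g τ ≤ g x) : g' ≤ 0 := by
  have h1 : Tendsto (slope g τ) (𝓝[<] τ) (𝓝 g') :=
    (hasDerivAt_iff_tendsto_slope.1 hg).mono_left (nhdsWithin_mono _ fun x hx => ne_of_lt hx)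
  refine le_of_tendsto h1 ?_
  filter_upwards [Ioo_mem_nhdsLT hs] with x hx
  rw [slope_def_field]
  exact div_nonpos_of_nonneg_of_nonpos (sub_nonneg.2 (h x hx)) (by linarith [hx.2])

theorem HasDerivAt.exists_lt_right {g : ℝ → ℝ} {g' s t : ℝ} (hg : HasDerivAt g g' s)
    (hpos : 0 < g') (hst : s < t) : ∃ x ∈ Ioo s t, g s < g x := by
  by_contra! h
  have h1 : Tendsto (slope g s) (𝓝[>] s) (𝓝 g') :=
    (hasDerivAt_iff_tendsto_slope.1 hg).mono_left (nhdsWithin_mono _ fun x hx => ne_of_gt hx)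
  refine absurd (le_of_tendsto h1 (b := 0) ?_) (not_le.2 hpos)
  filter_upwards [Ioo_mem_nhdsGT hst] with x hx
  rw [slope_def_field]
  exact div_nonpos_of_nonpos_of_nonneg (sub_nonpos.2 (h x hx)) (by linarith [hx.1])

/-- A differentiable function that crosses the level `c` only upwards stays above it. -/
theorem lt_of_le_of_forall_eq_imp_deriv_pos {θ g : ℝ → ℝ} {s t c : ℝ}
    (hd : ∀ x, HasDerivAt θ (g x) x) (hpos : ∀ x ∈ Icc s t, θ x = c → 0 < g x) (hst : s < t)
    (h : c ≤ θ s) : c < θ t := by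
  have hc : Continuous θ := continuous_iff_continuousAt.2 fun x => (hd x).continuousAt
  obtain ⟨s', hs', hlt⟩ : ∃ s' ∈ Ico s t, c < θ s' := by
    rcases h.lt_or_eq with h | h
    · exact ⟨s, ⟨le_rfl, hst⟩, h⟩
    · obtain ⟨x, hx, hx'⟩ := (hd s).exists_lt_right (hpos s ⟨le_rfl, hst.le⟩ h.symm) hst
      exact ⟨x, ⟨hx.1.le, hx.2⟩, h ▸ hx'⟩
  refine lt_of_forall_lt_imp_lt (a := s') (b := t) hc.continuousOn (fun τ hτ hb => ?_) t
    ⟨hs'.2.le, le_rfl⟩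
  rcases hτ.1.eq_or_lt with rfl | hτ'
  · exact hlt
  have h1 : c ≤ θ τ := by
    have : Tendsto θ (𝓝[<] τ) (𝓝 (θ τ)) := hc.continuousAt.tendsto.mono_left nhdsWithin_le_nhds
    refine ge_of_tendsto this ?_
    filter_upwards [Ioo_mem_nhdsLT hτ'] with x hx
    exact (hb x ⟨hx.1.le, hx.2⟩).le
  refine lt_of_le_of_ne h1 fun h2 => ?_
  have h3 := hpos τ ⟨hs'.1.trans hτ.1, hτ.2⟩ h2.symm
  exact absurd ((hd τ).nonpos_of_forall_le hτ' fun x hx => h2 ▸ (hb x ⟨hx.1.le, hx.2⟩).le)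
    (not_le.2 h3)

/-- Q is the squared sine of the difference between θ and the polar angle of (v, w). It vanishes at
0 and has zero derivative, so (v, w) stays parallel to (sin θ, cos θ) with no branch of the polar
angle to choose. -/
theorem mul_cos_eq_mul_sin_of_angle {v w v' w' θ : ℝ → ℝ} {T : ℝ}
    (hv : ContinuousOn v (Icc 0 T)) (hw : ContinuousOn w (Icc 0 T))
    (hv' : ∀ t ∈ Ioo 0 T, HasDerivAt v (v' t) t) (hw' : ∀ t ∈ Ioo 0 T, HasDerivAt w (w' t) t)
    (hne : ∀ t ∈ Icc 0 T, v t ^ 2 + w t ^ 2 ≠ 0) (hθ : ContinuousOn θ (Icc 0 T))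
    (hθ' : ∀ t ∈ Ioo 0 T,
      HasDerivAt θ ((v' t * w t - v t * w' t) / (v t ^ 2 + w t ^ 2)) t)
    (hv0 : v 0 = 0) (hθ0 : θ 0 = 0) {t : ℝ} (ht : t ∈ Icc 0 T) :
    v t * Real.cos (θ t) = w t * Real.sin (θ t) := by
  set Q : ℝ → ℝ := fun t =>
    (v t * Real.cos (θ t) - w t * Real.sin (θ t)) ^ 2 / (v t ^ 2 + w t ^ 2) with hQ
  have hsub : Icc 0 t ⊆ Icc 0 T := Icc_subset_Icc le_rfl ht.2
  have hQc : ContinuousOn Q (Icc 0 t) := by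
    have h1 := hv.mono hsub
    have h2 := hw.mono hsub
    have h3 := hθ.mono hsub
    exact (((h1.mul (Real.continuous_cos.comp_continuousOn h3)).sub
      (h2.mul (Real.continuous_sin.comp_continuousOn h3))).pow 2).div
      ((h1.pow 2).add (h2.pow 2)) fun x hx => hne x (hsub hx)
  have hQd : ∀ x ∈ Ioo 0 t, HasDerivAt Q 0 x := by
    intro x hx
    have hxT : x ∈ Ioo 0 T := ⟨hx.1, hx.2.trans_le ht.2⟩
    have h0 := hne x (Ioo_subset_Icc_self hxT)
    have h1 := hv' x hxT
    have h2 := hw' x hxT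
    have h3 := hθ' x hxT
    refine HasDerivAt.congr_deriv ((((h1.mul h3.cos).sub (h2.mul h3.sin)).pow 2).div
      ((h1.pow 2).add (h2.pow 2)) h0) ?_
    simp only [Pi.sub_apply, Pi.mul_apply, Pi.pow_apply]
    rw [div_eq_zero_iff]
    left
    field_simp
    ring
  have hle := abs_sub_le_of_abs_hasDerivAt_le (B := 0) ht.1 hQc hQd (fun x _ => by simp)
  rw [zero_mul] at hle
  have hQ0 : Q 0 = 0 := by simp [hQ, hv0, hθ0]
  have hQt : Q t = 0 := by
    have := abs_eq_zero.1 (le_antisymm hle (abs_nonneg _))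
    linarith
  have := (div_eq_zero_iff.1 hQt).resolve_right (hne t ht)
  have := pow_eq_zero_iff (two_ne_zero) |>.1 this
  linarith

namespace ShootingData

variable {D : ShootingData} {M a : ℝ} {v w : ℝ → ℝ}

/-- `θ` is an angle function counting the zeros of `v`. -/
structure Angle (D : ShootingData) (v θ g : ℝ → ℝ) : Prop where
  zero : θ 0 = 0
  deriv : ∀ t, HasDerivAt θ (g t) t
  zero_iff : ∀ t ∈ Icc 0 D.T, v t = 0 ↔ Real.sin (θ t) = 0
  pos : ∀ t ∈ Icc 0 D.T, v t = 0 → 0 < g t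

namespace Angle

variable {θ g : ℝ → ℝ} (A : D.Angle v θ g)
include A

theorem continuous : Continuous θ := continuous_iff_continuousAt.2 fun x => (A.deriv x).continuousAt

theorem v_eq_zero {t : ℝ} (ht : t ∈ Icc 0 D.T) {k : ℤ} (h : θ t = k * Real.pi) : v t = 0 := by
  rw [A.zero_iff t ht, h, Real.sin_int_mul_pi]

/-- At a multiple of π the function v vanishes, so θ is increasing there: each multiple is passed
once, upwards. -/
theorem cross {s t : ℝ} (hs : 0 ≤ s) (hst : s < t) (ht : t ≤ D.T) {k : ℤ}
    (h : k * Real.pi ≤ θ s) : k * Real.pi < θ t :=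
  lt_of_le_of_forall_eq_imp_deriv_pos A.deriv (fun x hx hxk =>
    A.pos x ⟨hs.trans hx.1, hx.2.trans ht⟩ (A.v_eq_zero ⟨hs.trans hx.1, hx.2.trans ht⟩ hxk)) hst h

theorem exists_int {t : ℝ} (ht : t ∈ Icc 0 D.T) (h : v t = 0) : ∃ k : ℤ, k * Real.pi = θ t :=
  Real.sin_eq_zero_iff.1 ((A.zero_iff t ht).1 h)

theorem le_of_zeros {n : ℕ} {x : ℕ → ℝ} (h0 : 0 < x 0) (hx : ∀ j < n, x j < x (j + 1))
    (hT : ∀ j ≤ n, x j ≤ D.T) (hv : ∀ j ≤ n, v (x j) = 0) :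
    ∀ j ≤ n, 0 < x j ∧ ((j : ℝ) + 1) * Real.pi ≤ θ (x j) := by
  have key : ∀ {s t : ℝ} {k : ℤ}, 0 ≤ s → s < t → t ≤ D.T → v t = 0 → k * Real.pi ≤ θ s →
      ((k : ℝ) + 1) * Real.pi ≤ θ t := by
    intro s t k hs hst ht hvt hk
    obtain ⟨j, hj⟩ := A.exists_int ⟨hs.trans hst.le, ht⟩ hvt
    have h1 := A.cross hs hst ht hk
    rw [← hj] at h1 ⊢
    have h2 : k < j := by exact_mod_cast (mul_lt_mul_iff_left₀ Real.pi_pos).1 h1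
    have h3 : (k : ℝ) + 1 ≤ j := by exact_mod_cast h2
    exact mul_le_mul_of_nonneg_right h3 Real.pi_pos.le
  intro j
  induction j with
  | zero =>
    intro _
    refine ⟨h0, ?_⟩
    have := key (k := 0) le_rfl h0 (hT 0 (Nat.zero_le _)) (hv 0 (Nat.zero_le _)) (by simp [A.zero])
    simpa using this
  | succ j ih =>
    intro hj
    obtain ⟨i1, i2⟩ := ih (by omega)
    have i3 := hx j (by omega)
    refine ⟨i1.trans i3, ?_⟩
    have := key (k := (j : ℤ) + 1) i1.le i3 (hT _ hj) (hv _ hj) (by push_cast; exact i2)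
    push_cast at this ⊢
    exact this

/-- Reaching jπ requires j + 1 zeros of v, counting t = 0, and these are δ apart. This bounds the
angle from above. -/
theorem exists_of_le {δ : ℝ} (hgap : ∀ s t, 0 ≤ s → s < t → t ≤ D.T → v s = 0 → v t = 0 →
    δ ≤ t - s) (j : ℕ) (hj : j * Real.pi ≤ θ D.T) :
    ∃ y ∈ Icc 0 D.T, θ y = j * Real.pi ∧ j * δ ≤ y := by
  induction j with
  | zero => exact ⟨0, ⟨le_rfl, D.T_pos.le⟩, by simp [A.zero], by simp⟩
  | succ j ih =>
    have hp := Real.pi_pos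
    push_cast at hj
    obtain ⟨y, hy, hyθ, hyδ⟩ := ih (by linarith)
    obtain ⟨z, hz, hzθ⟩ := intermediate_value_Icc hy.2 A.continuous.continuousOn
      (show ((j : ℝ) + 1) * Real.pi ∈ Icc (θ y) (θ D.T) from ⟨by linarith, hj⟩)
    have hyz : y < z := lt_of_le_of_ne hz.1 (by rintro rfl; linarith)
    have h1 : v y = 0 := A.v_eq_zero hy (k := j) (by simpa using hyθ)
    have h2 : v z = 0 := A.v_eq_zero ⟨hy.1.trans hz.1, hz.2⟩ (k := (j : ℤ) + 1)
      (by push_cast; exact hzθ)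
    have := hgap y z hy.1 hyz hz.2 h1 h2
    refine ⟨z, ⟨hy.1.trans hz.1, hz.2⟩, by push_cast; exact hzθ, ?_⟩
    push_cast
    linarith

/-- Each of the levels π, ..., nπ is attained exactly once in (0, T). Other multiples of π are
excluded by `cross` from 0 and up to T. -/
theorem exists_zeros {n : ℕ} (hn : θ D.T = ((n : ℝ) + 1) * Real.pi) :
    ∃ z : Fin n → ℝ, (∀ i, z i ∈ Ioo 0 D.T ∧ v (z i) = 0) ∧ Function.Injective z ∧
      ∀ t ∈ Ioo 0 D.T, v t = 0 → ∃ i, t = z i := by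
  have hp := Real.pi_pos
  have h1 : ∀ i : Fin n, ∃ y ∈ Icc 0 D.T, θ y = ((i : ℝ) + 1) * Real.pi := by
    intro i
    have hi : (i : ℝ) ≤ n := by exact_mod_cast i.2.le
    refine intermediate_value_Icc D.T_pos.le A.continuous.continuousOn ⟨?_, ?_⟩
    · rw [A.zero]; positivity
    · rw [hn]; gcongr
  choose z hz hzθ using h1
  have hcast : ∀ i : Fin n, θ (z i) = (((i : ℕ) + 1 : ℤ) : ℝ) * Real.pi := by
    intro i; rw [hzθ]; push_cast; rfl
  refine ⟨z, fun i => ⟨⟨?_, ?_⟩, A.v_eq_zero (hz i) (hcast i)⟩, ?_, ?_⟩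
  · refine lt_of_le_of_ne (hz i).1 fun h => ?_
    have := hzθ i
    rw [← h, A.zero] at this
    have h3 : 0 < ((i : ℝ) + 1) * Real.pi := by positivity
    linarith
  · refine lt_of_le_of_ne (hz i).2 fun h => ?_
    have := hzθ i
    rw [h, hn] at this
    have h3 := mul_right_cancel₀ hp.ne' this
    have h4 : (n : ℝ) = (i : ℕ) := by linarith
    have h5 : n = (i : ℕ) := by exact_mod_cast h4
    exact absurd i.2 (by omega)
  · intro i j hij
    have h3 := (hzθ i).symm.trans ((congrArg θ hij).trans (hzθ j))
    have h4 := mul_right_cancel₀ hp.ne' h3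
    have h5 : ((i : ℕ) : ℝ) = (j : ℕ) := by linarith
    exact Fin.ext (by exact_mod_cast h5)
  · intro t ht hvt
    obtain ⟨k, hk⟩ := A.exists_int (Ioo_subset_Icc_self ht) hvt
    have e1 := A.cross (k := 0) le_rfl ht.1 ht.2.le (by simp [A.zero])
    rw [← hk] at e1
    have e2 : (0 : ℤ) < k := by exact_mod_cast (mul_lt_mul_iff_left₀ hp).1 e1
    have e3 := A.cross ht.1.le ht.2 le_rfl hk.le
    rw [hn] at e3
    have e4 : k < (n : ℤ) + 1 := by exact_mod_cast (mul_lt_mul_iff_left₀ hp).1 e3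
    obtain ⟨i, hi⟩ : ∃ i : Fin n, ((i : ℕ) : ℤ) + 1 = k :=
      ⟨⟨(k - 1).toNat, by omega⟩, by simp only; omega⟩
    refine ⟨i, ?_⟩
    have e5 : θ (z i) = k * Real.pi := by rw [hcast, hi]
    rcases lt_trichotomy t (z i) with h | h | h
    · have := A.cross ht.1.le h (hz i).2 hk.le
      linarith
    · exact h
    · have := A.cross (hz i).1 h ht.2.le e5.ge
      linarith

end Angle

/-! ### Continuous dependence on the slope and the shooting argument. -/

theorem exists_flow (hM : D.Adm M) {a₁ : ℝ} (h1 : 1 ≤ a₁) :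
    ∃ V W : ℝ × ℝ → ℝ, Continuous V ∧ Continuous W ∧
      (∀ a ∈ Icc 1 a₁, D.Sol M a (fun t => V (a, t)) (fun t => W (a, t))) ∧
      ∀ a t, ∃ a' ∈ Icc 1 a₁, ∃ t' ∈ Icc 0 D.T, V (a, t) = V (a', t') ∧ W (a, t) = W (a', t') := by
  obtain ⟨L₁, B₁, hL₁, hB₁, hl₁, hb₁⟩ :=
    exists_lipschitz_bound_reg (locallyLipschitzOn_rpow D.κ) hM.one_le
  obtain ⟨L₂, B₂, hL₂, hB₂, hl₂, hb₂⟩ := exists_lipschitz_bound_reg D.f_lip hM.one_le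
  obtain ⟨H, hH⟩ := isCompact_Icc.exists_bound_of_continuousOn hM.continuousOn_wt
  have hT := D.T_pos
  have hH0 : 0 ≤ H := (norm_nonneg _).trans (hH 0 ⟨le_rfl, hT.le⟩)
  let G : ℝ → ℝ × ℝ → ℝ × ℝ := fun t x => (D.psi M x.2, -(D.wt M t * D.frc M x.1))
  let L : NNReal := (max B₁ (H * B₂)).toNNReal
  let K : NNReal := (max L₁ (H * L₂)).toNNReal
  have hLc : (L : ℝ) = max B₁ (H * B₂) := Real.coe_toNNReal _ (le_max_of_le_left hB₁)
  have hKc : (K : ℝ) = max L₁ (H * L₂) := Real.coe_toNNReal _ (le_max_of_le_left hL₁)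
  -- Initial values lie within a₁ of (0, 1), and a trajectory travels at most L T. With this radius
  -- one application covers all of [0, T].
  have hPL : IsPicardLindelof G (tmin := 0) (tmax := D.T) ⟨0, le_rfl, hT.le⟩ ((0, 1) : ℝ × ℝ)
      (L * D.T.toNNReal + a₁.toNNReal) a₁.toNNReal L K := by
    refine ⟨fun t ht => ?_, fun x _ => ?_, fun t ht x _ => ?_, ?_⟩
    · refine LipschitzOnWith.of_dist_le_mul fun x _ y _ => ?_
      rw [Prod.dist_eq, hKc]
      refine max_le ?_ ?_
      · rw [Real.dist_eq]
        refine (hl₁ _ _).trans (mul_le_mul (le_max_left _ _) ?_ (abs_nonneg _)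
          (le_max_of_le_left hL₁))
        exact le_max_right _ _
      · rw [Real.dist_eq]
        have e : -(D.wt M t * D.frc M x.1) - -(D.wt M t * D.frc M y.1) =
            D.wt M t * (D.frc M y.1 - D.frc M x.1) := by ring
        rw [e, abs_mul]
        have h2 : |D.wt M t| ≤ H := hH t ht
        calc _ ≤ H * (L₂ * |y.1 - x.1|) := mul_le_mul h2 (hl₂ _ _) (abs_nonneg _) hH0
          _ = H * L₂ * |x.1 - y.1| := by rw [abs_sub_comm]; ring
          _ ≤ _ := mul_le_mul (le_max_right _ _) (le_max_left _ _) (abs_nonneg _)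
            (le_max_of_le_left hL₁)
    · exact continuousOn_const.prodMk (hM.continuousOn_wt.mul continuousOn_const).neg
    · rw [hLc, Prod.norm_def]
      refine max_le ((hb₁ _).trans (le_max_left _ _)) (le_trans ?_ (le_max_right _ _))
      rw [norm_neg, norm_mul]
      exact mul_le_mul (hH t ht) (hb₂ _) (norm_nonneg _) hH0
    · simp [hT.le]
  obtain ⟨α, hα, hαc⟩ := hPL.exists_forall_mem_closedBall_eq_hasDerivWithinAt_continuousOn
  have hball : ∀ a ∈ Icc 1 a₁, ((0, a) : ℝ × ℝ) ∈ Metric.closedBall ((0, 1) : ℝ × ℝ)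
      (a₁.toNNReal : ℝ) := by
    intro a ha
    rw [Metric.mem_closedBall, Prod.dist_eq, Real.coe_toNNReal _ (by linarith)]
    simp only [dist_self]
    refine max_le (by linarith) ?_
    rw [Real.dist_eq, abs_of_nonneg (by linarith [ha.1])]
    linarith [ha.2]
  -- Clamping slope and time extends the flow continuously to the whole plane, so no continuity on
  -- subsets is needed later.
  let pa : ℝ → ℝ := fun a => projIcc 1 a₁ h1 a
  let pt : ℝ → ℝ := fun t => projIcc 0 D.T hT.le t
  have hpa : ∀ a, pa a ∈ Icc 1 a₁ := fun a => (projIcc 1 a₁ h1 a).2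
  have hpt : ∀ t, pt t ∈ Icc 0 D.T := fun t => (projIcc 0 D.T hT.le t).2
  have hpa' : ∀ a ∈ Icc 1 a₁, pa a = a := fun a ha => by simp [pa, projIcc_of_mem h1 ha]
  have hpt' : ∀ t ∈ Icc 0 D.T, pt t = t := fun t ht => by simp [pt, projIcc_of_mem hT.le ht]
  have hcpa : Continuous pa := continuous_subtype_val.comp continuous_projIcc
  have hcpt : Continuous pt := continuous_subtype_val.comp continuous_projIcc
  let U : ℝ × ℝ → ℝ × ℝ := fun x => α ((0, pa x.1), pt x.2)
  have hU : Continuous U := by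
    refine hαc.comp_continuous (by fun_prop) fun x => ⟨hball _ (hpa _), hpt _⟩
  refine ⟨fun x => (U x).1, fun x => (U x).2, by fun_prop, by fun_prop, fun a ha => ?_,
    fun a t => ⟨pa a, hpa a, pt t, hpt t, ?_⟩⟩
  · obtain ⟨e1, e2⟩ := hα _ (hball a ha)
    have hUe : ∀ t ∈ Icc 0 D.T, U (a, t) = α ((0, a), t) := fun t ht => by
      simp only [U, hpa' a ha, hpt' t ht]
    have hUd : ∀ t ∈ Icc 0 D.T, HasDerivWithinAt (fun t => U (a, t)) (G t (U (a, t)))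
        (Icc 0 D.T) t := fun t ht => by
      rw [hUe t ht]
      exact (e2 t ht).congr (fun x hx => hUe x hx) (hUe t ht)
    have h0 : U (a, 0) = (0, a) := by rw [hUe 0 ⟨le_rfl, hT.le⟩]; exact e1
    exact ⟨by simp [h0], by simp [h0], fun t ht => (hUd t ht).fst, fun t ht => (hUd t ht).snd⟩
  · simp only [U, hpa' _ (hpa a), hpt' _ (hpt t), and_self]

/-- The angle is defined as the integral of (v'w - vw')/(v² + w²), with a denominator that never
vanishes. Joint continuity of the integrand gives continuity of the final angle in the slope. -/
theorem exists_flow_angle (hM : D.Adm M) {a₁ : ℝ} (h1 : 1 ≤ a₁)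
    (hne : ∀ a ∈ Icc 1 a₁, ∀ v w, D.Sol M a v w → ∀ t ∈ Icc 0 D.T, v t = 0 → w t ≠ 0) :
    ∃ V W Θ G : ℝ → ℝ → ℝ, (∀ a ∈ Icc 1 a₁, D.Sol M a (V a) (W a) ∧ D.Angle (V a) (Θ a) (G a)) ∧
      Continuous fun a => Θ a D.T := by
  obtain ⟨V, W, hV, hW, hS, hproj⟩ := exists_flow hM h1
  have hT := D.T_pos
  let pt : ℝ → ℝ := fun t => projIcc 0 D.T hT.le t
  have hpt : ∀ t, pt t ∈ Icc 0 D.T := fun t => (projIcc 0 D.T hT.le t).2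
  have hpt' : ∀ t ∈ Icc 0 D.T, pt t = t := fun t ht => by simp [pt, projIcc_of_mem hT.le ht]
  have hcpt : Continuous pt := continuous_subtype_val.comp continuous_projIcc
  have hρ : ∀ x : ℝ × ℝ, V x ^ 2 + W x ^ 2 ≠ 0 := by
    rintro ⟨a, t⟩ h
    obtain ⟨a', ha', t', ht', e1, e2⟩ := hproj a t
    rw [e1, e2] at h
    have h2 : V (a', t') = 0 := by nlinarith [sq_nonneg (V (a', t')), sq_nonneg (W (a', t'))]
    have h3 : W (a', t') = 0 := by nlinarith [sq_nonneg (V (a', t')), sq_nonneg (W (a', t'))]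
    exact hne a' ha' _ _ (hS a' ha') t' ht' h2 h3
  have hwt : Continuous fun t => D.wt M (pt t) :=
    hM.continuousOn_wt.comp_continuous hcpt hpt
  let g : ℝ → ℝ → ℝ := fun a t => (D.psi M (W (a, t)) * W (a, t) +
    V (a, t) * (D.wt M (pt t) * D.frc M (V (a, t)))) / (V (a, t) ^ 2 + W (a, t) ^ 2)
  have hg : Continuous (Function.uncurry g) := by
    have h1 := hM.continuous_psi.comp hW
    have h2 := hM.continuous_frc.comp hV
    have h3 : Continuous fun x : ℝ × ℝ => D.wt M (pt x.2) := hwt.comp continuous_snd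
    exact ((h1.mul hW).add (hV.mul (h3.mul h2))).div ((hV.pow 2).add (hW.pow 2)) hρ
  refine ⟨fun a t => V (a, t), fun a t => W (a, t), fun a t => ∫ s in (0 : ℝ)..t, g a s, g,
    fun a ha => ⟨hS a ha, ?_⟩,
    intervalIntegral.continuous_parametric_intervalIntegral_of_continuous' hg 0 D.T⟩
  have hga : Continuous (g a) := hg.comp (by fun_prop : Continuous fun t : ℝ => (a, t))
  have hd : ∀ t, HasDerivAt (fun t => ∫ s in (0 : ℝ)..t, g a s) (g a t) t := fun t =>
    intervalIntegral.integral_hasDerivAt_right (hga.intervalIntegrable _ _)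
      (hga.stronglyMeasurableAtFilter _ _) hga.continuousAt
  have S := hS a ha
  refine ⟨by simp, hd, fun t ht => ?_, fun t ht hvt => ?_⟩
  · have key := mul_cos_eq_mul_sin_of_angle S.continuousOn_v S.continuousOn_w
      (fun t ht => S.hasDerivAt_v ht.1 ht.2) (fun t ht => S.hasDerivAt_w ht.1 ht.2)
      (fun t _ => hρ (a, t)) (θ := fun t => ∫ s in (0 : ℝ)..t, g a s)
      (fun t _ => (hd t).continuousAt.continuousWithinAt)
      (fun t ht => (hd t).congr_deriv (by
        simp only [g, hpt' t (Ioo_subset_Icc_self ht)]; ring))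
      S.v_zero (by simp) ht
    show V (a, t) = 0 ↔ Real.sin (∫ s in (0 : ℝ)..t, g a s) = 0
    constructor
    · intro h
      rw [h, zero_mul] at key
      exact (mul_eq_zero.1 key.symm).resolve_left (hne a ha _ _ S t ht h)
    · intro h
      rw [h, mul_zero] at key
      refine (mul_eq_zero.1 key).resolve_right fun h' => ?_
      have := Real.sin_sq_add_cos_sq (∫ s in (0 : ℝ)..t, g a s)
      rw [h, h'] at this
      norm_num at this
  · have h0 := hne a ha _ _ S t ht hvt
    simp only at hvt h0
    simp only [g, hvt, zero_mul, add_zero]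
    have : 0 < D.psi M (W (a, t)) * W (a, t) := by
      rcases lt_or_gt_of_ne h0 with h | h
      · have := hM.psi_pos (neg_pos.2 h)
        rw [hM.psi_neg] at this
        exact mul_pos_of_neg_of_neg (by linarith) h
      · exact mul_pos (hM.psi_pos h) h
    have h3 : 0 < W (a, t) ^ 2 := by positivity
    positivity

/-- Regularized solutions with exactly `n` interior zeros. -/
theorem exists_regularized (D : ShootingData) : ∃ n₀ : ℕ, ∀ n ≥ n₀, ∃ a₁, 1 ≤ a₁ ∧
    ∀ᶠ M in atTop, ∃ a ∈ Icc 1 a₁, ∃ v w, D.Sol M a v w ∧ v D.T = 0 ∧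
      ∃ z : Fin n → ℝ, (∀ i, z i ∈ Ioo 0 D.T ∧ v (z i) = 0) ∧ Function.Injective z ∧
        ∀ t ∈ Ioo 0 D.T, v t = 0 → ∃ i, t = z i := by
  have hT := D.T_pos
  have hp := Real.pi_pos
  have hinv := tendsto_inv_atTop_zero (𝕜 := ℝ)
  obtain ⟨W, w₀, t₂, hW1, hw₀, ht₂, ht₂T, hbd⟩ := D.uniform_bounds (a₁ := 1) le_rfl
  have hδ : 0 < D.β / W ^ D.κ := div_pos D.β_pos (Real.rpow_pos_of_pos (by linarith) _)
  -- The spacing for slope 1 depends on neither n nor M; n₀ spacings do not fit into [0, T], so the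
  -- angle at T for slope 1 is below (n+1)π when n ≥ n₀.
  obtain ⟨n₀, hn₀⟩ := exists_nat_gt (D.T / (D.β / W ^ D.κ))
  rw [div_lt_iff₀ hδ] at hn₀
  refine ⟨n₀, fun n hn => ?_⟩
  have hℓ : 0 < D.T / (2 * n + 2) := by positivity
  -- The n + 1 intervals [(2j+1)ℓ, (2j+2)ℓ], j ≤ n, lie in [ℓ, T] with gaps between them, so their
  -- zeros are distinct.
  set ℓ := D.T / (2 * n + 2) with hℓdef
  have hℓT : ℓ * (2 * n + 2) = D.T := by rw [hℓdef]; field_simp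
  obtain ⟨a₁, ha₁, hev⟩ := D.exists_forall_exists_zero hℓ (by
    have : (0 : ℝ) ≤ n := by positivity
    nlinarith)
  obtain ⟨W', w₀', t₂', hW1', hw₀', ht₂', ht₂T', hbd'⟩ := D.uniform_bounds ha₁
  refine ⟨a₁, ha₁, ?_⟩
  filter_upwards [D.eventually_adm, hinv.eventually_le_const ht₂, hinv.eventually_le_const ht₂',
    hev] with M hM hMt hMt' hosc
  obtain ⟨V, U, Θ, G, hS, hc⟩ := exists_flow_angle hM ha₁ (fun a ha v w S t ht hvt hwt => by
    have := (hbd' M hM hMt' a ha v w S).le_abs_w t ht (by rw [hvt, abs_zero]; exact D.β_pos.le)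
    rw [hwt, abs_zero] at this
    linarith)
  have hlow : Θ 1 D.T ≤ ((n : ℝ) + 1) * Real.pi := by
    obtain ⟨S, A⟩ := hS 1 ⟨le_rfl, ha₁⟩
    by_contra! h
    have bd := hbd M hM hMt 1 ⟨le_rfl, le_rfl⟩ _ _ S
    obtain ⟨y, hy, -, hyδ⟩ := A.exists_of_le (δ := D.β / W ^ D.κ)
      (fun s t h1 h2 h3 h4 h5 => bd.gap S hM hW1 hw₀ h1 h2 h3 h4 h5) (n + 1)
      (by push_cast; exact h.le)
    have h1 : (n₀ : ℝ) ≤ ((n + 1 : ℕ) : ℝ) := by exact_mod_cast hn.trans (Nat.le_succ n)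
    have h2 := mul_le_mul_of_nonneg_right h1 hδ.le
    linarith [hy.2]
  have hhigh : ((n : ℝ) + 1) * Real.pi ≤ Θ a₁ D.T := by
    obtain ⟨S, A⟩ := hS a₁ ⟨ha₁, le_rfl⟩
    have h1 : ∀ j : ℕ, ∃ t, j ≤ n →
        t ∈ Icc ((2 * j + 1) * ℓ) ((2 * j + 1) * ℓ + ℓ) ∧ V a₁ t = 0 := by
      intro j
      by_cases hj : j ≤ n
      · have hj' : (j : ℝ) ≤ n := by exact_mod_cast hj
        have hj0 : (0 : ℝ) ≤ j := by positivity
        obtain ⟨t, ht, hvt⟩ := hosc _ _ S ((2 * j + 1) * ℓ) (by nlinarith) (by nlinarith)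
        exact ⟨t, fun _ => ⟨ht, hvt⟩⟩
      · exact ⟨0, fun h => absurd h hj⟩
    choose x hx using h1
    have hxT : ∀ j ≤ n, x j ≤ D.T := fun j hj => by
      have hj' : (j : ℝ) ≤ n := by exact_mod_cast hj
      nlinarith [(hx j hj).1.2]
    have h0 : 0 < x 0 := by
      have := (hx 0 (Nat.zero_le _)).1.1
      simp at this
      linarith
    have hlt : ∀ j < n, x j < x (j + 1) := fun j hj => by
      have e1 := (hx j hj.le).1.2
      have e2 := (hx (j + 1) hj).1.1
      push_cast at e2
      nlinarith
    obtain ⟨e1, e2⟩ := A.le_of_zeros h0 hlt hxT (fun j hj => (hx j hj).2) n le_rfl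
    rcases (hxT n le_rfl).eq_or_lt with h | h
    · rwa [h] at e2
    · have := A.cross (k := (n : ℤ) + 1) e1.le h le_rfl (by push_cast; exact e2)
      push_cast at this
      exact this.le
  obtain ⟨a, ha, haθ⟩ := intermediate_value_Icc ha₁ hc.continuousOn ⟨hlow, hhigh⟩
  obtain ⟨S, A⟩ := hS a ha
  refine ⟨a, ha, _, _, S, A.v_eq_zero ⟨hT.le, le_rfl⟩ (k := (n : ℤ) + 1) ?_, A.exists_zeros haθ⟩
  push_cast
  exact haθ

end ShootingData

/-! ### Removing the truncation. -/

/-- The odd extension of `x ↦ x ^ κ`. -/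
noncomputable def signedPow (κ x : ℝ) : ℝ := max x 0 ^ κ - max (-x) 0 ^ κ

theorem continuous_signedPow {κ : ℝ} (hκ : 0 < κ) : Continuous (signedPow κ) :=
  ((Real.continuous_rpow_const hκ.le).comp (continuous_id.max continuous_const)).sub
    ((Real.continuous_rpow_const hκ.le).comp (continuous_neg.max continuous_const))

theorem signedPow_of_nonneg {κ x : ℝ} (hκ : 0 < κ) (hx : 0 ≤ x) : signedPow κ x = x ^ κ := by
  rw [signedPow, max_eq_left hx, max_eq_right (by linarith), Real.zero_rpow hκ.ne', sub_zero]

theorem signedPow_neg (κ x : ℝ) : signedPow κ (-x) = -signedPow κ x := by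
  rw [signedPow, signedPow, neg_neg, neg_sub]

/-- If the derivatives are eventually within ε of L on a common neighbourhood of t, the mean value
inequality for g_k - xL survives the pointwise limit. -/
theorem hasDerivWithinAt_of_tendsto {ι : Type*} {l : Filter ι} [l.NeBot] {g g' : ι → ℝ → ℝ}
    {G : ℝ → ℝ} {T t L : ℝ} (ht : t ∈ Icc 0 T)
    (hG : ∀ s ∈ Icc 0 T, Tendsto (fun k => g k s) l (𝓝 (G s)))
    (hc : ∀ᶠ k in l, ContinuousOn (g k) (Icc 0 T))
    (hd : ∀ᶠ k in l, ∀ s ∈ Ioo 0 T, HasDerivAt (g k) (g' k s) s)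
    (hL : ∀ ε > 0, ∃ δ > 0, ∀ᶠ k in l, ∀ s ∈ Ioo 0 T, |s - t| < δ → |g' k s - L| ≤ ε) :
    HasDerivWithinAt G L (Icc 0 T) t := by
  rw [hasDerivWithinAt_iff_isLittleO, Asymptotics.isLittleO_iff]
  intro ε hε
  obtain ⟨δ, hδ, hev⟩ := hL ε hε
  have hnear : ∀ᶠ s in 𝓝[Icc 0 T] t, |s - t| < δ := nhdsWithin_le_nhds (by
    filter_upwards [Metric.ball_mem_nhds t hδ] with s hs
    rwa [Metric.mem_ball, Real.dist_eq] at hs)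
  filter_upwards [hnear, self_mem_nhdsWithin] with s hs hsT
  have hlim : Tendsto (fun k => |g k s - g k t - (s - t) * L|) l
      (𝓝 |G s - G t - (s - t) * L|) :=
    (((hG s hsT).sub (hG t ht)).sub_const _).abs
  refine le_of_tendsto hlim ?_
  filter_upwards [hc, hd, hev] with k h1 h2 h3
  have hgL : ∀ x ∈ Ioo 0 T, HasDerivAt (fun x => g k x - x * L) (g' k x - L) x := fun x hx => by
    simpa using (h2 x hx).fun_sub ((hasDerivAt_id x).mul_const L)
  have hgc : ContinuousOn (fun x => g k x - x * L) (Icc 0 T) :=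
    h1.sub (continuousOn_id.mul continuousOn_const)
  have e : g k s - g k t - (s - t) * L = g k s - s * L - (g k t - t * L) := by ring
  rcases le_total s t with h | h
  · have := abs_sub_le_of_abs_hasDerivAt_le (B := ε) h
      (hgc.mono (Icc_subset_Icc hsT.1 ht.2))
      (fun x hx => hgL x ⟨hsT.1.trans_lt hx.1, hx.2.trans_le ht.2⟩)
      (fun x hx => h3 x ⟨hsT.1.trans_lt hx.1, hx.2.trans_le ht.2⟩ (by
        rw [abs_sub_comm, abs_of_nonneg (by linarith [hx.2])]
        rw [abs_sub_comm, abs_of_nonneg (by linarith)] at hs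
        linarith [hx.1]))
    rw [Real.norm_eq_abs, abs_sub_comm s t, abs_of_nonneg (sub_nonneg.2 h)]
    rw [abs_sub_comm] at this
    rw [e]
    exact this
  · have := abs_sub_le_of_abs_hasDerivAt_le (B := ε) h
      (hgc.mono (Icc_subset_Icc ht.1 hsT.2))
      (fun x hx => hgL x ⟨ht.1.trans_lt hx.1, hx.2.trans_le hsT.2⟩)
      (fun x hx => h3 x ⟨ht.1.trans_lt hx.1, hx.2.trans_le hsT.2⟩ (by
        rw [abs_of_nonneg (by linarith [hx.1])]
        rw [abs_of_nonneg (by linarith)] at hs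
        linarith [hx.2]))
    rw [Real.norm_eq_abs, abs_of_nonneg (sub_nonneg.2 h)]
    rw [e]
    exact this

namespace ShootingData

variable {D : ShootingData} {M a : ℝ} {v w : ℝ → ℝ}

theorem continuousAt_f (D : ShootingData) {x : ℝ} (hx : x ≠ 0) : ContinuousAt D.f x := by
  rcases lt_or_gt_of_ne hx with h | h
  · have h1 : ContinuousAt D.f (-x) :=
      D.f_continuousOn.continuousAt (Ioi_mem_nhds (neg_pos.2 h))
    have h2 : ContinuousAt (fun y => -D.f (-y)) x :=
      (ContinuousAt.comp (f := fun y : ℝ => -y) h1 continuous_neg.continuousAt).neg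
    refine h2.congr ?_
    filter_upwards [Iio_mem_nhds h] with y hy
    rw [D.f_odd y (ne_of_lt hy), neg_neg]
  · exact D.f_continuousOn.continuousAt (Ioi_mem_nhds h)

theorem Adm.frc_of_abs_mem (hM : D.Adm M) {x : ℝ} (h1 : M⁻¹ ≤ |x|) (h2 : |x| ≤ M) :
    D.frc M x = D.f x := by
  rcases abs_cases x with ⟨e, -⟩ | ⟨e, e'⟩
  · rw [e] at h1 h2
    exact hM.frc_of_mem h1 h2
  · rw [e] at h1 h2
    have := hM.frc_of_mem h1 h2
    rw [hM.frc_neg, D.f_odd x e'.ne] at this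
    linarith

/-- The two functions differ only for |x| < 1/M, where both have absolute value at most M^(-κ) and
the same sign. Hence convergence is uniform on bounded sets. -/
theorem Adm.abs_psi_sub_le (hM : D.Adm M) {x : ℝ} (h : |x| ≤ M) :
    |D.psi M x - signedPow D.κ x| ≤ M⁻¹ ^ D.κ := by
  have hκ := D.κ_pos
  have key : ∀ y, 0 ≤ y → y ≤ M → |D.psi M y - signedPow D.κ y| ≤ M⁻¹ ^ D.κ := by
    intro y h0 h1
    rw [signedPow_of_nonneg hκ h0]
    rcases le_total M⁻¹ y with h2 | h2
    · rw [hM.psi_of_mem h2 h1, sub_self, abs_zero]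
      exact Real.rpow_nonneg hM.inv_pos.le _
    · have e1 := hM.psi_mono h0 h2
      rw [hM.psi_of_mem le_rfl (inv_le_self_of_one_le hM.one_le)] at e1
      have e2 := hM.psi_nonneg h0
      have e3 := Real.rpow_le_rpow h0 h2 hκ.le
      have e4 := Real.rpow_nonneg h0 D.κ
      rw [abs_le]
      constructor <;> linarith
  rcases abs_cases x with ⟨e, e'⟩ | ⟨e, e'⟩
  · rw [e] at h
    exact key x e' h
  · rw [e] at h
    have := key (-x) (by linarith) h
    rwa [hM.psi_neg, signedPow_neg, ← neg_add', abs_neg, ← sub_eq_add_neg] at this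

section FixedParameter

variable {W w₀ t₂ s t ρ : ℝ} (S : D.Sol M a v w) (hM : D.Adm M) (B : D.Bounds W w₀ t₂ M v w)
include S hM B

/-- Where `|v|` is small, `w` varies little. -/
theorem Bounds.abs_w_sub_le (ht₂ : 0 < t₂) (hMt : M⁻¹ ≤ t₂) (hw₀ : 0 < w₀)
    (hMw : M⁻¹ ≤ w₀) (hwM : w₀ ≤ M) (hs : t₂ ≤ s) (hst : s ≤ t)
    (ht : t ≤ D.T) (hρ : ρ ≤ D.β) (hv : ∀ x ∈ Icc s t, |v x| ≤ ρ) :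
    w₀ ^ D.κ * |w t - w s| ≤ 3 * D.h t₂ * (D.C / (1 - D.m) * ρ ^ (1 - D.m)) := by
  have hm := D.m_lt_one
  set F := D.C / (1 - D.m) * ρ ^ (1 - D.m) with hF
  have hFrc : ∀ x ∈ Icc s t, |D.Frc M (v x)| ≤ F := fun x hx => by
    refine (hM.abs_Frc_le ((hv x hx).trans hρ)).trans ?_
    exact mul_le_mul_of_nonneg_left (Real.rpow_le_rpow (abs_nonneg _) (hv x hx) (by linarith))
      (div_nonneg D.C_pos.le (by linarith))
  have hsm : s ∈ Icc s t := ⟨le_rfl, hst⟩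
  have htm : t ∈ Icc s t := ⟨hst, le_rfl⟩
  have hF0 : 0 ≤ F := (abs_nonneg _).trans (hFrc s hsm)
  have hs0 : 0 < s := ht₂.trans_le hs
  -- Together these give |en(t) - en(s)| ≤ F h(t₂), and the potential terms at s and t cost F h(t₂)
  -- each: whence the factor 3. Then Ψ has slope at least w₀^κ at the values of |w|, and w has
  -- constant sign.
  have e1 := S.en_sub_mono hM (hMt.trans hs) hst ht (B := F) fun x hx => (abs_le.1 (hFrc x hx)).2
  have e2 := S.en_sub_anti hM (hMt.trans hs) hst ht (B := -F) fun x hx => (abs_le.1 (hFrc x hx)).1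
  have hhs := D.h_pos s ⟨hs0, hst.trans ht⟩
  have hht := D.h_pos t ⟨hs0.trans_le hst, ht⟩
  have hh1 := h_antitone ht₂ hs (hst.trans ht)
  have hh2 := h_antitone hs0 hst ht
  have e3 : |D.h s * D.Frc M (v s)| ≤ D.h t₂ * F := by
    rw [abs_mul, abs_of_pos hhs]
    exact mul_le_mul hh1 (hFrc s hsm) (abs_nonneg _) (hhs.le.trans hh1)
  have e4 : |D.h t * D.Frc M (v t)| ≤ D.h t₂ * F := by
    rw [abs_mul, abs_of_pos hht]
    exact mul_le_mul (hh2.trans hh1) (hFrc t htm) (abs_nonneg _) (hhs.le.trans hh1)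
  have e5 : F * D.h s ≤ D.h t₂ * F := by
    rw [mul_comm]; exact mul_le_mul_of_nonneg_right hh1 hF0
  have e6 := mul_nonneg hF0 hht.le
  have hΨ : |D.Psi M (w t) - D.Psi M (w s)| ≤ 3 * D.h t₂ * F := by
    unfold en at e1 e2
    rw [abs_le] at e3 e4 ⊢
    constructor <;> linarith [e3.1, e3.2, e4.1, e4.2]
  have hwlow : ∀ x ∈ Icc s t, w₀ ≤ |w x| := fun x hx =>
    B.le_abs_w x ⟨hs0.le.trans hx.1, hx.2.trans ht⟩ ((hv x hx).trans hρ)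
  have habs : |w t - w s| = |(|w t| - |w s|)| := by
    rcases forall_lt_or_forall_lt_neg (c := 0) le_rfl
      (S.continuousOn_w.mono (Icc_subset_Icc hs0.le ht))
      (fun x hx => hw₀.trans_le (hwlow x hx)) with h | h
    · rw [abs_of_pos (h t htm), abs_of_pos (h s hsm)]
    · have h1 := h t htm
      have h2 := h s hsm
      rw [neg_zero] at h1 h2
      rw [abs_of_neg h1, abs_of_neg h2, ← abs_neg (w t - w s)]
      congr 1
      ring
  have hψ : D.psi M w₀ = w₀ ^ D.κ := hM.psi_of_mem hMw hwM
  have key : ∀ x y, w₀ ≤ x → x ≤ y → w₀ ^ D.κ * (y - x) ≤ D.Psi M y - D.Psi M x := by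
    intro x y hx hxy
    refine le_trans ?_ (hM.Psi_sub_ge (hw₀.le.trans hx) hxy)
    rw [← hψ]
    exact mul_le_mul_of_nonneg_right (hM.psi_mono hw₀.le hx) (sub_nonneg.2 hxy)
  rw [habs]
  rw [← hM.Psi_abs (w t), ← hM.Psi_abs (w s)] at hΨ
  rcases le_total |w s| |w t| with h | h
  · rw [abs_of_nonneg (sub_nonneg.2 h)]
    exact (key _ _ (hwlow s hsm) h).trans ((le_abs_self _).trans hΨ)
  · rw [abs_sub_comm, abs_of_nonneg (sub_nonneg.2 h)]
    rw [abs_sub_comm] at hΨ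
    exact (key _ _ (hwlow t htm) h).trans ((le_abs_self _).trans hΨ)

/-- Near a point where `|v|` is small there is a zero of `v`. -/
theorem Bounds.exists_zero_near (hw₀ : 0 < w₀) (hMw : M⁻¹ ≤ w₀) (hwM : w₀ ≤ M) {η : ℝ}
    (hη : 0 < η) (h0 : 0 ≤ t - η) (hT : t + η ≤ D.T)
    (hv : ∀ x ∈ Icc (t - η) (t + η), |v x| ≤ D.β) (hvt : |v t| ≤ w₀ ^ D.κ * η) :
    ∃ z ∈ Icc (t - η) (t + η), v z = 0 := by
  have hsub : Icc (t - η) (t + η) ⊆ Icc 0 D.T := Icc_subset_Icc h0 hT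
  have hψ : D.psi M w₀ = w₀ ^ D.κ := hM.psi_of_mem hMw hwM
  have hcv := S.continuousOn_v.mono hsub
  have hd : ∀ x ∈ Ioo (t - η) (t + η), HasDerivAt v (D.psi M (w x)) x := fun x hx =>
    S.hasDerivAt_v (h0.trans_lt hx.1) (hx.2.trans_le hT)
  have hwlow : ∀ x ∈ Icc (t - η) (t + η), w₀ ≤ |w x| := fun x hx =>
    B.le_abs_w x (hsub hx) (hv x hx)
  have hw₀κ : 0 < w₀ ^ D.κ := Real.rpow_pos_of_pos hw₀ _
  have hvt' := abs_le.1 hvt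
  have c1 : ContinuousOn v (Icc (t - η) t) := hcv.mono (Icc_subset_Icc le_rfl (by linarith))
  have c2 : ContinuousOn v (Icc t (t + η)) := hcv.mono (Icc_subset_Icc (by linarith) le_rfl)
  have hl : t - η ∈ Icc (t - η) (t + η) := ⟨le_rfl, by linarith⟩
  have hr : t + η ∈ Icc (t - η) (t + η) := ⟨by linarith, le_rfl⟩
  rcases forall_lt_or_forall_lt_neg (c := 0) le_rfl (S.continuousOn_w.mono hsub)
      (fun x hx => hw₀.trans_le (hwlow x hx)) with h | h
  · have hb : ∀ x ∈ Ioo (t - η) (t + η), w₀ ^ D.κ ≤ D.psi M (w x) := fun x hx => by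
      have := hwlow x (Ioo_subset_Icc_self hx)
      rw [abs_of_pos (h x (Ioo_subset_Icc_self hx))] at this
      rw [← hψ]
      exact hM.psi_mono hw₀.le this
    have e1 := le_sub_of_le_hasDerivAt (by linarith) c1
      (fun x hx => hd x ⟨hx.1, by linarith [hx.2]⟩)
      fun x hx => hb x ⟨hx.1, by linarith [hx.2]⟩
    have e2 := le_sub_of_le_hasDerivAt (by linarith) c2
      (fun x hx => hd x ⟨by linarith [hx.1], hx.2⟩)
      fun x hx => hb x ⟨by linarith [hx.1], hx.2⟩
    rw [sub_sub_cancel] at e1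
    rw [add_sub_cancel_left] at e2
    exact isPreconnected_Icc.intermediate_value hl hr hcv
      (show (0 : ℝ) ∈ Icc (v (t - η)) (v (t + η)) from ⟨by linarith, by linarith⟩)
  · have hb : ∀ x ∈ Ioo (t - η) (t + η), D.psi M (w x) ≤ -w₀ ^ D.κ := fun x hx => by
      have := hwlow x (Ioo_subset_Icc_self hx)
      have h' := h x (Ioo_subset_Icc_self hx)
      rw [neg_zero] at h'
      rw [abs_of_neg h'] at this
      have := hM.psi_mono hw₀.le this
      rw [hψ, hM.psi_neg] at this
      linarith
    have e1 := sub_le_of_hasDerivAt_le (by linarith) c1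
      (fun x hx => hd x ⟨hx.1, by linarith [hx.2]⟩)
      fun x hx => hb x ⟨hx.1, by linarith [hx.2]⟩
    have e2 := sub_le_of_hasDerivAt_le (by linarith) c2
      (fun x hx => hd x ⟨by linarith [hx.1], hx.2⟩)
      fun x hx => hb x ⟨by linarith [hx.1], hx.2⟩
    rw [sub_sub_cancel] at e1
    rw [add_sub_cancel_left] at e2
    exact isPreconnected_Icc.intermediate_value hr hl hcv
      (show (0 : ℝ) ∈ Icc (v (t + η)) (v (t - η)) from ⟨by linarith, by linarith⟩)

end FixedParameter

/-- A pointwise limit of regularized solutions as the regularization is removed. -/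
structure IsLimit {ι : Type*} (D : ShootingData) (l : Filter ι) (M a : ι → ℝ)
    (v w : ι → ℝ → ℝ) (W w₀ t₂ : ℝ) (V U : ℝ → ℝ) : Prop where
  W_ge : 1 ≤ W
  w₀_pos : 0 < w₀
  t₂_pos : 0 < t₂
  t₂_le : t₂ ≤ D.T
  tendsto_M : Tendsto M l atTop
  sol : ∀ᶠ k in l, D.Sol (M k) (a k) (v k) (w k)
  bounds : ∀ᶠ k in l, D.Bounds W w₀ t₂ (M k) (v k) (w k)
  tendsto_v : ∀ t ∈ Icc 0 D.T, Tendsto (fun k => v k t) l (𝓝 (V t))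
  tendsto_w : ∀ t ∈ Icc 0 D.T, Tendsto (fun k => w k t) l (𝓝 (U t))

namespace IsLimit

variable {ι : Type*} {l : Filter ι} [l.NeBot] {M a : ι → ℝ} {v w : ι → ℝ → ℝ} {W w₀ t₂ : ℝ}
  {V U : ℝ → ℝ} (H : D.IsLimit l M a v w W w₀ t₂ V U)
include H

omit [l.NeBot] in
theorem adm : ∀ᶠ k in l, D.Adm (M k) := H.tendsto_M.eventually D.eventually_adm

omit [l.NeBot] in
theorem inv_le {ε : ℝ} (hε : 0 < ε) : ∀ᶠ k in l, (M k)⁻¹ ≤ ε :=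
  (tendsto_inv_atTop_zero.comp H.tendsto_M).eventually_le_const hε

omit [l.NeBot] in
theorem lipschitz : ∀ᶠ k in l, ∀ s ∈ Icc 0 D.T, ∀ t ∈ Icc 0 D.T,
    |v k t - v k s| ≤ W ^ D.κ * |t - s| := by
  filter_upwards [H.adm, H.sol, H.bounds] with k hM S B s hs t ht
  rcases le_total s t with h | h
  · rw [abs_of_nonneg (sub_nonneg.2 h)]
    exact S.abs_v_sub_le hM H.W_ge B.abs_w_le hs.1 h ht.2
  · rw [abs_sub_comm, abs_sub_comm t s, abs_of_nonneg (sub_nonneg.2 h)]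
    exact S.abs_v_sub_le hM H.W_ge B.abs_w_le ht.1 h hs.2

theorem abs_V_sub_le {s t : ℝ} (hs : s ∈ Icc 0 D.T) (ht : t ∈ Icc 0 D.T) :
    |V t - V s| ≤ W ^ D.κ * |t - s| := by
  refine le_of_tendsto ((H.tendsto_v t ht).sub (H.tendsto_v s hs)).abs ?_
  filter_upwards [H.lipschitz] with k hk
  exact hk s hs t ht

theorem continuousOn_V : ContinuousOn V (Icc 0 D.T) := by
  have hW : 0 ≤ W ^ D.κ := Real.rpow_nonneg (by linarith [H.W_ge]) _
  refine (LipschitzOnWith.of_dist_le_mul (K := (W ^ D.κ).toNNReal) fun x hx y hy => ?_).continuousOn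
  rw [Real.dist_eq, Real.dist_eq, Real.coe_toNNReal _ hW]
  exact H.abs_V_sub_le hy hx

theorem V_zero : V 0 = 0 := by
  have h0 : (0 : ℝ) ∈ Icc 0 D.T := ⟨le_rfl, D.T_pos.le⟩
  refine tendsto_nhds_unique (H.tendsto_v 0 h0) (tendsto_const_nhds.congr' ?_)
  filter_upwards [H.sol] with k S
  exact S.v_zero.symm

theorem le_V {t : ℝ} (ht : t ∈ Icc 0 t₂) : t ≤ V t := by
  refine ge_of_tendsto (H.tendsto_v t ⟨ht.1, ht.2.trans H.t₂_le⟩) ?_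
  filter_upwards [H.bounds] with k B
  exact B.le_v t ht

theorem U_ne_zero {t : ℝ} (ht : t ∈ Icc 0 D.T) (hV : V t = 0) : U t ≠ 0 := by
  have h1 : w₀ ≤ |U t| := by
    refine ge_of_tendsto (H.tendsto_w t ht).abs ?_
    have h2 := (H.tendsto_v t ht).abs
    rw [hV, abs_zero] at h2
    filter_upwards [H.bounds, h2.eventually_le_const D.β_pos] with k B hk
    exact B.le_abs_w t ht hk
  exact abs_pos.1 (H.w₀_pos.trans_le h1)

omit [l.NeBot] in
theorem eventually_v_near {t ε : ℝ} (ht : t ∈ Icc 0 D.T) (hε : 0 < ε) :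
    ∃ δ > 0, ∀ᶠ k in l, ∀ s ∈ Icc 0 D.T, |s - t| < δ → |v k s - V t| < ε := by
  have hW : 0 < W ^ D.κ := Real.rpow_pos_of_pos (by linarith [H.W_ge]) _
  refine ⟨ε / 2 / W ^ D.κ, by positivity, ?_⟩
  have h2 : Tendsto (fun k => |v k t - V t|) l (𝓝 0) := by
    simpa using ((H.tendsto_v t ht).sub_const (V t)).abs
  filter_upwards [H.lipschitz, h2.eventually_lt_const (half_pos hε)] with k h3 h4 s hs hst
  have h5 := h3 t ht s hs
  have h6 : W ^ D.κ * |s - t| ≤ ε / 2 := by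
    rw [mul_comm, ← le_div_iff₀ hW]; exact hst.le
  have h7 := abs_sub_le (v k s) (v k t) (V t)
  linarith

-- Near t the v_k stay away from 0 and s stays away from 0, so for large M all truncations in the
-- force are inactive and continuity of h and f suffices.
omit [l.NeBot] in
theorem eventually_force_near {t : ℝ} (ht : t ∈ Ioc 0 D.T) (hV : V t ≠ 0) {ε : ℝ} (hε : 0 < ε) :
    ∃ δ > 0, ∀ᶠ k in l, ∀ s ∈ Ioo 0 D.T, |s - t| < δ →
      |-(D.wt (M k) s * D.frc (M k) (v k s)) - -(D.h t * D.f (V t))| ≤ ε := by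
  have h1 : Tendsto (fun x : ℝ × ℝ => D.h x.1 * D.f x.2) (𝓝[Ioc 0 D.T] t ×ˢ 𝓝 (V t))
      (𝓝 (D.h t * D.f (V t))) :=
    ((D.h_cont t ht).tendsto.comp tendsto_fst).mul
      ((D.continuousAt_f hV).tendsto.comp tendsto_snd)
  have h2 := h1.eventually (Metric.ball_mem_nhds _ hε)
  obtain ⟨P, hP, Q, hQ, hPQ⟩ := eventually_prod_iff.1 h2
  obtain ⟨δ₁, hδ₁, hP'⟩ := Metric.mem_nhdsWithin_iff.1 hP
  obtain ⟨ε₂, hε₂, hQ'⟩ := Metric.mem_nhds_iff.1 hQ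
  have hVp := abs_pos.2 hV
  obtain ⟨δ₂, hδ₂, hv⟩ := H.eventually_v_near (Ioc_subset_Icc_self ht)
    (lt_min hε₂ (half_pos hVp))
  refine ⟨min (min δ₁ δ₂) (t / 2), lt_min (lt_min hδ₁ hδ₂) (half_pos ht.1), ?_⟩
  filter_upwards [hv, H.adm, H.inv_le (half_pos hVp), H.inv_le (half_pos ht.1),
    H.tendsto_M.eventually_ge_atTop (2 * |V t|)] with k hk hM hM1 hM2 hM3 s hs hst
  have hst1 : |s - t| < δ₁ := hst.trans_le ((min_le_left _ _).trans (min_le_left _ _))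
  have hst2 : |s - t| < δ₂ := hst.trans_le ((min_le_left _ _).trans (min_le_right _ _))
  have hst3 : |s - t| < t / 2 := hst.trans_le (min_le_right _ _)
  have e1 := hk s (Ioo_subset_Icc_self hs) hst2
  have e2 : |v k s - V t| < |V t| / 2 := e1.trans_le (min_le_right _ _)
  have e3 := abs_sub_abs_le_abs_sub (V t) (v k s)
  rw [abs_sub_comm] at e3
  have e4 := abs_sub_abs_le_abs_sub (v k s) (V t)
  rw [hM.frc_of_abs_mem (by linarith) (by linarith),
    wt_of_ge (by linarith [(abs_lt.1 hst3).1])]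
  have e5 := hPQ (x := s) (hP' ⟨by rwa [Metric.mem_ball, Real.dist_eq], hs.1, hs.2.le⟩)
    (y := v k s) (hQ' (by
      rw [Metric.mem_ball, Real.dist_eq]; exact e1.trans_le (min_le_left _ _)))
  have e6 : |D.h s * D.f (v k s) - D.h t * D.f (V t)| < ε := e5
  rw [neg_sub_neg, abs_sub_comm]
  exact e6.le

theorem hasDerivWithinAt_U {t : ℝ} (ht : t ∈ Ioc 0 D.T) (hV : V t ≠ 0) :
    HasDerivWithinAt U (-(D.h t * D.f (V t))) (Icc 0 D.T) t := by
  refine hasDerivWithinAt_of_tendsto (Ioc_subset_Icc_self ht) H.tendsto_w ?_ ?_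
    (fun ε hε => H.eventually_force_near ht hV hε)
  · filter_upwards [H.sol] with k S using S.continuousOn_w
  · filter_upwards [H.sol] with k S s hs using S.hasDerivAt_w hs.1 hs.2

omit [l.NeBot] in
theorem equicontinuous_w_of_ne {t : ℝ} (ht : t ∈ Ioc 0 D.T) (hV : V t ≠ 0) {ε : ℝ} (hε : 0 < ε) :
    ∃ δ > 0, ∀ᶠ k in l, ∀ s ∈ Icc 0 D.T, |s - t| < δ → |w k s - w k t| ≤ ε := by
  obtain ⟨δ, hδ, hev⟩ := H.eventually_force_near ht hV one_pos
  set L := |-(D.h t * D.f (V t))| + 1 with hL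
  have hL0 : 0 < L := by positivity
  refine ⟨min δ (ε / L), lt_min hδ (by positivity), ?_⟩
  filter_upwards [hev, H.sol] with k hk S s hs hst
  have hst1 : |s - t| < δ := hst.trans_le (min_le_left _ _)
  have hst2 : L * |s - t| ≤ ε := by
    rw [mul_comm, ← le_div_iff₀ hL0]; exact (hst.trans_le (min_le_right _ _)).le
  have hb : ∀ x ∈ Ioo 0 D.T, |x - t| < δ →
      |-(D.wt (M k) x * D.frc (M k) (v k x))| ≤ L := fun x hx hxt => by
    have := hk x hx hxt
    have h2 := abs_sub_abs_le_abs_sub (-(D.wt (M k) x * D.frc (M k) (v k x)))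
      (-(D.h t * D.f (V t)))
    linarith
  rcases le_total s t with h | h
  · have := abs_sub_le_of_abs_hasDerivAt_le h (S.continuousOn_w.mono (Icc_subset_Icc hs.1 ht.2))
      (fun x hx => S.hasDerivAt_w (hs.1.trans_lt hx.1) (hx.2.trans_le ht.2))
      (fun x hx => hb x ⟨hs.1.trans_lt hx.1, hx.2.trans_le ht.2⟩ (by
        rw [abs_sub_comm, abs_of_nonneg (by linarith [hx.2])]
        rw [abs_sub_comm, abs_of_nonneg (by linarith)] at hst1
        linarith [hx.1]))
    rw [abs_sub_comm s t, abs_of_nonneg (sub_nonneg.2 h)] at hst2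
    rw [abs_sub_comm]
    linarith
  · have := abs_sub_le_of_abs_hasDerivAt_le h (S.continuousOn_w.mono (Icc_subset_Icc ht.1.le hs.2))
      (fun x hx => S.hasDerivAt_w (ht.1.trans hx.1) (hx.2.trans_le hs.2))
      (fun x hx => hb x ⟨ht.1.trans hx.1, hx.2.trans_le hs.2⟩ (by
        rw [abs_of_nonneg (by linarith [hx.1])]
        rw [abs_of_nonneg (by linarith)] at hst1
        linarith [hx.2]))
    rw [abs_of_nonneg (sub_nonneg.2 h)] at hst2
    linarith

theorem t₂_lt_of_eq {t : ℝ} (ht : t ∈ Ioc 0 D.T) (hV : V t = 0) : t₂ < t := by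
  by_contra! h
  have := H.le_V ⟨ht.1.le, h⟩
  linarith [ht.1]

/-- At a zero of V the force is not bounded uniformly in M. The energy replaces it: |v_k| ≤ ρ on a
common neighbourhood, so w_k varies by at most a multiple of ρ^(1-m). -/
theorem equicontinuous_w_of_eq {t : ℝ} (ht : t ∈ Ioc 0 D.T) (hV : V t = 0) {ε : ℝ} (hε : 0 < ε) :
    ∃ δ > 0, ∀ᶠ k in l, ∀ s ∈ Icc 0 D.T, |s - t| < δ → |w k s - w k t| ≤ ε := by
  have hm := D.m_lt_one
  have htt := H.t₂_lt_of_eq ht hV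
  have hw₀κ : 0 < w₀ ^ D.κ := Real.rpow_pos_of_pos H.w₀_pos _
  obtain ⟨ρ, hρβ, hρε, hρ⟩ : ∃ ρ, ρ ≤ D.β ∧
      3 * D.h t₂ * (D.C / (1 - D.m) * ρ ^ (1 - D.m)) ≤ w₀ ^ D.κ * ε ∧ 0 < ρ := by
    have h2 : Tendsto (fun ρ : ℝ => 3 * D.h t₂ * (D.C / (1 - D.m) * ρ ^ (1 - D.m))) (𝓝 0)
        (𝓝 0) := by
      have : Continuous fun ρ : ℝ => 3 * D.h t₂ * (D.C / (1 - D.m) * ρ ^ (1 - D.m)) :=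
        continuous_const.mul (continuous_const.mul (Real.continuous_rpow_const (by linarith)))
      simpa [Real.zero_rpow (by linarith : 1 - D.m ≠ 0)] using this.tendsto 0
    have h3 : ∀ᶠ ρ in 𝓝[>] (0 : ℝ), ρ ≤ D.β ∧
        3 * D.h t₂ * (D.C / (1 - D.m) * ρ ^ (1 - D.m)) ≤ w₀ ^ D.κ * ε :=
      nhdsWithin_le_nhds ((eventually_le_nhds D.β_pos).and
        (h2.eventually_le_const (by positivity)))
    obtain ⟨ρ, h4, h5⟩ := (h3.and self_mem_nhdsWithin).exists
    exact ⟨ρ, h4.1, h4.2, h5⟩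
  obtain ⟨δ, hδ, hev⟩ := H.eventually_v_near (Ioc_subset_Icc_self ht) hρ
  refine ⟨min δ (t - t₂), lt_min hδ (by linarith), ?_⟩
  filter_upwards [hev, H.sol, H.adm, H.bounds, H.inv_le H.t₂_pos, H.inv_le H.w₀_pos,
    H.tendsto_M.eventually_ge_atTop w₀] with k hk S hM B hM1 hM2 hM3 s hs hst
  have hst1 : |s - t| < δ := hst.trans_le (min_le_left _ _)
  have hst2 : |s - t| < t - t₂ := hst.trans_le (min_le_right _ _)
  rw [hV] at hk
  simp only [sub_zero] at hk
  refine le_of_mul_le_mul_left ?_ hw₀κ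
  rcases le_total s t with h | h
  · rw [abs_sub_comm]
    refine (B.abs_w_sub_le S hM H.t₂_pos hM1 H.w₀_pos hM2 hM3 ?_ h ht.2 hρβ
      fun x hx => (hk x ⟨hs.1.trans hx.1, hx.2.trans ht.2⟩ ?_).le).trans hρε
    · linarith [(abs_lt.1 hst2).1]
    · rw [abs_sub_comm, abs_of_nonneg (by linarith [hx.2])]
      rw [abs_sub_comm, abs_of_nonneg (by linarith)] at hst1
      linarith [hx.1]
  · refine (B.abs_w_sub_le S hM H.t₂_pos hM1 H.w₀_pos hM2 hM3 htt.le h hs.2 hρβ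
      fun x hx => (hk x ⟨ht.1.le.trans hx.1, hx.2.trans hs.2⟩ ?_).le).trans hρε
    rw [abs_of_nonneg (by linarith [hx.1])]
    rw [abs_of_nonneg (by linarith)] at hst1
    linarith [hx.2]

theorem equicontinuous_w {t : ℝ} (ht : t ∈ Ioc 0 D.T) {ε : ℝ} (hε : 0 < ε) :
    ∃ δ > 0, ∀ᶠ k in l, ∀ s ∈ Icc 0 D.T, |s - t| < δ → |w k s - w k t| ≤ ε := by
  by_cases hV : V t = 0
  · exact H.equicontinuous_w_of_eq ht hV hε
  · exact H.equicontinuous_w_of_ne ht hV hε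

theorem continuousOn_U : ContinuousOn U (Ioc 0 D.T) := by
  intro t ht
  rw [Metric.continuousWithinAt_iff]
  intro ε hε
  obtain ⟨δ, hδ, hev⟩ := H.equicontinuous_w ht (half_pos hε)
  refine ⟨δ, hδ, fun s hs hst => ?_⟩
  rw [Real.dist_eq] at hst ⊢
  have hs' := Ioc_subset_Icc_self hs
  refine lt_of_le_of_lt (le_of_tendsto ((H.tendsto_w s hs').sub
    (H.tendsto_w t (Ioc_subset_Icc_self ht))).abs ?_) (half_lt_self hε)
  filter_upwards [hev] with k hk using hk s hs' hst

theorem hasDerivWithinAt_V {t : ℝ} (ht : t ∈ Ioc 0 D.T) :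
    HasDerivWithinAt V (signedPow D.κ (U t)) (Icc 0 D.T) t := by
  have hκ := D.κ_pos
  refine hasDerivWithinAt_of_tendsto (Ioc_subset_Icc_self ht) H.tendsto_v
    (g' := fun k s => D.psi (M k) (w k s)) ?_ ?_ fun ε hε => ?_
  · filter_upwards [H.sol] with k S using S.continuousOn_v
  · filter_upwards [H.sol] with k S s hs using S.hasDerivAt_v hs.1 hs.2
  obtain ⟨η, hη, hηψ⟩ := Metric.continuousAt_iff.1
    ((continuous_signedPow hκ).continuousAt (x := U t)) (ε / 2) (half_pos hε)
  obtain ⟨δ, hδ, hev⟩ := H.equicontinuous_w ht (half_pos hη)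
  have h1 : Tendsto (fun k => |w k t - U t|) l (𝓝 0) := by
    simpa using ((H.tendsto_w t (Ioc_subset_Icc_self ht)).sub_const (U t)).abs
  have h2 : Tendsto (fun k => (M k)⁻¹ ^ D.κ) l (𝓝 0) := by
    have := (tendsto_inv_atTop_zero.comp H.tendsto_M).rpow_const (p := D.κ) (Or.inr hκ.le)
    rwa [Real.zero_rpow hκ.ne'] at this
  refine ⟨δ, hδ, ?_⟩
  filter_upwards [hev, h1.eventually_lt_const (half_pos hη), h2.eventually_lt_const (half_pos hε),
    H.adm, H.bounds, H.tendsto_M.eventually_ge_atTop W] with k e1 e2 e3 hM B hMW s hs hst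
  have hs' := Ioo_subset_Icc_self hs
  have e4 := e1 s hs' hst
  have e5 := abs_sub_le (w k s) (w k t) (U t)
  have e6 : dist (w k s) (U t) < η := by rw [Real.dist_eq]; linarith
  have e7 := hηψ e6
  rw [Real.dist_eq] at e7
  have e8 := hM.abs_psi_sub_le ((B.abs_w_le s hs').trans hMW)
  have e9 := abs_sub_le (D.psi (M k) (w k s)) (signedPow D.κ (w k s)) (signedPow D.κ (U t))
  linarith

omit [l.NeBot] in
theorem exists_zero_near {t η : ℝ} (hη : 0 < η) (h0 : 0 < t) (hT : t < D.T) (hV : V t = 0) :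
    ∀ᶠ k in l, ∃ z ∈ Ioo 0 D.T, |z - t| ≤ η ∧ v k z = 0 := by
  have ht : t ∈ Icc 0 D.T := ⟨h0.le, hT.le⟩
  have hw₀κ : 0 < w₀ ^ D.κ := Real.rpow_pos_of_pos H.w₀_pos _
  obtain ⟨δ, hδ, hev⟩ := H.eventually_v_near ht D.β_pos
  set ν := min (min η (δ / 2)) (min (t / 2) ((D.T - t) / 2)) with hν
  have hν0 : 0 < ν := lt_min (lt_min hη (half_pos hδ)) (lt_min (half_pos h0) (by linarith))
  have hν1 : ν ≤ η := (min_le_left _ _).trans (min_le_left _ _)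
  have hν2 : ν ≤ δ / 2 := (min_le_left _ _).trans (min_le_right _ _)
  have hν3 : ν ≤ t / 2 := (min_le_right _ _).trans (min_le_left _ _)
  have hν4 : ν ≤ (D.T - t) / 2 := (min_le_right _ _).trans (min_le_right _ _)
  have h1 := (H.tendsto_v t ht).abs
  rw [hV, abs_zero] at h1
  filter_upwards [hev, H.sol, H.adm, H.bounds, H.inv_le H.w₀_pos,
    H.tendsto_M.eventually_ge_atTop w₀, h1.eventually_le_const (mul_pos hw₀κ hν0)]
    with k hk S hM B hM2 hM3 hvt
  obtain ⟨z, hz, hz0⟩ := B.exists_zero_near S hM H.w₀_pos hM2 hM3 hν0 (by linarith) (by linarith)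
    (fun x hx => by
      have := hk x ⟨by linarith [hx.1], by linarith [hx.2]⟩ (by
        rw [abs_lt]; constructor <;> linarith [hx.1, hx.2])
      rw [hV, sub_zero] at this
      exact this.le) hvt
  refine ⟨z, ⟨by linarith [hz.1], by linarith [hz.2]⟩, ?_, hz0⟩
  rw [abs_le]
  constructor <;> linarith [hz.1, hz.2]

end IsLimit

/-- Solutions of the singular problem vanishing at `T`, with exactly `n` zeros in `(0, T)`. -/
structure SingularSol (D : ShootingData) (n : ℕ) (V U : ℝ → ℝ) : Prop where
  continuousOn_V : ContinuousOn V (Icc 0 D.T)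
  continuousOn_U : ContinuousOn U (Ioc 0 D.T)
  V_zero : V 0 = 0
  V_T : V D.T = 0
  dV : ∀ t ∈ Ioc 0 D.T, HasDerivWithinAt V (signedPow D.κ (U t)) (Icc 0 D.T) t
  dU : ∀ t ∈ Ioc 0 D.T, V t ≠ 0 →
    HasDerivWithinAt U (-(D.h t * D.f (V t))) (Icc 0 D.T) t
  U_ne_zero : ∀ t ∈ Ioc 0 D.T, V t = 0 → U t ≠ 0
  encard : {t | t ∈ Ioo 0 D.T ∧ V t = 0}.encard = n

theorem _root_.Ultrafilter.exists_tendsto_Icc {ι : Type*} (l : Ultrafilter ι) {g : ι → ℝ}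
    {a b : ℝ} (h : ∀ᶠ k in (l : Filter ι), g k ∈ Icc a b) :
    ∃ x, Tendsto g l (𝓝 x) := by
  obtain ⟨x, -, hx⟩ := isCompact_Icc.ultrafilter_le_nhds (l.map g) (le_principal_iff.2 h)
  exact ⟨x, hx⟩

/-- The n zeros of the approximations converge to n distinct zeros of V in the open interval, by the
uniform spacing. Simplicity of zeros shows that V has no others. -/
theorem exists_singularSol (D : ShootingData) : ∃ n₀ : ℕ, ∀ n ≥ n₀, ∃ V U, D.SingularSol n V U := by
  obtain ⟨n₀, hn₀⟩ := D.exists_regularized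
  refine ⟨n₀, fun n hn => ?_⟩
  obtain ⟨a₁, ha₁, hev⟩ := hn₀ n hn
  obtain ⟨W, w₀, t₂, hW1, hw₀, ht₂, ht₂T, hbd⟩ := D.uniform_bounds ha₁
  have hT := D.T_pos
  have hWκ : 0 < W ^ D.κ := Real.rpow_pos_of_pos (by linarith) _
  -- Regularized solutions exist only for large k; the implication lets them be chosen for every k.
  have hex : ∀ k : ℕ, ∃ (a : ℝ) (v w : ℝ → ℝ) (z : Fin n → ℝ),
      (∃ a ∈ Icc 1 a₁, ∃ v w, D.Sol k a v w ∧ v D.T = 0 ∧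
      ∃ z : Fin n → ℝ, (∀ i, z i ∈ Ioo 0 D.T ∧ v (z i) = 0) ∧ Function.Injective z ∧
        ∀ t ∈ Ioo 0 D.T, v t = 0 → ∃ i, t = z i) → a ∈ Icc 1 a₁ ∧ D.Sol k a v w ∧ v D.T = 0 ∧
      (∀ i, z i ∈ Ioo 0 D.T ∧ v (z i) = 0) ∧ Function.Injective z ∧
        ∀ t ∈ Ioo 0 D.T, v t = 0 → ∃ i, t = z i := by
    intro k
    by_cases h : ∃ a ∈ Icc 1 a₁, ∃ v w, D.Sol k a v w ∧ v D.T = 0 ∧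
      ∃ z : Fin n → ℝ, (∀ i, z i ∈ Ioo 0 D.T ∧ v (z i) = 0) ∧ Function.Injective z ∧
        ∀ t ∈ Ioo 0 D.T, v t = 0 → ∃ i, t = z i
    · obtain ⟨a, ha, v, w, S, hv, z, h1, h2, h3⟩ := h
      exact ⟨a, v, w, z, fun _ => ⟨ha, S, hv, h1, h2, h3⟩⟩
    · exact ⟨0, 0, 0, 0, fun h' => absurd h' h⟩
  choose a v w z hk using hex
  -- Bounded families converge pointwise along an ultrafilter, so V, U and the limits of the zeros
  -- are obtained without extracting subsequences.
  let l : Ultrafilter ℕ := hyperfilter ℕ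
  have hl : (l : Filter ℕ) ≤ atTop := by
    rw [← Nat.cofinite_eq_atTop]; exact hyperfilter_le_cofinite
  have hcast : Tendsto (fun k : ℕ => (k : ℝ)) l atTop := tendsto_natCast_atTop_atTop.mono_left hl
  have hall := (hcast.eventually hev).mono fun k h => hk k h
  have hadm := hcast.eventually D.eventually_adm
  have hMt := (tendsto_inv_atTop_zero.comp hcast).eventually_le_const ht₂
  have hbounds : ∀ᶠ k : ℕ in (l : Filter ℕ), D.Bounds W w₀ t₂ k (v k) (w k) := by
    filter_upwards [hall, hadm, hMt] with k h1 h2 h3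
    exact hbd k h2 h3 (a k) h1.1 _ _ h1.2.1
  have hvb : ∀ t ∈ Icc 0 D.T, ∀ᶠ k in (l : Filter ℕ), v k t ∈ Icc (-(W ^ D.κ * D.T))
      (W ^ D.κ * D.T) := by
    intro t ht
    filter_upwards [hall, hadm, hbounds] with k h1 h2 h3
    have := h1.2.1.abs_v_sub_le h2 hW1 h3.abs_w_le le_rfl ht.1 ht.2
    rw [h1.2.1.v_zero, sub_zero, sub_zero] at this
    exact abs_le.1 (this.trans (mul_le_mul_of_nonneg_left ht.2 hWκ.le))
  have hwb : ∀ t ∈ Icc 0 D.T, ∀ᶠ k in (l : Filter ℕ), w k t ∈ Icc (-W) W := by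
    intro t ht
    filter_upwards [hbounds] with k h3
    exact abs_le.1 (h3.abs_w_le t ht)
  have hV : ∀ t, ∃ x, t ∈ Icc 0 D.T → Tendsto (fun k => v k t) l (𝓝 x) := fun t => by
    by_cases ht : t ∈ Icc 0 D.T
    · obtain ⟨x, hx⟩ := l.exists_tendsto_Icc (hvb t ht)
      exact ⟨x, fun _ => hx⟩
    · exact ⟨0, fun h => absurd h ht⟩
  have hU : ∀ t, ∃ x, t ∈ Icc 0 D.T → Tendsto (fun k => w k t) l (𝓝 x) := fun t => by
    by_cases ht : t ∈ Icc 0 D.T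
    · obtain ⟨x, hx⟩ := l.exists_tendsto_Icc (hwb t ht)
      exact ⟨x, fun _ => hx⟩
    · exact ⟨0, fun h => absurd h ht⟩
  have hZ : ∀ i, ∃ x, Tendsto (fun k => z k i) l (𝓝 x) := fun i =>
    l.exists_tendsto_Icc (a := 0) (b := D.T)
      (hall.mono fun k h => Ioo_subset_Icc_self (h.2.2.2.1 i).1)
  choose V hV using hV
  choose U hU using hU
  choose Z hZ using hZ
  have H : D.IsLimit (l : Filter ℕ) (fun k => (k : ℝ)) a v w W w₀ t₂ V U :=
    ⟨hW1, hw₀, ht₂, ht₂T, hcast, hall.mono fun k h => h.2.1, hbounds, hV, hU⟩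
  have hTm : D.T ∈ Icc 0 D.T := ⟨hT.le, le_rfl⟩
  have hVT : V D.T = 0 := by
    refine tendsto_nhds_unique (hV _ hTm) (tendsto_const_nhds.congr' ?_)
    filter_upwards [hall] with k h using h.2.2.1.symm
  set δ := D.β / W ^ D.κ with hδ
  have hδ0 : 0 < δ := div_pos D.β_pos hWκ
  have hgap : ∀ᶠ k in (l : Filter ℕ), ∀ s t, 0 ≤ s → s < t → t ≤ D.T → v k s = 0 → v k t = 0 →
      δ ≤ t - s := by
    filter_upwards [hall, hadm, hbounds] with k h1 h2 h3 s t e1 e2 e3 e4 e5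
    exact h3.gap h1.2.1 h2 hW1 hw₀ e1 e2 e3 e4 e5
  -- The endpoints 0 and T are zeros too, so the spacing keeps the limits inside (0, T).
  have hZ1 : ∀ i, δ ≤ Z i := fun i => ge_of_tendsto (hZ i) (by
    filter_upwards [hall, hgap] with k h1 h2
    have := h2 0 (z k i) le_rfl (h1.2.2.2.1 i).1.1 (h1.2.2.2.1 i).1.2.le h1.2.1.v_zero
      (h1.2.2.2.1 i).2
    linarith)
  have hZ2 : ∀ i, Z i ≤ D.T - δ := fun i => le_of_tendsto (hZ i) (by
    filter_upwards [hall, hgap] with k h1 h2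
    have := h2 (z k i) D.T (h1.2.2.2.1 i).1.1.le (h1.2.2.2.1 i).1.2 le_rfl
      (h1.2.2.2.1 i).2 h1.2.2.1
    linarith)
  have hZinj : Function.Injective Z := by
    intro i j hij
    by_contra hne
    have h1 : δ ≤ |Z i - Z j| := ge_of_tendsto ((hZ i).sub (hZ j)).abs (by
      filter_upwards [hall, hgap] with k h1 h2
      obtain ⟨hi, hi0⟩ := h1.2.2.2.1 i
      obtain ⟨hj, hj0⟩ := h1.2.2.2.1 j
      rcases lt_trichotomy (z k i) (z k j) with h | h | h
      · rw [abs_sub_comm]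
        exact (h2 _ _ hi.1.le h hj.2.le hi0 hj0).trans (le_abs_self _)
      · exact absurd (h1.2.2.2.2.1 h) hne
      · exact (h2 _ _ hj.1.le h hi.2.le hj0 hi0).trans (le_abs_self _))
    rw [hij, sub_self, abs_zero] at h1
    linarith
  have hZV : ∀ i, V (Z i) = 0 := by
    intro i
    have hZi : Z i ∈ Icc 0 D.T := ⟨by linarith [hZ1 i], by linarith [hZ2 i]⟩
    have h1 : Tendsto (fun k => W ^ D.κ * |Z i - z k i|) l (𝓝 0) := by
      simpa using (((hZ i).const_sub (Z i)).abs).const_mul (W ^ D.κ)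
    have h2 : |V (Z i)| ≤ 0 := by
      refine le_of_tendsto_of_tendsto (hV _ hZi).abs h1 ?_
      filter_upwards [hall, H.lipschitz] with k e1 e2
      have := e2 _ (Ioo_subset_Icc_self (e1.2.2.2.1 i).1) _ hZi
      rwa [(e1.2.2.2.1 i).2, sub_zero] at this
    exact abs_eq_zero.1 (le_antisymm h2 (abs_nonneg _))
  -- Near a zero of V the v_k have zeros; if it differed from every Z i, these would be an
  -- additional zero of v_k.
  have hset : {t | t ∈ Ioo 0 D.T ∧ V t = 0} = range Z := by
    ext t
    constructor
    · rintro ⟨ht, hVt⟩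
      by_contra hcon
      have hne : ∀ i, Z i ≠ t := fun i h => hcon ⟨i, h⟩
      obtain ⟨η, hη, hη0⟩ : ∃ η, (∀ i, η < |Z i - t|) ∧ 0 < η := by
        have : ∀ᶠ η in 𝓝[>] (0 : ℝ), ∀ i, η < |Z i - t| := nhdsWithin_le_nhds
          (eventually_all.2 fun i => eventually_lt_nhds (abs_pos.2 (sub_ne_zero.2 (hne i))))
        exact (this.and self_mem_nhdsWithin).exists
      have h1 : ∀ᶠ k in (l : Filter ℕ), ∀ i, η < |z k i - t| :=
        eventually_all.2 fun i => ((hZ i).sub_const t).abs.eventually_const_lt (hη i)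
      obtain ⟨k, e1, e2, x, hx, hxt, hvx⟩ :=
        (h1.and (hall.and (H.exists_zero_near hη0 ht.1 ht.2 hVt))).exists
      obtain ⟨i, rfl⟩ := e2.2.2.2.2.2 x hx hvx
      linarith [e1 i]
    · rintro ⟨i, rfl⟩
      exact ⟨⟨by linarith [hZ1 i], by linarith [hZ2 i]⟩, hZV i⟩
  refine ⟨V, U, H.continuousOn_V, H.continuousOn_U, H.V_zero, hVT,
    fun t ht => H.hasDerivWithinAt_V ht, fun t ht hVt => H.hasDerivWithinAt_U ht hVt,
    fun t ht hVt => H.U_ne_zero (Ioc_subset_Icc_self ht) hVt, ?_⟩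
  rw [hset, ← image_univ, hZinj.encard_image, encard_univ]
  simp

end ShootingData

/-! ### From the radial problem to the shooting problem. -/

/-- Bounded contributions are absorbed into the singular one, because Y^m |y|^(-m) ≥ 1 for 0 < |y| ≤
Y. -/
theorem SingularAtZero.exists_bound {f : ℝ → ℝ} {m : ℝ} (H2 : SingularAtZero f m)
    (hf : OddLocLipschitz f) (hm : 0 < m) {Y : ℝ} (hY : 0 < Y) :
    ∃ C > 0, ∀ y, y ≠ 0 → |y| ≤ Y → |f y| ≤ C * |y| ^ (-m) := by
  obtain ⟨g, hg, -, δ, hδ, hfg⟩ := H2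
  obtain ⟨G, hG⟩ := (isCompact_Icc (a := (0 : ℝ)) (b := Y)).exists_bound_of_continuousOn
    hg.continuous.continuousOn
  obtain ⟨B, hB⟩ := (isCompact_Icc (a := min δ Y) (b := Y)).exists_bound_of_continuousOn
    (f := f) (hf.2.continuousOn.mono fun x hx => ne_of_gt ((lt_min hδ hY).trans_le hx.1))
  have hG0 : 0 ≤ G := (norm_nonneg _).trans (hG 0 ⟨le_rfl, hY.le⟩)
  have hB0 : 0 ≤ B := (norm_nonneg _).trans (hB Y ⟨min_le_right _ _, le_rfl⟩)
  have key : ∀ y, 0 < y → y ≤ Y → |f y| ≤ (1 + (G + B) * Y ^ m) * y ^ (-m) := by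
    intro y h0 h
    have h1 : 1 ≤ Y ^ m * y ^ (-m) := by
      rw [Real.rpow_neg h0.le, ← div_eq_mul_inv, one_le_div (Real.rpow_pos_of_pos h0 _)]
      exact Real.rpow_le_rpow h0.le h hm.le
    have h2 : 0 < y ^ (-m) := Real.rpow_pos_of_pos h0 _
    have h3 := mul_le_mul_of_nonneg_left h1 (add_nonneg hG0 hB0)
    rcases lt_or_ge y δ with h' | h'
    · have e : |y| ^ (m - 1) * y = y ^ m := by
        rw [abs_of_pos h0, Real.rpow_sub_one h0.ne', div_mul_cancel₀ _ h0.ne']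
      rw [hfg y h0.ne' (by rwa [abs_of_pos h0]), e, one_div, ← Real.rpow_neg h0.le]
      have h4 := abs_add_le (-(y ^ (-m))) (g y)
      rw [abs_neg, abs_of_pos h2] at h4
      have h5 : |g y| ≤ G := hG y ⟨h0.le, h⟩
      linarith
    · have h5 : |f y| ≤ B := hB y ⟨(min_le_left _ _).trans h', h⟩
      linarith
  refine ⟨1 + (G + B) * Y ^ m, by positivity, fun y hy h => ?_⟩
  rcases abs_cases y with ⟨e, e'⟩ | ⟨e, e'⟩
  · rw [e] at h ⊢
    exact key y (lt_of_le_of_ne e' hy.symm) h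
  · rw [e] at h ⊢
    have := key (-y) (neg_pos.2 e') h
    rwa [hf.1 y hy, abs_neg] at this

theorem PowerAtInfinity.tendsto_div {f : ℝ → ℝ} {l s : ℝ} (H1 : PowerAtInfinity f l) (h : s < l) :
    Tendsto (fun x => f x / x ^ s) atTop atTop := by
  obtain ⟨g, -, ⟨M, hM⟩, hg⟩ := H1
  have h1 : Tendsto (fun x : ℝ => x ^ (l - s) * (1 / 2)) atTop atTop :=
    (tendsto_rpow_atTop (sub_pos.2 h)).atTop_mul_const (by norm_num)
  refine tendsto_atTop_mono' _ ?_ h1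
  filter_upwards [eventually_gt_atTop M, eventually_gt_atTop 0,
    hg.eventually_le_const (by norm_num : (0 : ℝ) < 1 / 2)] with x hx h0 hgx
  have hl : 0 < x ^ l := Real.rpow_pos_of_pos h0 _
  rw [abs_of_pos h0, div_le_iff₀ hl] at hgx
  rw [hM x (hx.trans_le (le_abs_self x)), abs_of_pos h0, Real.rpow_sub_one h0.ne',
    div_mul_cancel₀ _ h0.ne', le_div_iff₀ (Real.rpow_pos_of_pos h0 _), mul_right_comm,
    ← Real.rpow_add h0, sub_add_cancel]
  have := neg_abs_le (g x)
  linarith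

/-- In the variable t = r^(-c) the weight becomes a multiple of r^s K(r) with s = (N-1)p/(p-1). The
condition on rK'/K says that r^s K increases in r, hence that h decreases in t. -/
theorem exists_shootingData {N p R m α₁ l : ℝ} (hp : 1 < p) (hpN : p < N)
    (hR : 0 < R) (hl : p - 1 < l) (hm₀ : 0 < m) (hm₁ : m < 1)
    (hα₁ : N + m * (N - p) / (p - 1) < α₁) {K₁ : ℝ} {f K : ℝ → ℝ} (hf : OddLocLipschitz f)
    (H1 : PowerAtInfinity f l) (H2 : SingularAtZero f m) (H3 : UniquePositiveZero f)
    (hK : ContDiffOn ℝ 1 K (Ici R)) (hKpos : ∀ r ∈ Ici R, 0 < K r)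
    (hKd : ∀ r ∈ Ici R, -((N - 1) * p / (p - 1)) < r * derivWithin K (Ici R) r / K r)
    (hK₁ : 0 < K₁) (hKle : ∀ r ∈ Ici R, K r ≤ K₁ / r ^ α₁) :
    ∃ D : ShootingData, D.κ = 1 / (p - 1) ∧ D.T = R ^ (-((N - p) / (p - 1))) ∧ D.f = f ∧
      ∀ r ∈ Ici R, D.h (r ^ (-((N - p) / (p - 1)))) =
        ((N - p) / (p - 1)) ^ (-p) * (r ^ ((N - 1) * p / (p - 1)) * K r) := by
  have hp1 : 0 < p - 1 := by linarith
  have hNp : 0 < N - p := by linarith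
  set c := (N - p) / (p - 1) with hc
  have hc0 : 0 < c := div_pos hNp hp1
  set s := (N - 1) * p / (p - 1) with hs
  obtain ⟨β, hβ, hβ0, hβ1, hβ2⟩ := H3
  obtain ⟨C, hC, hCf⟩ := H2.exists_bound hf hm₀ hβ
  set q₁ := (s - α₁) / c with hq₁
  -- The natural exponent q₁ may be negative; replacing it by q costs the factor T^(q - q₁) in the
  -- constant A.
  set q := max 0 q₁ with hq
  have hqm : q + m < 1 := by
    rw [hq, max_add, max_lt_iff]
    refine ⟨by linarith, ?_⟩
    have h1 : s - α₁ < (1 - m) * c := by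
      -- Because s = N + c, the inequality q₁ < 1 - m is exactly the lower bound assumed on α₁.
      have h2 : s = N + c := by rw [hs, hc]; field_simp; ring
      have h3 : m * (N - p) / (p - 1) = m * c := by rw [hc]; ring
      rw [h3] at hα₁
      linarith
    have : q₁ < 1 - m := by rwa [hq₁, div_lt_iff₀ hc0]
    linarith
  set T := R ^ (-c) with hT
  have hT0 : 0 < T := Real.rpow_pos_of_pos hR _
  have hcc : -c * (-(1 / c)) = 1 := by field_simp
  have hinv : ∀ r : ℝ, 0 < r → (r ^ (-c)) ^ (-(1 / c)) = r := fun r hr => by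
    rw [← Real.rpow_mul hr.le, hcc, Real.rpow_one]
  have hρ : ∀ t : ℝ, 0 < t → t ≤ T → R ≤ t ^ (-(1 / c)) := fun t h0 h => by
    have := Real.rpow_le_rpow_of_nonpos h0 h (neg_nonpos.2 (one_div_pos.2 hc0).le)
    rwa [hT, hinv R hR] at this
  have hρ' : ∀ t : ℝ, 0 < t → t < T → R < t ^ (-(1 / c)) := fun t h0 h => by
    have := Real.rpow_lt_rpow_of_neg h0 h (neg_lt_zero.2 (one_div_pos.2 hc0))
    rwa [hT, hinv R hR] at this
  have hρc : ContinuousOn (fun t : ℝ => t ^ (-(1 / c))) (Ioc 0 T) := fun t ht =>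
    (Real.continuousAt_rpow_const _ _ (Or.inl ht.1.ne')).continuousWithinAt
  let g : ℝ → ℝ := fun r => c ^ (-p) * (r ^ s * K r)
  have hgc : ContinuousOn g (Ici R) := continuousOn_const.mul
    (ContinuousOn.mul (fun r hr => (Real.continuousAt_rpow_const _ _
      (Or.inl (ne_of_gt (hR.trans_le hr)))).continuousWithinAt) hK.continuousOn)
  have hgd : ∀ r, R < r → HasDerivAt g
      (c ^ (-p) * (s * r ^ (s - 1) * K r + r ^ s * derivWithin K (Ici R) r)) r := by
    intro r hr
    have h1 : HasDerivAt K (derivWithin K (Ici R) r) r :=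
      ((hK.differentiableOn one_ne_zero r hr.le).hasDerivWithinAt).hasDerivAt (Ici_mem_nhds hr)
    exact ((Real.hasDerivAt_rpow_const (Or.inl (hR.trans hr).ne')).mul h1).const_mul _
  have hcp : 0 < c ^ (-p) := Real.rpow_pos_of_pos hc0 _
  have hgd0 : ∀ r, R < r →
      0 ≤ c ^ (-p) * (s * r ^ (s - 1) * K r + r ^ s * derivWithin K (Ici R) r) := by
    intro r hr
    have hr0 := hR.trans hr
    have h1 := hKd r hr.le
    rw [lt_div_iff₀ (hKpos r hr.le)] at h1
    have h2 : r ^ s = r ^ (s - 1) * r := by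
      rw [Real.rpow_sub_one hr0.ne', div_mul_cancel₀ _ hr0.ne']
    have h3 : s * r ^ (s - 1) * K r + r ^ s * derivWithin K (Ici R) r =
        r ^ (s - 1) * (s * K r + r * derivWithin K (Ici R) r) := by rw [h2]; ring
    rw [h3]
    have h4 : 0 < r ^ (s - 1) := Real.rpow_pos_of_pos hr0 _
    exact mul_nonneg hcp.le (mul_nonneg h4.le (by linarith))
  have hρd : ∀ t ∈ Ioo 0 T, HasDerivAt (fun t : ℝ => t ^ (-(1 / c)))
      (-(1 / c) * t ^ (-(1 / c) - 1)) t := fun t ht =>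
    Real.hasDerivAt_rpow_const (Or.inl ht.1.ne')
  refine ⟨{
    κ := 1 / (p - 1), m := m, q := q, T := T, β := β
    A := c ^ (-p) * K₁ * T ^ (q - q₁), C := C, f := f
    h := fun t => g (t ^ (-(1 / c)))
    h' := fun t => c ^ (-p) * (s * (t ^ (-(1 / c))) ^ (s - 1) * K (t ^ (-(1 / c))) +
      (t ^ (-(1 / c))) ^ s * derivWithin K (Ici R) (t ^ (-(1 / c)))) *
      (-(1 / c) * t ^ (-(1 / c) - 1))
    κ_pos := one_div_pos.2 hp1
    m_pos := hm₀
    q_nonneg := le_max_left _ _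
    mq := hqm
    T_pos := hT0
    β_pos := hβ
    A_pos := by positivity
    C_pos := hC
    f_odd := hf.1
    f_lip := hf.2.mono fun x hx => ne_of_gt hx
    f_nonpos := fun x h0 h => by
      rcases h.eq_or_lt with rfl | h
      · exact hβ0.le
      · exact (hβ1 x ⟨h0, h⟩).le
    f_nonneg := fun x h => by
      rcases h.eq_or_lt with rfl | h
      · exact hβ0.ge
      · exact (hβ2 x h).le
    f_bound := fun x h0 h => by
      have := hCf x h0.ne' (by rwa [abs_of_pos h0])
      rwa [abs_of_pos h0] at this
    f_super := by
      rw [one_div_one_div]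
      exact H1.tendsto_div hl
    h_pos := fun t ht => by
      have h1 := hρ t ht.1 ht.2
      have h2 := hKpos _ h1
      have h3 : 0 < (t ^ (-(1 / c))) ^ s := Real.rpow_pos_of_pos (hR.trans_le h1) _
      exact mul_pos hcp (mul_pos h3 h2)
    h_cont := hgc.comp hρc fun t ht => hρ t ht.1 ht.2
    h_deriv := fun t ht => HasDerivAt.comp (h₂ := g) t (hgd _ (hρ' t ht.1 ht.2)) (hρd t ht)
    h'_nonpos := fun t ht => by
      refine mul_nonpos_of_nonneg_of_nonpos (hgd0 _ (hρ' t ht.1 ht.2)) ?_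
      have h1 : 0 < t ^ (-(1 / c) - 1) := Real.rpow_pos_of_pos ht.1 _
      have h2 : 0 < 1 / c := one_div_pos.2 hc0
      nlinarith
    h_bound := fun t ht => by
      have h1 := hρ t ht.1 ht.2
      have hr0 := hR.trans_le h1
      have h2 := hKle _ h1
      have h3 : 0 < (t ^ (-(1 / c))) ^ s := Real.rpow_pos_of_pos hr0 _
      have h4 : (t ^ (-(1 / c))) ^ s * (K₁ / (t ^ (-(1 / c))) ^ α₁) = K₁ * t ^ (-q₁) := by
        have : t ^ (-q₁) = (t ^ (-(1 / c))) ^ s / (t ^ (-(1 / c))) ^ α₁ := by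
          rw [← Real.rpow_sub hr0, ← Real.rpow_mul ht.1.le]
          congr 1
          rw [hq₁]; ring
        rw [this]; ring
      have h5 : t ^ (-q₁) ≤ T ^ (q - q₁) * t ^ (-q) := by
        have : t ^ (-q₁) = t ^ (q - q₁) * t ^ (-q) := by
          rw [← Real.rpow_add ht.1]; congr 1; ring
        rw [this]
        exact mul_le_mul_of_nonneg_right (Real.rpow_le_rpow ht.1.le ht.2
          (sub_nonneg.2 (le_max_right _ _))) (Real.rpow_nonneg ht.1.le _)
      calc c ^ (-p) * ((t ^ (-(1 / c))) ^ s * K (t ^ (-(1 / c))))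
          ≤ c ^ (-p) * ((t ^ (-(1 / c))) ^ s * (K₁ / (t ^ (-(1 / c))) ^ α₁)) := by gcongr
        _ = c ^ (-p) * (K₁ * t ^ (-q₁)) := by rw [h4]
        _ ≤ c ^ (-p) * (K₁ * (T ^ (q - q₁) * t ^ (-q))) := by gcongr
        _ = _ := by ring }, rfl, rfl, rfl, fun r hr => ?_⟩
  have hr0 : 0 < r := hR.trans_le hr
  simp only [g, hinv r hr0]

/-! ### Integrability of the singular term and the radial solution. -/

theorem pPhi_neg (p x : ℝ) : pPhi p (-x) = -pPhi p x := by
  rw [pPhi, pPhi, abs_neg, mul_neg]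

theorem pPhi_mul {p b : ℝ} (hb : 0 < b) (y : ℝ) : pPhi p (y * b) = pPhi p y * b ^ (p - 1) := by
  have : b ^ (p - 1) = b ^ (p - 2) * b := by
    rw [← Real.rpow_add_one hb.ne']; congr 1; ring
  rw [pPhi, pPhi, abs_mul, abs_of_pos hb, Real.mul_rpow (abs_nonneg _) hb.le, this]
  ring

theorem pPhi_signedPow {p : ℝ} (hp : 1 < p) (x : ℝ) :
    pPhi p (signedPow (1 / (p - 1)) x) = x := by
  have hp1 : 0 < p - 1 := by linarith
  have key : ∀ y, 0 ≤ y → pPhi p (signedPow (1 / (p - 1)) y) = y := by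
    intro y hy
    rw [signedPow_of_nonneg (one_div_pos.2 hp1) hy]
    rcases hy.eq_or_lt with rfl | hy
    · rw [Real.zero_rpow (one_div_pos.2 hp1).ne', pPhi, mul_zero]
    · have h1 : 0 < y ^ (1 / (p - 1)) := Real.rpow_pos_of_pos hy _
      rw [pPhi, abs_of_pos h1, ← Real.rpow_add_one h1.ne', ← Real.rpow_mul hy.le]
      have : 1 / (p - 1) * (p - 2 + 1) = 1 := by field_simp; ring
      rw [this, Real.rpow_one]
  rcases le_total 0 x with h | h
  · exact key x h
  · have := key (-x) (by linarith)
    rw [signedPow_neg, pPhi_neg] at this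
    linarith

theorem integrableOn_abs_sub_rpow {m : ℝ} (hm : m < 1) (x δ : ℝ) :
    IntegrableOn (fun s : ℝ => |s - x| ^ (-m)) (Ioo (x - δ) (x + δ)) := by
  have h1 : IntegrableOn (fun s : ℝ => |s| ^ (-m)) (Metric.ball 0 δ) :=
    integrableOn_ball_of_norm_le_rpow (C := 1) (α := m) (by simp) (by simpa using hm)
      (Eventually.of_forall fun s => by
        rw [one_mul, Real.norm_eq_abs, Real.norm_eq_abs,
          abs_of_nonneg (Real.rpow_nonneg (abs_nonneg _) _)])
      ((continuous_abs.measurable.pow_const _).aestronglyMeasurable)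
  have h2 := (measurePreserving_sub_right (volume : Measure ℝ) x).integrableOn_comp_preimage
    (MeasurableEquiv.subRight x).measurableEmbedding (f := fun s : ℝ => |s| ^ (-m))
    (s := Metric.ball 0 δ)
  have h3 := h2.2 h1
  refine h3.mono_set fun s hs => ?_
  rw [mem_preimage, Metric.mem_ball, Real.dist_eq, sub_zero, abs_lt]
  constructor <;> linarith [hs.1, hs.2]

/-- Zeros of u are simple, so near any x one has |u(s)| ≥ b|s - x|, and |s - x|^(-m) is integrable
because m < 1. -/
theorem locallyIntegrableOn_one_div_abs_rpow {m R : ℝ} (hm₀ : 0 < m) (hm : m < 1) {u u' : ℝ → ℝ}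
    (hu : ∀ r ∈ Ici R, HasDerivWithinAt u (u' r) (Ici R) r)
    (hne : ∀ r ∈ Ici R, u r = 0 → u' r ≠ 0) :
    LocallyIntegrableOn (fun r => 1 / |u r| ^ m) (Ici R) := by
  have huc : ContinuousOn u (Ici R) := fun r hr => (hu r hr).continuousWithinAt
  intro x hx
  obtain ⟨b, hb, hev⟩ : ∃ b > 0, ∀ᶠ s in 𝓝[Ici R] x, b * |s - x| ≤ |u s| := by
    by_cases h0 : u x = 0
    · have hL := abs_pos.2 (hne x hx h0)
      refine ⟨|u' x| / 2, half_pos hL, ?_⟩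
      have := (Asymptotics.isLittleO_iff.1 (hasDerivWithinAt_iff_isLittleO.1 (hu x hx)))
        (half_pos hL)
      filter_upwards [this] with s hs
      rw [h0, sub_zero, smul_eq_mul, Real.norm_eq_abs, Real.norm_eq_abs] at hs
      have h1 := abs_sub_abs_le_abs_sub ((s - x) * u' x) (u s)
      rw [abs_sub_comm, abs_mul] at h1
      linarith
    -- Where u(x) ≠ 0 the same linear lower bound holds trivially for |s - x| < 1, so both cases
    -- share one estimate.
    · have hL := abs_pos.2 h0
      refine ⟨|u x| / 2, half_pos hL, ?_⟩
      have h1 : ∀ᶠ s in 𝓝[Ici R] x, |u x| / 2 < |u s| :=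
        (huc x hx).abs.eventually_const_lt (half_lt_self hL)
      have h2 : ∀ᶠ s in 𝓝[Ici R] x, |s - x| < 1 := nhdsWithin_le_nhds (by
        filter_upwards [Metric.ball_mem_nhds x one_pos] with s hs
        rwa [Metric.mem_ball, Real.dist_eq] at hs)
      filter_upwards [h1, h2] with s e1 e2
      nlinarith
  obtain ⟨δ, hδ, hsub⟩ := Metric.mem_nhdsWithin_iff.1 hev
  refine ⟨Metric.ball x δ ∩ Ici R, inter_mem (mem_nhdsWithin_of_mem_nhds
    (Metric.ball_mem_nhds x hδ)) self_mem_nhdsWithin, ?_⟩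
  have hint : IntegrableOn (fun s : ℝ => b ^ (-m) * |s - x| ^ (-m)) (Metric.ball x δ ∩ Ici R) := by
    refine IntegrableOn.mono_set ((integrableOn_abs_sub_rpow hm x δ).const_mul _) fun s hs => ?_
    have := hs.1
    rwa [Real.ball_eq_Ioo] at this
  have hmeas : MeasurableSet (Metric.ball x δ ∩ Ici R) := measurableSet_ball.inter measurableSet_Ici
  refine Integrable.mono' hint ?_ ?_
  · have h1 : AEMeasurable u (volume.restrict (Metric.ball x δ ∩ Ici R)) :=
      (huc.mono inter_subset_right).aemeasurable hmeas
    have h2 : Measurable fun y : ℝ => 1 / |y| ^ m :=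
      (continuous_abs.measurable.pow_const _).const_div 1
    exact (h2.comp_aemeasurable h1).aestronglyMeasurable
  · have hx0 : ∀ᵐ s ∂(volume.restrict (Metric.ball x δ ∩ Ici R)), s ≠ x :=
      ae_restrict_of_ae (by simp [ae_iff])
    filter_upwards [ae_restrict_mem hmeas, hx0] with s hs hsx
    have h1 : b * |s - x| ≤ |u s| := hsub hs
    have h2 : 0 < |s - x| := abs_pos.2 (sub_ne_zero.2 hsx)
    have h3 : 0 < |u s| := (mul_pos hb h2).trans_le h1
    rw [Real.norm_eq_abs, abs_of_nonneg (by positivity), one_div, ← Real.rpow_neg h3.le,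
      ← Real.mul_rpow hb.le h2.le]
    exact Real.rpow_le_rpow_of_nonpos (mul_pos hb h2) h1 (by linarith)

theorem integrableOn_force {m R r ν : ℝ} (hR : 0 < R) {f K u : ℝ → ℝ}
    (hm : 0 < m) (hf : OddLocLipschitz f) (H2 : SingularAtZero f m) (hK : ContinuousOn K (Ici R))
    (hu : ContinuousOn u (Ici R)) (hae : ∀ᵐ r ∂(volume.restrict (Ici R)), u r ≠ 0)
    (hloc : LocallyIntegrableOn (fun r => 1 / |u r| ^ m) (Ici R)) :
    IntegrableOn (fun t => t ^ ν * K t * f (u t)) (Icc R r) := by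
  have hsub : Icc R r ⊆ Ici R := fun x hx => hx.1
  have hw : ContinuousOn (fun t => t ^ ν * K t) (Icc R r) := ContinuousOn.mul
    (fun t ht => (Real.continuousAt_rpow_const _ _
      (Or.inl (ne_of_gt (hR.trans_le ht.1)))).continuousWithinAt) (hK.mono hsub)
  obtain ⟨A, hA⟩ := isCompact_Icc.exists_bound_of_continuousOn hw
  obtain ⟨Y, hY⟩ := isCompact_Icc.exists_bound_of_continuousOn (hu.mono hsub)
  obtain ⟨C, hC, hCf⟩ := H2.exists_bound hf hm (Y := max Y 1) (lt_max_of_lt_right one_pos)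
  have hint := (hloc.integrableOn_compact_subset hsub isCompact_Icc).const_mul (A * C)
  have hfm : Measurable f := measurable_of_continuousOn_compl_singleton 0 hf.2.continuousOn
  refine Integrable.mono' hint ?_ ?_
  · exact ((hw.aemeasurable measurableSet_Icc).mul (hfm.comp_aemeasurable
      ((hu.mono hsub).aemeasurable measurableSet_Icc))).aestronglyMeasurable
  · filter_upwards [ae_restrict_mem measurableSet_Icc,
      ae_restrict_of_ae_restrict_of_subset hsub hae] with t ht hut
    have h1 := hCf (u t) hut ((hY t ht).trans (le_max_left _ _))
    have h2 : 1 / |u t| ^ m = |u t| ^ (-m) := by rw [Real.rpow_neg (abs_nonneg _), one_div]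
    rw [norm_mul, h2, mul_assoc]
    exact mul_le_mul (hA t ht) h1 (norm_nonneg _) ((norm_nonneg _).trans (hA t ht))

theorem theorem1 (N : ℕ) (hN : 2 < N) (p : ℝ) (hp : 1 < p) (hpN : p < (N : ℝ))
    (R : ℝ) (hR : 0 < R)
    (l m α α₁ : ℝ) (hl : p - 1 < l) (hm₀ : 0 < m) (hm₁ : m < 1)
    (hα₁ : (N : ℝ) + m * ((N : ℝ) - p) / (p - 1) < α₁) (hαα : α₁ ≤ α)
    (hα : α < 2 * ((N : ℝ) - 1))
    (f K : ℝ → ℝ) (hf : OddLocLipschitz f) (H1 : PowerAtInfinity f l)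
    (H2 : SingularAtZero f m) (H3 : UniquePositiveZero f)
    (H4 : WeightCondition N p R α α₁ K) :
    ∃ n₀ : ℕ, ∀ n : ℕ, n₀ ≤ n →
      ∃ u : ℝ → ℝ, IsRadialSolution N p R m f K u ∧
        {r : ℝ | R < r ∧ u r = 0}.encard = (n : ℕ∞) := by
  obtain ⟨hK, hKpos, hKd, K₀, K₁, hK₀, hK₁, hKb⟩ := H4
  obtain ⟨D, hDκ, hDT, hDf, hDh⟩ := exists_shootingData hp hpN hR hl hm₀ hm₁ hα₁ hf H1 H2 H3
    hK hKpos hKd hK₁ fun r hr => (hKb r hr).2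
  have hp1 : 0 < p - 1 := by linarith
  have hNp : 0 < (N : ℝ) - p := by linarith
  set c := ((N : ℝ) - p) / (p - 1) with hc
  have hc0 : 0 < c := div_pos hNp hp1
  have hcc : -c * (-(1 / c)) = 1 := by field_simp
  have hτ : ∀ r ∈ Ici R, r ^ (-c) ∈ Ioc 0 D.T := fun r hr => by
    rw [hDT]
    exact ⟨Real.rpow_pos_of_pos (hR.trans_le hr) _,
      Real.rpow_le_rpow_of_nonpos hR hr (neg_nonpos.2 hc0.le)⟩
  have hτ' : ∀ r, R < r → r ^ (-c) < D.T := fun r hr => by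
    rw [hDT]
    exact Real.rpow_lt_rpow_of_neg hR hr (neg_lt_zero.2 hc0)
  have hτc : ContinuousOn (fun r : ℝ => r ^ (-c)) (Ici R) := fun r hr =>
    (Real.continuousAt_rpow_const _ _ (Or.inl (ne_of_gt (hR.trans_le hr)))).continuousWithinAt
  have hτd : ∀ r ∈ Ici R, HasDerivAt (fun r : ℝ => r ^ (-c)) (-c * r ^ (-c - 1)) r :=
    fun r hr => Real.hasDerivAt_rpow_const (Or.inl (ne_of_gt (hR.trans_le hr)))
  obtain ⟨n₀, hn₀⟩ := D.exists_singularSol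
  refine ⟨n₀, fun n hn => ?_⟩
  obtain ⟨V, U, S⟩ := hn₀ n hn
  set u : ℝ → ℝ := fun r => V (r ^ (-c)) with hu
  set u' : ℝ → ℝ := fun r => signedPow D.κ (U (r ^ (-c))) * (-c * r ^ (-c - 1)) with hu'
  have hud : ∀ r ∈ Ici R, HasDerivWithinAt u (u' r) (Ici R) r := fun r hr =>
    (S.dV _ (hτ r hr)).comp r (hτd r hr).hasDerivWithinAt
      fun x hx => Ioc_subset_Icc_self (hτ x hx)
  have hdw : ∀ r ∈ Ici R, derivWithin u (Ici R) r = u' r := fun r hr =>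
    (hud r hr).derivWithin (uniqueDiffOn_Ici R r hr)
  have huc : ContinuousOn u (Ici R) := fun r hr => (hud r hr).continuousWithinAt
  have hUc : ContinuousOn (fun r => U (r ^ (-c))) (Ici R) := S.continuousOn_U.comp hτc hτ
  have hu'c : ContinuousOn u' (Ici R) :=
    ((continuous_signedPow D.κ_pos).comp_continuousOn hUc).mul (continuousOn_const.mul
      fun r hr => (Real.continuousAt_rpow_const _ _
        (Or.inl (ne_of_gt (hR.trans_le hr)))).continuousWithinAt)
  -- The flux is -c^(p-1) U: `signedPow` inverts `pPhi`, and (-c-1)(p-1) = -(N-1) cancels the power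
  -- of r. In particular a zero of u' where u = 0 would be a common zero of V and U.
  have hflux : ∀ r ∈ Ici R,
      r ^ ((N : ℝ) - 1) * pPhi p (u' r) = -(c ^ (p - 1) * U (r ^ (-c))) := by
    intro r hr
    have hr0 : 0 < r := hR.trans_le hr
    have h1 : 0 < r ^ (-c - 1) := Real.rpow_pos_of_pos hr0 _
    have e : u' r = -(signedPow D.κ (U (r ^ (-c))) * (c * r ^ (-c - 1))) := by
      rw [hu']; ring
    have h2 : (-c - 1) * (p - 1) = -((N : ℝ) - 1) := by rw [hc]; field_simp; ring
    rw [e, pPhi_neg, pPhi_mul (mul_pos hc0 h1), hDκ, pPhi_signedPow hp,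
      Real.mul_rpow hc0.le h1.le, ← Real.rpow_mul hr0.le, h2]
    have h3 : r ^ ((N : ℝ) - 1) * r ^ (-((N : ℝ) - 1)) = 1 := by
      rw [← Real.rpow_add hr0, add_neg_cancel, Real.rpow_zero]
    linear_combination (-(U (r ^ (-c)) * c ^ (p - 1))) * h3
  have hne : ∀ r ∈ Ici R, u r = 0 → u' r ≠ 0 := by
    intro r hr h0 h
    have := hflux r hr
    rw [h, pPhi, mul_zero, mul_zero, eq_comm, neg_eq_zero] at this
    rcases mul_eq_zero.1 this with h1 | h1
    · exact (Real.rpow_pos_of_pos hc0 (p - 1)).ne' h1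
    · exact S.U_ne_zero _ (hτ r hr) h0 h1
  have hzeros : {r : ℝ | R < r ∧ u r = 0} =
      (fun t : ℝ => t ^ (-(1 / c))) '' {t | t ∈ Ioo 0 D.T ∧ V t = 0} := by
    have hinv : ∀ x : ℝ, 0 < x → (x ^ (-c)) ^ (-(1 / c)) = x := fun x hx => by
      rw [← Real.rpow_mul hx.le, hcc, Real.rpow_one]
    have hinv' : ∀ x : ℝ, 0 < x → (x ^ (-(1 / c))) ^ (-c) = x := fun x hx => by
      rw [← Real.rpow_mul hx.le, mul_comm, hcc, Real.rpow_one]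
    ext r
    constructor
    · rintro ⟨hr, h0⟩
      exact ⟨r ^ (-c), ⟨⟨(hτ r hr.le).1, hτ' r hr⟩, h0⟩, hinv r (hR.trans hr)⟩
    · rintro ⟨t, ⟨ht, h0⟩, rfl⟩
      refine ⟨?_, ?_⟩
      · have := Real.rpow_lt_rpow_of_neg ht.1 ht.2 (neg_lt_zero.2 (one_div_pos.2 hc0))
        rwa [hDT, hinv R hR] at this
      · simp only [hu, hinv' t ht.1, h0]
  have hcard : {r : ℝ | R < r ∧ u r = 0}.encard = (n : ℕ∞) := by
    rw [hzeros, InjOn.encard_image, S.encard]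
    intro s hs t ht hst
    exact (Real.strictAntiOn_rpow_Ioi_of_exponent_neg
      (neg_lt_zero.2 (one_div_pos.2 hc0))).injOn hs.1.1 ht.1.1 hst
  have hfin : {r : ℝ | R < r ∧ u r = 0}.Finite := by
    rw [← encard_ne_top_iff, hcard]
    exact ENat.natCast_ne_top n
  have hcount : (insert R {r : ℝ | R < r ∧ u r = 0}).Countable := (hfin.insert R).countable
  have hae : ∀ᵐ r ∂(volume.restrict (Ici R)), u r ≠ 0 := by
    have h1 : ∀ᵐ r ∂(volume.restrict (Ici R)), r ∉ insert R {r : ℝ | R < r ∧ u r = 0} :=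
      ae_restrict_of_ae (hcount.ae_notMem _)
    filter_upwards [h1, ae_restrict_mem measurableSet_Ici] with r hr hrR h0
    rcases (show R ≤ r from hrR).eq_or_lt with h | h
    · exact hr (Or.inl h.symm)
    · exact hr (Or.inr ⟨h, h0⟩)
  have hloc := locallyIntegrableOn_one_div_abs_rpow hm₀ hm₁ hud hne
  have hint : ∀ r ∈ Ici R,
      IntervalIntegrable (fun t => t ^ ((N : ℝ) - 1) * K t * f (u t)) volume R r := fun r hr => by
    rw [intervalIntegrable_iff_integrableOn_Icc_of_le hr]
    exact integrableOn_force hR hm₀ hf H2 hK.continuousOn huc hae hloc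
  refine ⟨u, ⟨?_, hae, hloc, hint, fun r hr => ?_, ?_, ?_⟩, hcard⟩
  · rw [contDiffOn_one_iff_derivWithin (uniqueDiffOn_Ici R)]
    exact ⟨fun r hr => (hud r hr).differentiableWithinAt, hu'c.congr hdw⟩
  -- U is continuous but has no claimed derivative at zeros of V. The zero set is finite and the
  -- force integrable, so the fundamental theorem still applies.
  · have hΓ := MeasureTheory.integral_eq_of_hasDerivAt_off_countable
      (fun r => c ^ (p - 1) * U (r ^ (-c))) (fun t => t ^ ((N : ℝ) - 1) * K t * f (u t)) hcount
      (a := R) (b := r) ?_ ?_ (hint r hr)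
    · rw [hdw r hr, hdw R self_mem_Ici, hflux r hr, hflux R self_mem_Ici, hΓ]
      ring
    · rw [uIcc_of_le hr]
      exact (continuousOn_const.mul hUc).mono fun x hx => hx.1
    · rw [min_eq_left hr, max_eq_right hr]
      rintro x ⟨hx, hxn⟩
      have hx0 : 0 < x := hR.trans hx.1
      have hux : V (x ^ (-c)) ≠ 0 := fun h => hxn (Or.inr ⟨hx.1, h⟩)
      have h1 := (S.dU _ (hτ x hx.1.le) hux).hasDerivAt
        (Icc_mem_nhds (hτ x hx.1.le).1 (hτ' x hx.1))
      refine ((h1.comp x (hτd x hx.1.le)).const_mul (c ^ (p - 1))).congr_deriv ?_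
      rw [hDh x hx.1.le, hDf]
      -- The factor c^(-p) in h was chosen for this: it cancels c^(p-1) from the flux and c from
      -- dt/dr.
      have e1 : c ^ (p - 1) * c ^ (-p) * c = 1 := by
        rw [← Real.rpow_add hc0, ← Real.rpow_add_one hc0.ne']
        have : p - 1 + -p + 1 = 0 := by ring
        rw [this, Real.rpow_zero]
      have e2 : x ^ (((N : ℝ) - 1) * p / (p - 1)) * x ^ (-c - 1) = x ^ ((N : ℝ) - 1) := by
        rw [← Real.rpow_add hx0]
        congr 1
        rw [hc]; field_simp; ring
      rw [← e2]
      linear_combination (x ^ (((N : ℝ) - 1) * p / (p - 1)) * x ^ (-c - 1) * K x *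
        f (V (x ^ (-c)))) * e1
  · simp only [hu, ← hDT, S.V_T]
  · have h1 : Tendsto (fun r : ℝ => r ^ (-c)) atTop (𝓝[Icc 0 D.T] 0) := by
      refine tendsto_nhdsWithin_iff.2 ⟨tendsto_rpow_neg_atTop hc0, ?_⟩
      filter_upwards [eventually_ge_atTop R] with r hr
      exact Ioc_subset_Icc_self (hτ r hr)
    have h2 := (S.continuousOn_V 0 ⟨le_rfl, D.T_pos.le⟩).tendsto.comp h1
    rwa [S.V_zero] at h2
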